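/- Let $G$ be a compact connected Lie group. By the existence of faithful unitary representations we regard $G$ as a compact subgroup of some $U(n)$; write $\mathfrak g$ for its Lie algebra, $\mathfrak g^{\mathbb C}=\mathfrak g\oplus i\mathfrak g$, $G^{\mathbb C}\subset GL(n,\mathbb C)$ for its complexification (the subgroup generated by $G$ and $\exp(\mathfrak g^{\mathbb C})$), and $A^\star$ for the conjugate transpose of a matrix $A$. The decoupled octonionic Nahm equations on $[0,1]$ for functions $\alpha,\beta_1,\beta_2,\beta_3:[0,1]\to\mathfrak g^{\mathbb C}$ are $$\frac{d\beta_i}{dt}+2[\alpha,\beta_i]=0,\qquad [\beta_i,\beta_j]=0\qquad(i,j=1,2,3),$$ $$\frac{d}{dt}(\alpha+\alpha^\star)+2\Bigl([\alpha,\alpha^\star]+\sum_{i=1}^3[\beta_i,\beta_i^\star]\Bigr)=0.$$ Let $\mathcal G_0$ be the group of $C^2$ maps $g:[0,1]\to G$ with $g(0)=g(1)=1$; it acts by $\alpha\mapsto g\alpha g^{-1}-\frac12\frac{dg}{dt}g^{-1}$, $\beta_i\mapsto g\beta_ig^{-1}$. Let $\mathcal M$ be the set of solutions of these equations that are smooth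 on $[0,1]$, where two solutions are identified if an element of $\mathcal G_0$ takes one to the other, and let $$N=\{(g,t_1,t_2,t_3)\in G^{\mathbb C}\times(\mathfrak g^{\mathbb C})^3 : [t_i,t_j]=0 \text{ for all } i,j\}.$$ For every smooth solution $(\alpha,\beta_1,\beta_2,\beta_3)$ there is a unique $C^2$ map $g:[0,1]\to G^{\mathbb C}$ with $\frac{dg}{dt}=2g\alpha$ and $g(0)=1$, and the functions $g\beta_ig^{-1}$ are constant on $[0,1]$. The assignment $$\Theta:(\alpha,\beta_1,\beta_2,\beta_3)\longmapsto\bigl(g(1),\,g\beta_1g^{-1},\,g\beta_2g^{-1},\,g\beta_3g^{-1}\bigr)$$ induces a well-defined map $\Theta:\mathcal M\to N$, and this map is a bijection. -/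

import Mathlib

namespace OctonionicNahm

/-- Complex `n × n` matrices. -/
abbrev Mat (n : ℕ) : Type := Matrix (Fin n) (Fin n) ℂ

/-- The closed unit interval `[0,1]`. Paths on it are functions on `ℝ` of which only the values on
`[0,1]` are ever used; derivatives on it are one-sided at the end points. -/
abbrev I01 : Set ℝ := Set.Icc 0 1

/-- The derivative at `t` of a path of matrices on `[0,1]`, entry by entry. -/
noncomputable def D {n : ℕ} (A : ℝ → Mat n) (t : ℝ) : Mat n :=
  Matrix.of fun i j => derivWithin (fun s => A s i j) I01 t

/-- A path of matrices is of class `C^k` on `[0,1]` (smooth for `k = ⊤`) if its entries are. -/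
def IsClass {n : ℕ} (k : ℕ∞) (A : ℝ → Mat n) : Prop :=
  ∀ i j, ContDiffOn ℝ k (fun s => A s i j) I01

/-- A compact connected Lie group. Every compact Lie group has a faithful unitary representation,
so it is taken, up to isomorphism, as a compact group of unitary `n × n` matrices. The operation
`*` on the complexified Lie algebra (with `X* = -X` on `𝔤`, antilinear) and on the complexified
group is then the conjugate transpose. -/
structure IsCompactConnectedUnitary {n : ℕ} (G : Subgroup (GL (Fin n) ℂ)) : Prop where
  unitary : ∀ g ∈ G, (g : Mat n) ∈ Matrix.unitaryGroup (Fin n) ℂ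
  compact : IsCompact (G : Set (GL (Fin n) ℂ))
  connected : IsConnected (G : Set (GL (Fin n) ℂ))

/-- The Lie algebra `𝔤` of `G`: all `X` whose one-parameter group `exp (tX)` lies in `G`. -/
def lieAlg {n : ℕ} (G : Subgroup (GL (Fin n) ℂ)) : Set (Mat n) :=
  {X | ∀ t : ℝ, ∃ g ∈ G, (g : Mat n) = NormedSpace.exp (t • X)}

/-- The complexified Lie algebra `𝔤 ⊕ i𝔤`. -/
def lieAlgC {n : ℕ} (G : Subgroup (GL (Fin n) ℂ)) : Set (Mat n) :=
  {Z | ∃ X ∈ lieAlg G, ∃ Y ∈ lieAlg G, Z = X + Complex.I • Y}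

/-- The complexification `G^ℂ`: the subgroup of `GL(n,ℂ)` generated by `G` and `exp (𝔤 ⊕ i𝔤)`. -/
def complexification {n : ℕ} (G : Subgroup (GL (Fin n) ℂ)) : Subgroup (GL (Fin n) ℂ) :=
  Subgroup.closure
    ((G : Set (GL (Fin n) ℂ)) ∪ {g | ∃ Z ∈ lieAlgC G, (g : Mat n) = NormedSpace.exp Z})

/-- Gauge transformations with values in a matrix group `H`: `C²` maps `[0,1] → H`. -/
structure IsGauge {n : ℕ} (H : Subgroup (GL (Fin n) ℂ)) (g : ℝ → GL (Fin n) ℂ) : Prop where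
  mem : ∀ t ∈ I01, g t ∈ H
  isClass : IsClass 2 (fun t => (g t : Mat n))

/-- The group `𝒢₀` of gauge transformations that are the identity at both ends. -/
structure IsBasedGauge {n : ℕ} (H : Subgroup (GL (Fin n) ℂ)) (g : ℝ → GL (Fin n) ℂ) : Prop
    extends IsGauge H g where
  zero : g 0 = 1
  one : g 1 = 1

/-- `g α g⁻¹ - ½ (dg/dt) g⁻¹`. -/
noncomputable def gaugeα {n : ℕ} (g : ℝ → GL (Fin n) ℂ) (α : ℝ → Mat n) (t : ℝ) : Mat n :=
  (g t : Mat n) * α t * ((g t)⁻¹ : GL (Fin n) ℂ)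
    - (1 / 2 : ℝ) • (D (fun s => (g s : Mat n)) t * ((g t)⁻¹ : GL (Fin n) ℂ))

/-- `g β g⁻¹`. -/
noncomputable def gaugeβ {n : ℕ} (g : ℝ → GL (Fin n) ℂ) (β : ℝ → Mat n) (t : ℝ) : Mat n :=
  (g t : Mat n) * β t * ((g t)⁻¹ : GL (Fin n) ℂ)

/-- Smooth solutions on `[0,1]` of the decoupled octonionic Nahm equations of `G`. Here `ᴴ` is the
conjugate transpose and `⁅A, B⁆ = A * B - B * A`. -/
structure Solution {n : ℕ} (G : Subgroup (GL (Fin n) ℂ)) where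
  α : ℝ → Mat n
  β : Fin 3 → ℝ → Mat n
  α_mem : ∀ t ∈ I01, α t ∈ lieAlgC G
  β_mem : ∀ i, ∀ t ∈ I01, β i t ∈ lieAlgC G
  α_smooth : IsClass ⊤ α
  β_smooth : ∀ i, IsClass ⊤ (β i)
  complex_eq : ∀ i, ∀ t ∈ I01, D (β i) t + (2 : ℝ) • ⁅α t, β i t⁆ = 0
  comm : ∀ i j, ∀ t ∈ I01, ⁅β i t, β j t⁆ = 0
  real_eq : ∀ t ∈ I01, D (fun s => α s + (α s).conjTranspose) t
    + (2 : ℝ) • (⁅α t, (α t).conjTranspose⁆ + ∑ i, ⁅β i t, (β i t).conjTranspose⁆) = 0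

/-- `x` and `y` are in the same orbit of `𝒢₀`. -/
def GaugeEquiv {n : ℕ} {G : Subgroup (GL (Fin n) ℂ)} (x y : Solution G) : Prop :=
  ∃ g : ℝ → GL (Fin n) ℂ, IsBasedGauge G g ∧
    ∀ t ∈ I01, y.α t = gaugeα g x.α t ∧ ∀ i, y.β i t = gaugeβ g (x.β i) t

section Equivalence

variable {n : ℕ}

theorem IsClass.mul {k : ℕ∞} {A B : ℝ → Mat n} (hA : IsClass k A) (hB : IsClass k B) :
    IsClass k (fun s => A s * B s) := by
  intro i j
  simp only [Matrix.mul_apply]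
  exact ContDiffOn.sum fun l _ => (hA i l).mul (hB l j)

theorem contDiffOn_det {k : ℕ∞} {A : ℝ → Mat n} (hA : IsClass k A) :
    ContDiffOn ℝ k (fun s => (A s).det) I01 := by
  simp only [Matrix.det_apply]
  exact ContDiffOn.sum fun σ _ => (contDiffOn_prod fun i _ => hA (σ i) i).const_smul _

theorem IsClass.inv {k : ℕ∞} {g : ℝ → GL (Fin n) ℂ}
    (h : IsClass k (fun t => (g t : Mat n))) :
    IsClass k (fun t => (((g t)⁻¹ : GL (Fin n) ℂ) : Mat n)) := by
  intro i j
  have e : (fun t => (((g t)⁻¹ : GL (Fin n) ℂ) : Mat n) i j)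
      = fun t => ((g t : Mat n).det)⁻¹ * ((g t : Mat n).updateRow j (Pi.single i 1)).det := by
    funext t
    rw [Matrix.coe_units_inv, Matrix.inv_def, Matrix.smul_apply, Matrix.adjugate_apply,
      Ring.inverse_eq_inv', smul_eq_mul]
  rw [e]
  refine ((contDiffOn_det h).inv fun t _ => ?_).mul (contDiffOn_det ?_)
  · exact ((Matrix.isUnit_iff_isUnit_det _).1 (g t).isUnit).ne_zero
  · intro a b
    by_cases ha : a = j
    · subst ha; simpa using contDiffOn_const
    · simpa [Matrix.updateRow_ne ha] using h a b

theorem D_mul {A B : ℝ → Mat n} {t : ℝ} (ht : t ∈ I01) (hA : IsClass 2 A) (hB : IsClass 2 B) :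
    D (fun s => A s * B s) t = D A t * B t + A t * D B t := by
  ext i j
  simp only [D, Matrix.of_apply, Matrix.add_apply, Matrix.mul_apply, ← Finset.sum_add_distrib]
  refine HasDerivWithinAt.derivWithin ?_ (uniqueDiffOn_Icc zero_lt_one t ht)
  exact HasDerivWithinAt.fun_sum fun l _ =>
    ((hA i l).differentiableOn (by norm_num) t ht).hasDerivWithinAt.mul
      ((hB l j).differentiableOn (by norm_num) t ht).hasDerivWithinAt

theorem gaugeβ_mul (g h : ℝ → GL (Fin n) ℂ) (β : ℝ → Mat n) (t : ℝ) :
    gaugeβ (fun s => g s * h s) β t = gaugeβ g (gaugeβ h β) t := by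
  simp only [gaugeβ, Units.val_mul, mul_inv_rev]
  noncomm_ring

theorem gaugeα_mul {g h : ℝ → GL (Fin n) ℂ} (α : ℝ → Mat n) {t : ℝ} (ht : t ∈ I01)
    (hg : IsClass 2 (fun t => (g t : Mat n)))
    (hh : IsClass 2 (fun t => (h t : Mat n))) :
    gaugeα (fun s => g s * h s) α t = gaugeα g (gaugeα h α) t := by
  simp only [gaugeα, Units.val_mul, mul_inv_rev]
  rw [D_mul ht hg hh]
  have e : (h t : Mat n) * (((h t)⁻¹ : GL (Fin n) ℂ) : Mat n) = 1 := Units.mul_inv _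
  have e2 : D (fun s => (g s : Mat n)) t * (h t : Mat n)
      * ((((h t)⁻¹ : GL (Fin n) ℂ) : Mat n) * (((g t)⁻¹ : GL (Fin n) ℂ) : Mat n))
      = D (fun s => (g s : Mat n)) t * (((g t)⁻¹ : GL (Fin n) ℂ) : Mat n) := by
    rw [← mul_assoc, mul_assoc _ (h t : Mat n), e, mul_one]
  rw [add_mul, e2, smul_add, mul_sub, sub_mul, mul_smul_comm, smul_mul_assoc]
  simp only [mul_assoc]
  abel

theorem gaugeα_one (α : ℝ → Mat n) (t : ℝ) : gaugeα (fun _ => 1) α t = α t := by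
  have e : D (fun _ : ℝ => (1 : Mat n)) t = 0 := by
    ext i j; simp [D]
  simp [gaugeα, e]

theorem gaugeα_congr (g : ℝ → GL (Fin n) ℂ) {α α' : ℝ → Mat n} {t : ℝ} (h : α t = α' t) :
    gaugeα g α t = gaugeα g α' t := by
  simp [gaugeα, h]

theorem gaugeβ_congr (g : ℝ → GL (Fin n) ℂ) {β β' : ℝ → Mat n} {t : ℝ} (h : β t = β' t) :
    gaugeβ g β t = gaugeβ g β' t := by
  simp [gaugeβ, h]

theorem gaugeEquiv_equivalence (G : Subgroup (GL (Fin n) ℂ)) :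
    Equivalence (GaugeEquiv (G := G)) where
  refl x := ⟨fun _ => 1, ⟨⟨fun _ _ => G.one_mem, fun _ _ => contDiffOn_const⟩, rfl, rfl⟩,
    fun t _ => ⟨(gaugeα_one _ t).symm, fun i => by simp [gaugeβ]⟩⟩
  symm := by
    rintro x y ⟨g, hg, h⟩
    refine ⟨fun t => (g t)⁻¹, ⟨⟨fun t ht => G.inv_mem (hg.mem t ht),
      hg.isClass.inv⟩, by simp [hg.zero], by simp [hg.one]⟩, fun t ht => ⟨?_, ?_⟩⟩
    · rw [gaugeα_congr _ (h t ht).1, ← gaugeα_mul _ ht (hg.isClass.inv)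
        hg.isClass]
      simp only [inv_mul_cancel]
      exact (gaugeα_one _ t).symm
    · intro i
      rw [gaugeβ_congr _ ((h t ht).2 i), ← gaugeβ_mul]
      simp [gaugeβ]
  trans := by
    rintro x y z ⟨g, hg, h⟩ ⟨k, hk, h'⟩
    refine ⟨fun t => k t * g t, ⟨⟨fun t ht => G.mul_mem (hk.mem t ht) (hg.mem t ht),
      by simpa only [Units.val_mul] using hk.isClass.mul hg.isClass⟩,
      by simp [hk.zero, hg.zero], by simp [hk.one, hg.one]⟩, fun t ht => ⟨?_, ?_⟩⟩
    · rw [gaugeα_mul _ ht hk.isClass hg.isClass, (h' t ht).1]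
      exact gaugeα_congr _ (h t ht).1
    · intro i
      rw [gaugeβ_mul, (h' t ht).2 i]
      exact gaugeβ_congr _ ((h t ht).2 i)

end Equivalence

/-- Gauge equivalence of solutions as a setoid. -/
def gaugeSetoid {n : ℕ} (G : Subgroup (GL (Fin n) ℂ)) : Setoid (Solution G) :=
  ⟨GaugeEquiv, gaugeEquiv_equivalence G⟩

/-- The moduli space: smooth solutions on `[0,1]` modulo `𝒢₀`. -/
def ModuliSpace {n : ℕ} (G : Subgroup (GL (Fin n) ℂ)) : Type :=
  Quotient (gaugeSetoid G)

/-- The class of a solution in the moduli space. -/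
def Solution.toModuli {n : ℕ} {G : Subgroup (GL (Fin n) ℂ)} (x : Solution G) : ModuliSpace G :=
  Quotient.mk (gaugeSetoid G) x

/-- The set `N` of commuting triples of `T*G^ℂ = G^ℂ × 𝔤^ℂ`. -/
def commutingTriples {n : ℕ} (G : Subgroup (GL (Fin n) ℂ)) :
    Set (GL (Fin n) ℂ × (Fin 3 → Mat n)) :=
  {p | p.1 ∈ complexification G ∧ (∀ i, p.2 i ∈ lieAlgC G) ∧ ∀ i j, ⁅p.2 i, p.2 j⁆ = 0}

/-- `g` is a complex gauge transformation with `g(0) = 1` and `dg/dt = 2 g α`; the second equation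
says that `g` takes `α` to `0`. -/
structure IsTrivializing {n : ℕ} {G : Subgroup (GL (Fin n) ℂ)} (x : Solution G)
    (g : ℝ → GL (Fin n) ℂ) : Prop extends IsGauge (complexification G) g where
  zero : g 0 = 1
  ode : ∀ t ∈ I01, D (fun s => (g s : Mat n)) t = (2 : ℝ) • ((g t : Mat n) * x.α t)

end OctonionicNahm

/-!
The map `Θ` sends a solution to `(g(1), β(0))`, where `g` solves the linear equation `g' = 2gα`,
`g(0) = 1`; the complex equations say that `gβᵢg⁻¹` is constant. A based gauge transformation `u`
replaces `g` by `gu⁻¹`, so `Θ` descends to the moduli space. Bijectivity is the uniqueness and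
existence of a solution of the real equation with prescribed `g(1)` and `β(0)`.

Uniqueness rests on convexity. If `u` is a complex gauge transformation between two solutions, the
real equation makes the second derivative of `‖u‖²` a sum of squares (`hasDerivWithinAt_normSq`).
For two solutions with the same image under `Θ`, the quotient `u` of their trivializations is the
identity at both ends, so `‖u‖²` and `‖u⁻¹‖²` are both at most `‖1‖² = n`. This forces `u` to be
unitary (`conjTranspose_eq_of_real_eq`). Its logarithmic derivative is then skew-Hermitian and
lies in the complexified Lie algebra, hence in the Lie algebra of `G`, and `u` is a path in `G`
(`TangentPath.mem_of_unitary`).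

Existence is the continuity method. Up to a gauge transformation by a path in `G`, the connection
`α` may be taken Hermitian, and then the equations for `(α, β)`, together with `h' = 2hα`, are a
quadratic ordinary differential equation with initial data `α(0)` Hermitian and `β(0) = τ`
(`nahmField`, `HermitianNahm`). The task is to choose `α(0)` so that the solution exists up to time
`1` and `h(1)` lies in a given coset `gG`.

* The set of `(τ, gG)` for which this is possible is open (`HermitianNahm.eventually_exists`). The
  flow is differentiable in the initial data (`exists_quadratic_flow`), and a deformation which
  moves `h(1)` only along the coset is trivial, again by convexity (`linearised_eq_zero`). The
  inverse function theorem is applied in the complexified Lie algebra rather than in `G^ℂ`, by means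
  of the fact that short paths tangent to a Lie subalgebra end in the exponential of a short vector
  of it (`exists_exp_eq_of_short_path`); so no closedness or manifold structure of `G^ℂ` is needed.
* It is closed along paths (`isClosed_solvableSet_inter`), because a solution is bounded in terms of
  `τ` and its end point: a convexity estimate for `log (1 + ‖h‖²)` bounds `h`, and if `α` were large
  then `‖h‖²` would be so convex as to become negative in the middle of the interval
  (`HermitianNahm.exists_bound`).

Starting from the zero solution, `β(0)` is moved to `τ` and the coset along the exponentials which,
together with `G`, generate `G^ℂ`; so every coset is reached (`exists_hermitianNahm`). A smooth path
in the connected group `G` from `1` to the remaining factor (`mem_smoothlyReachable`) then corrects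
the end point without affecting `β(0)`.
-/

namespace OctonionicNahm

open Set Filter Topology MeasureTheory

/-! ### Quadratic and linear differential equations on the unit interval -/

section Banach

set_option linter.unusedSectionVars false

variable {E F F' : Type*} [NormedAddCommGroup E] [NormedSpace ℝ E] [NormedAddCommGroup F]
  [NormedSpace ℝ F] [NormedAddCommGroup F'] [NormedSpace ℝ F']

/-- The extension of a continuous path on `[0,1]` to `ℝ`, constant on either side. -/
noncomputable def extend01 (v : C(I01, E)) : ℝ → E := IccExtend (zero_le_one (α := ℝ)) v

theorem extend01_of_mem (v : C(I01, E)) {t : ℝ} (ht : t ∈ I01) : extend01 v t = v ⟨t, ht⟩ :=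
  IccExtend_of_mem _ _ ht

theorem continuous_extend01 (v : C(I01, E)) : Continuous (extend01 v) :=
  v.continuous.Icc_extend'

theorem norm_extend01_le (v : C(I01, E)) (t : ℝ) : ‖extend01 v t‖ ≤ ‖v‖ :=
  v.norm_coe_le_norm _

/-- The restriction to `[0,1]` of a path that is continuous there. -/
def restrict01 (Y : ℝ → E) (h : ContinuousOn Y I01) : C(I01, E) :=
  ⟨I01.domRestrict Y, h.domRestrict⟩

theorem extend01_restrict01 {Y : ℝ → E} (h : ContinuousOn Y I01) {t : ℝ} (ht : t ∈ I01) :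
    extend01 (restrict01 Y h) t = Y t :=
  extend01_of_mem _ ht

/-- Pointwise application of a bounded bilinear map to continuous paths. -/
noncomputable def pathBilin (B : E →L[ℝ] F →L[ℝ] F') :
    C(I01, E) →L[ℝ] C(I01, F) →L[ℝ] C(I01, F') :=
  LinearMap.mkContinuous₂
    (LinearMap.mk₂ ℝ (fun v w => (⟨fun t => B (v t) (w t), by fun_prop⟩ : C(I01, F')))
      (fun _ _ _ => by ext; simp) (fun _ _ _ => by ext; simp)
      (fun _ _ _ => by ext; simp) (fun _ _ _ => by ext; simp))
    ‖B‖ fun v w => by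
      refine (ContinuousMap.norm_le _ (by positivity)).2 fun t => ?_
      refine (B.le_opNorm₂ _ _).trans ?_
      gcongr
      · exact v.norm_coe_le_norm t
      · exact w.norm_coe_le_norm t

@[simp]
theorem pathBilin_apply (B : E →L[ℝ] F →L[ℝ] F') (v : C(I01, E)) (w : C(I01, F)) (t : I01) :
    pathBilin B v w t = B (v t) (w t) := rfl

theorem intervalIntegrable_extend01 (v : C(I01, E)) (a b : ℝ) :
    IntervalIntegrable (extend01 v) volume a b :=
  (continuous_extend01 v).intervalIntegrable a b

/-- The primitive `t ↦ ∫₀ᵗ v` of a continuous path. -/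
noncomputable def primitive : C(I01, E) →L[ℝ] C(I01, E) :=
  LinearMap.mkContinuous
    { toFun := fun v => ⟨fun t => ∫ s in (0 : ℝ)..t, extend01 v s, by
        exact (intervalIntegral.continuous_primitive
          (fun a b => intervalIntegrable_extend01 v a b) 0).comp continuous_subtype_val⟩
      map_add' := fun v w => by
        ext t
        exact intervalIntegral.integral_add (intervalIntegrable_extend01 v _ _)
          (intervalIntegrable_extend01 w _ _)
      map_smul' := fun c v => by
        ext t
        exact intervalIntegral.integral_smul c _ }
    1 fun v => by
      refine (ContinuousMap.norm_le _ (by positivity)).2 fun t => ?_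
      refine (intervalIntegral.norm_integral_le_of_norm_le_const
        (fun s _ => norm_extend01_le v s)).trans ?_
      rw [sub_zero, abs_of_nonneg t.2.1, one_mul]
      exact mul_le_of_le_one_right (norm_nonneg _) t.2.2

theorem primitive_apply (v : C(I01, E)) (t : I01) :
    primitive v t = ∫ s in (0 : ℝ)..t, extend01 v s := rfl

/-- The integral equation `y = e + ∫ v` in differential form. -/
theorem hasDerivWithinAt_of_eq_primitive [CompleteSpace E] {y v : C(I01, E)} {e : E}
    (h : y = ContinuousMap.const _ e + primitive v) {t : ℝ} (ht : t ∈ I01) :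
    HasDerivWithinAt (extend01 y) (extend01 v t) I01 t := by
  have h1 : HasDerivWithinAt (fun t => e + ∫ s in (0 : ℝ)..t, extend01 v s) (extend01 v t) I01 t :=
    ((intervalIntegral.integral_hasDerivAt_right (intervalIntegrable_extend01 v _ _)
      (continuous_extend01 v).aestronglyMeasurable.stronglyMeasurableAtFilter
      (continuous_extend01 v).continuousAt).const_add e).hasDerivWithinAt
  refine h1.congr (fun s hs => ?_) ?_
  · rw [extend01_of_mem y hs, h]; rfl
  · rw [extend01_of_mem y ht, h]; rfl

theorem eq_primitive_of_hasDerivWithinAt [CompleteSpace E] {Y Y' : ℝ → E}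
    (h : ∀ t ∈ I01, HasDerivWithinAt Y (Y' t) I01 t) (h' : ContinuousOn Y' I01) (t : I01) :
    Y t = Y 0 + primitive (restrict01 Y' h') t := by
  rw [primitive_apply, intervalIntegral.integral_eq_sub_of_hasDeriv_right_of_le (f := Y) t.2.1]
  · abel
  · exact fun s hs => ((h s ⟨hs.1, hs.2.trans t.2.2⟩).mono
      (Icc_subset_Icc_right t.2.2)).continuousWithinAt
  · intro s hs
    have hs' : s ∈ I01 := ⟨hs.1.le, hs.2.le.trans t.2.2⟩
    rw [extend01_restrict01 h' hs']
    exact ((h s hs').hasDerivAt (Icc_mem_nhds hs.1 (hs.2.trans_le t.2.2))).hasDerivWithinAt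
  · exact intervalIntegrable_extend01 _ _ _

theorem primitive_apply_zero (v : C(I01, E)) : primitive v ⟨0, by simp⟩ = 0 := by
  simp [primitive_apply]

/-- The iterates of the Volterra operator `v ↦ ∫₀ᵗ A v` decay like `‖A‖ᵐ tᵐ / m!`. -/
theorem norm_volterra_pow_le (A : C(I01, E →L[ℝ] E)) (m : ℕ) (v : C(I01, E)) (t : I01) :
    ‖((primitive.comp (pathBilin (ContinuousLinearMap.id ℝ (E →L[ℝ] E)) A)) ^ m) v t‖
      ≤ ‖A‖ ^ m * (t : ℝ) ^ m / m.factorial * ‖v‖ := by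
  induction m generalizing t with
  | zero => simpa using v.norm_coe_le_norm t
  | succ m ih =>
    rw [pow_succ', mul_apply_eq_comp]
    simp only [ContinuousLinearMap.comp_apply]
    rw [primitive_apply]
    have hc : Continuous fun s : ℝ => ‖A‖ * (‖A‖ ^ m * s ^ m / m.factorial * ‖v‖) := by fun_prop
    refine (intervalIntegral.norm_integral_le_of_norm_le (g := fun s : ℝ =>
      ‖A‖ * (‖A‖ ^ m * s ^ m / m.factorial * ‖v‖)) t.2.1 ?_
      (hc.intervalIntegrable _ _)).trans (le_of_eq ?_)
    · refine ae_of_all _ fun s hs => ?_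
      have hs' : s ∈ I01 := ⟨hs.1.le, hs.2.trans t.2.2⟩
      rw [extend01_of_mem _ hs', pathBilin_apply, ContinuousLinearMap.id_apply]
      refine (ContinuousLinearMap.le_opNorm _ _).trans ?_
      gcongr
      · exact A.norm_coe_le_norm _
      · exact ih ⟨s, hs'⟩
    · have e : (fun s : ℝ => ‖A‖ * (‖A‖ ^ m * s ^ m / m.factorial * ‖v‖))
          = fun s => (‖A‖ ^ (m + 1) / m.factorial * ‖v‖) * s ^ m := by
        funext s; ring
      rw [e, intervalIntegral.integral_const_mul, integral_pow]
      have : (m.factorial : ℝ) ≠ 0 := by positivity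
      have h2 : (m + 1 : ℝ) ≠ 0 := by positivity
      simp only [Nat.factorial_succ, Nat.cast_mul, Nat.cast_add, Nat.cast_one, zero_pow
        (Nat.succ_ne_zero m), sub_zero]
      field_simp

/-- Volterra operators of the second kind are invertible: a power of the integral operator is a
contraction. -/
theorem isUnit_one_sub_volterra [CompleteSpace E] (A : C(I01, E →L[ℝ] E)) :
    IsUnit (1 - primitive.comp (pathBilin (ContinuousLinearMap.id ℝ (E →L[ℝ] E)) A)) := by
  set T := primitive.comp (pathBilin (ContinuousLinearMap.id ℝ (E →L[ℝ] E)) A) with hT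
  -- `1 - T` is a factor of `1 - Tᵐ`, which is invertible as soon as `‖Tᵐ‖ < 1`
  obtain ⟨m, hm⟩ : ∃ m : ℕ, ‖A‖ ^ m / m.factorial < 1 :=
    ((FloorSemiring.tendsto_pow_div_factorial_atTop ‖A‖).eventually_lt_const one_pos).exists
  have hTm : ‖T ^ m‖ < 1 := by
    refine lt_of_le_of_lt (ContinuousLinearMap.opNorm_le_bound _ (by positivity) fun v => ?_) hm
    refine (ContinuousMap.norm_le _ (by positivity)).2 fun t => ?_
    refine (norm_volterra_pow_le A m v t).trans ?_
    gcongr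
    exact mul_le_of_le_one_right (by positivity) (pow_le_one₀ t.2.1 t.2.2)
  have h : IsUnit (1 - T ^ m) := isUnit_one_sub_of_norm_lt_one (x := T ^ m) hTm
  rw [← mul_neg_geom_sum] at h
  have hc : Commute (1 - T) (∑ i ∈ Finset.range m, T ^ i) :=
    Commute.sum_right _ _ _ fun i _ =>
      ((Commute.one_left T).sub_left (Commute.refl T)).pow_right i
  exact (hc.isUnit_mul_iff.1 h).1

/-- The equation `v - ∫ A v = e` is the initial value problem `v' = A v`, `v(0) = e`. -/
theorem eq_of_sub_volterra_eq_const [CompleteSpace E] {A : C(I01, E →L[ℝ] E)} {v : C(I01, E)}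
    {e : E}
    (h : (1 - primitive.comp (pathBilin (ContinuousLinearMap.id ℝ (E →L[ℝ] E)) A)) v
      = ContinuousMap.const _ e) :
    extend01 v 0 = e ∧ ∀ t ∈ I01,
      HasDerivWithinAt (extend01 v) (extend01 A t (extend01 v t)) I01 t := by
  have h1 : v = ContinuousMap.const _ e
      + primitive (pathBilin (ContinuousLinearMap.id ℝ (E →L[ℝ] E)) A v) := by
    rw [← h]; simp
  constructor
  · rw [extend01_of_mem v (by simp : (0 : ℝ) ∈ I01), h1, ContinuousMap.add_apply,
      primitive_apply_zero]
    simp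
  · intro t ht
    have := hasDerivWithinAt_of_eq_primitive h1 ht
    rwa [extend01_of_mem _ ht, pathBilin_apply, ContinuousLinearMap.id_apply,
      ← extend01_of_mem _ ht, ← extend01_of_mem _ ht] at this

/-- Linear differential equations with continuous coefficients have solutions on all of `[0,1]`. -/
theorem exists_linear_ode [CompleteSpace E] {A : ℝ → E →L[ℝ] E} (hA : ContinuousOn A I01) (e : E) :
    ∃ v : ℝ → E, v 0 = e ∧ ∀ t ∈ I01, HasDerivWithinAt v (A t (v t)) I01 t := by
  obtain ⟨U, hU⟩ := isUnit_one_sub_volterra (restrict01 A hA)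
  have h : (1 - primitive.comp (pathBilin (ContinuousLinearMap.id ℝ (E →L[ℝ] E))
      (restrict01 A hA))) ((U⁻¹ : Units _).1 (ContinuousMap.const _ e))
      = ContinuousMap.const _ e := by
    rw [← hU, ← mul_apply_eq_comp, Units.mul_inv]; rfl
  obtain ⟨h0, h1⟩ := eq_of_sub_volterra_eq_const h
  refine ⟨_, h0, fun t ht => ?_⟩
  have := h1 t ht
  rwa [extend01_restrict01 hA ht] at this

/-- The solution of the quadratic equation `y' = B(y, y)` on `[0,1]` depends differentiably on the
initial value near any solution which exists up to time `1`, and the derivative solves the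
linearised equation. -/
theorem exists_quadratic_flow [CompleteSpace E] (B : E →L[ℝ] E →L[ℝ] E) {y : ℝ → E}
    (hy : ∀ t ∈ I01, HasDerivWithinAt y (B (y t) (y t)) I01 t) :
    ∃ (Φ : E → C(I01, E)) (Φ' : E →L[ℝ] C(I01, E)), HasStrictFDerivAt Φ Φ' (y 0) ∧
      (∀ t ∈ I01, extend01 (Φ (y 0)) t = y t) ∧
      (∀ᶠ e in 𝓝 (y 0), extend01 (Φ e) 0 = e ∧ ∀ t ∈ I01, HasDerivWithinAt (extend01 (Φ e))
        (B (extend01 (Φ e) t) (extend01 (Φ e) t)) I01 t) ∧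
      ∀ δ, extend01 (Φ' δ) 0 = δ ∧ ∀ t ∈ I01, HasDerivWithinAt (extend01 (Φ' δ))
        (B (y t) (extend01 (Φ' δ) t) + B (extend01 (Φ' δ) t) (y t)) I01 t := by
  have hyc : ContinuousOn y I01 := fun t ht => (hy t ht).continuousWithinAt
  set y₀ : C(I01, E) := restrict01 y hyc with hy₀
  have hAc : ContinuousOn (fun t => B (y t) + B.flip (y t)) I01 := by fun_prop
  set A : C(I01, E →L[ℝ] E) := restrict01 _ hAc with hA
  set T := primitive.comp (pathBilin (ContinuousLinearMap.id ℝ (E →L[ℝ] E)) A) with hT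
  -- solutions with initial value `e` are the paths with `F y = e`
  let F : C(I01, E) → C(I01, E) := fun z => z - primitive (pathBilin B z z)
  obtain ⟨U, hU⟩ := isUnit_one_sub_volterra A
  let U' : C(I01, E) ≃L[ℝ] C(I01, E) := ContinuousLinearEquiv.unitsEquiv ℝ _ U
  have hF : HasStrictFDerivAt F (U' : C(I01, E) →L[ℝ] C(I01, E)) y₀ := by
    have h1 := (pathBilin B).hasStrictFDerivAt_of_bilinear (hasStrictFDerivAt_id y₀)
      (hasStrictFDerivAt_id y₀)
    have h2 := (hasStrictFDerivAt_id y₀).sub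
      ((primitive (E := E)).hasStrictFDerivAt.comp y₀ h1)
    refine h2.congr_fderiv ?_
    have h3 : (U' : C(I01, E) →L[ℝ] C(I01, E)) = 1 - T := hU
    rw [h3, hT]
    have h4 : ∀ v, pathBilin (ContinuousLinearMap.id ℝ (E →L[ℝ] E)) A v
        = pathBilin B y₀ v + pathBilin B v y₀ := fun v => rfl
    refine ContinuousLinearMap.ext fun v => ?_
    simp [h4]
  have hF0 : F y₀ = ContinuousMap.const _ (y 0) := by
    ext t
    have h1 : ContinuousOn (fun t => B (y t) (y t)) I01 := by fun_prop
    have h2 := eq_primitive_of_hasDerivWithinAt hy h1 t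
    change y t - primitive (pathBilin B y₀ y₀) t = y 0
    rw [h2]
    simp only [add_sub_assoc]
    convert add_zero _
    exact sub_self _
  let c : E →L[ℝ] C(I01, E) := ContinuousLinearMap.const ℝ I01
  have hc : ∀ e, c e = ContinuousMap.const _ e := fun e => rfl
  have hg := hF.to_localInverse
  rw [hF0, ← hc] at hg
  have hF0' : hF.localInverse F U' y₀ (c (y 0)) = y₀ := by
    rw [hc, ← hF0]; exact hF.localInverse_apply_image
  refine ⟨fun e => hF.localInverse F U' y₀ (c e), _, hg.comp (y 0) c.hasStrictFDerivAt,
    fun t ht => ?_, ?_, fun δ => ?_⟩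
  · change extend01 (hF.localInverse F U' y₀ (c (y 0))) t = y t
    rw [hF0', extend01_restrict01 hyc ht]
  · have h1 := hF.eventually_right_inverse
    rw [hF0, ← hc] at h1
    filter_upwards [c.continuous.continuousAt.eventually h1] with e he
    set z := hF.localInverse F U' y₀ (c e)
    have hz : z = ContinuousMap.const _ e + primitive (pathBilin B z z) := by
      rw [← hc, ← he]; simp [F]
    constructor
    · rw [extend01_of_mem z (by simp : (0 : ℝ) ∈ I01), hz, ContinuousMap.add_apply,
        primitive_apply_zero]
      simp
    · intro t ht
      have := hasDerivWithinAt_of_eq_primitive hz ht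
      rwa [extend01_of_mem _ ht, pathBilin_apply, ← extend01_of_mem _ ht] at this
  · have h1 : (1 - T) ((U'.symm : C(I01, E) →L[ℝ] C(I01, E)) (c δ)) = ContinuousMap.const _ δ := by
      rw [← hU]; exact U'.apply_symm_apply (c δ)
    obtain ⟨h2, h3⟩ := eq_of_sub_volterra_eq_const h1
    refine ⟨h2, fun t ht => ?_⟩
    have := h3 t ht
    rwa [hA, extend01_restrict01 hAc ht] at this

theorem hasDerivWithinAt_Ici_of_Icc {a b : ℝ} {f : ℝ → E} {f' : E} {t : ℝ} (ht : t ∈ Ico a b)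
    (h : HasDerivWithinAt f f' (Icc a b) t) : HasDerivWithinAt f f' (Ici t) t :=
  h.mono_of_mem_nhdsWithin (mem_of_superset (Icc_mem_nhdsGE ht.2) (Icc_subset_Icc_left ht.1))

/-- Grönwall's inequality for a path with vanishing initial value. -/
theorem eq_zero_of_norm_deriv_le {f f' : ℝ → E} {K : ℝ}
    (hf : ∀ t ∈ I01, HasDerivWithinAt f (f' t) I01 t) (h0 : f 0 = 0)
    (hK : ∀ t ∈ I01, ‖f' t‖ ≤ K * ‖f t‖) : ∀ t ∈ I01, f t = 0 :=
  eq_zero_of_abs_deriv_le_mul_abs_self_of_eq_zero_right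
    (fun t ht => (hf t ht).continuousWithinAt)
    (fun t ht => hasDerivWithinAt_Ici_of_Icc ht (hf t (Ico_subset_Icc_self ht))) h0
    fun t ht => hK t (Ico_subset_Icc_self ht)

theorem exists_norm_le_of_continuousOn {f : ℝ → E} (hf : ContinuousOn f I01) :
    ∃ K, 0 ≤ K ∧ ∀ t ∈ I01, ‖f t‖ ≤ K := by
  obtain ⟨K, hK⟩ := isCompact_Icc.exists_bound_of_continuousOn hf
  exact ⟨K, (norm_nonneg _).trans (hK 0 (by simp)), hK⟩

/-- A path which starts in a subspace `W` stays there if its velocity is, up to an error controlled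
by the distance to `W`, tangent to `W`. Here `P` is a projection onto `W`. -/
theorem mem_of_invariant {W : Submodule ℝ E} {P : E →L[ℝ] E} (hP : ∀ w ∈ W, P w = w)
    (hP' : ∀ w, P w ∈ W) {ζ : ℝ → E} {F : ℝ → E → E} {K : ℝ} (h0 : ζ 0 ∈ W)
    (hζ : ∀ t ∈ I01, HasDerivWithinAt ζ (F t (ζ t)) I01 t)
    (hF : ∀ t ∈ I01, F t (P (ζ t)) ∈ W)
    (hK : ∀ t ∈ I01, ‖F t (ζ t) - F t (P (ζ t))‖ ≤ K * ‖ζ t - P (ζ t)‖) :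
    ∀ t ∈ I01, ζ t ∈ W := by
  set Q : E →L[ℝ] E := ContinuousLinearMap.id ℝ E - P with hQ
  have hQW : ∀ w ∈ W, Q w = 0 := fun w hw => by simp [hQ, hP w hw]
  have h1 : ∀ t ∈ I01, HasDerivWithinAt (fun t => Q (ζ t)) (Q (F t (ζ t))) I01 t :=
    fun t ht => Q.hasFDerivAt.comp_hasDerivWithinAt t (hζ t ht)
  have h2 := eq_zero_of_norm_deriv_le (K := ‖Q‖ * K) h1 (hQW _ h0) fun t ht => by
    have e : Q (F t (ζ t)) = Q (F t (ζ t) - F t (P (ζ t))) := by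
      rw [map_sub, hQW _ (hF t ht), sub_zero]
    rw [e, mul_assoc]
    refine (Q.le_opNorm _).trans ?_
    gcongr
    exact hK t ht
  intro t ht
  have h3 : ζ t = P (ζ t) := sub_eq_zero.1 (h2 t ht)
  rw [h3]
  exact hP' _

/-- Every subspace of a finite-dimensional space has a continuous projection onto it. -/
theorem exists_projection [FiniteDimensional ℝ E] (W : Submodule ℝ E) :
    ∃ P : E →L[ℝ] E, (∀ w ∈ W, P w = w) ∧ ∀ w, P w ∈ W := by
  obtain ⟨f, hf⟩ := W.subtype.exists_leftInverse_of_injective (W.ker_subtype)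
  refine ⟨(W.subtype.comp f).toContinuousLinearMap, fun w hw => ?_, fun w => ?_⟩
  · have := LinearMap.congr_fun hf ⟨w, hw⟩
    simpa using congrArg Subtype.val this
  · simp

/-- A subspace preserved by a linear differential equation contains the solutions which start in
it. -/
theorem mem_of_linear_ode [FiniteDimensional ℝ E] {W : Submodule ℝ E} {A : ℝ → E →L[ℝ] E}
    {b v : ℝ → E} (hA : ContinuousOn A I01) (h0 : v 0 ∈ W)
    (hv : ∀ t ∈ I01, HasDerivWithinAt v (A t (v t) + b t) I01 t)
    (hW : ∀ t ∈ I01, ∀ w ∈ W, A t w + b t ∈ W) : ∀ t ∈ I01, v t ∈ W := by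
  obtain ⟨P, hP, hP'⟩ := exists_projection W
  obtain ⟨K, -, hK⟩ := exists_norm_le_of_continuousOn hA
  refine mem_of_invariant (F := fun t x => A t x + b t) hP hP' h0 hv
    (fun t ht => hW t ht _ (hP' _)) (K := K) fun t ht => ?_
  rw [add_sub_add_right_eq_sub, ← map_sub]
  exact ((A t).le_opNorm _).trans (mul_le_mul_of_nonneg_right (hK t ht) (norm_nonneg _))

theorem norm_bilin_self_sub_le (B : E →L[ℝ] E →L[ℝ] E) {R : ℝ} {x y : E} (hx : ‖x‖ ≤ R)
    (hy : ‖y‖ ≤ R) : ‖B x x - B y y‖ ≤ ‖B‖ * (2 * R) * ‖x - y‖ := by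
  have e : B x x - B y y = B x (x - y) + B (x - y) y := by
    simp only [map_sub, sub_apply]; abel
  rw [e]
  refine (norm_add_le_of_le ((B.le_opNorm₂ _ _).trans
    (mul_le_mul_of_nonneg_right (mul_le_mul_of_nonneg_left hx (norm_nonneg B)) (norm_nonneg _)))
    ((B.le_opNorm₂ _ _).trans (mul_le_mul_of_nonneg_left hy (by positivity)))).trans ?_
  linarith

/-- A subspace preserved by a quadratic differential equation contains the solutions which start in
it. -/
theorem mem_of_quadratic_ode [FiniteDimensional ℝ E] {W : Submodule ℝ E} {B : E →L[ℝ] E →L[ℝ] E}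
    {y : ℝ → E} (h0 : y 0 ∈ W) (hy : ∀ t ∈ I01, HasDerivWithinAt y (B (y t) (y t)) I01 t)
    (hW : ∀ w ∈ W, B w w ∈ W) : ∀ t ∈ I01, y t ∈ W := by
  obtain ⟨P, hP, hP'⟩ := exists_projection W
  obtain ⟨R, hR, hK⟩ := exists_norm_le_of_continuousOn
    (fun t ht => (hy t ht).continuousWithinAt : ContinuousOn y I01)
  refine mem_of_invariant (F := fun _ x => B x x) hP hP' h0 hy (fun t _ => hW _ (hP' _))
    (K := ‖B‖ * (2 * (R + ‖P‖ * R))) fun t ht => norm_bilin_self_sub_le B ?_ ?_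
  · exact (hK t ht).trans (le_add_of_nonneg_right (by positivity))
  · exact ((P.le_opNorm _).trans (mul_le_mul_of_nonneg_left (hK t ht) (norm_nonneg _))).trans
      (le_add_of_nonneg_left hR)

/-- Uniformly bounded solutions on `[0,1]` of a quadratic equation whose initial values converge
have a limit which solves the equation. -/
theorem exists_limit_quadratic_ode [CompleteSpace E] {B : E →L[ℝ] E →L[ℝ] E} {y : ℕ → ℝ → E}
    {e : E} {R : ℝ} (hy : ∀ m, ∀ t ∈ I01, HasDerivWithinAt (y m) (B (y m t) (y m t)) I01 t)
    (hR : ∀ m, ∀ t ∈ I01, ‖y m t‖ ≤ R) (he : Tendsto (fun m => y m 0) atTop (𝓝 e)) :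
    ∃ z : ℝ → E, z 0 = e ∧ (∀ t ∈ I01, HasDerivWithinAt z (B (z t) (z t)) I01 t) ∧
      ∀ t ∈ I01, Tendsto (fun m => y m t) atTop (𝓝 (z t)) := by
  have hyc : ∀ m, ContinuousOn (y m) I01 := fun m t ht => (hy m t ht).continuousWithinAt
  set Y : ℕ → C(I01, E) := fun m => restrict01 (y m) (hyc m) with hY
  have hR0 : 0 ≤ R := (norm_nonneg _).trans (hR 0 0 (by simp))
  set K : NNReal := ⟨‖B‖ * (2 * R), by positivity⟩ with hK
  have hdist : ∀ m k, ∀ t ∈ I01,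
      dist (y m t) (y k t) ≤ dist (y m 0) (y k 0) * Real.exp (K * (t - 0)) := by
    intro m k
    refine dist_le_of_trajectories_ODE_of_mem (v := fun _ x => B x x)
      (s := fun _ => Metric.closedBall 0 R) (fun t _ => ?_) (hyc m)
      (fun t ht => hasDerivWithinAt_Ici_of_Icc ht (hy m t (Ico_subset_Icc_self ht)))
      (fun t ht => by simpa using hR m t (Ico_subset_Icc_self ht)) (hyc k)
      (fun t ht => hasDerivWithinAt_Ici_of_Icc ht (hy k t (Ico_subset_Icc_self ht)))
      (fun t ht => by simpa using hR k t (Ico_subset_Icc_self ht)) le_rfl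
    refine LipschitzOnWith.of_dist_le_mul fun x hx z hz => ?_
    rw [dist_eq_norm, dist_eq_norm]
    exact norm_bilin_self_sub_le B (by simpa using hx) (by simpa using hz)
  -- by Grönwall's inequality the paths converge uniformly as soon as their initial values do
  have hcauchy : CauchySeq Y := by
    rw [Metric.cauchySeq_iff]
    intro ε hε
    obtain ⟨N, hN⟩ := Metric.cauchySeq_iff.1 he.cauchySeq (ε / 2 / Real.exp K) (by positivity)
    refine ⟨N, fun m hm k hk => lt_of_le_of_lt ?_ (half_lt_self hε)⟩
    refine (ContinuousMap.dist_le (by positivity)).2 fun t => ?_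
    refine (hdist m k t t.2).trans ?_
    have h1 : Real.exp (K * (t - 0)) ≤ Real.exp K :=
      Real.exp_le_exp.2 (by simpa using mul_le_of_le_one_right K.2 t.2.2)
    calc _ ≤ ε / 2 / Real.exp K * Real.exp K := by
            gcongr
            exact (hN m hm k hk).le
      _ = ε / 2 := by field_simp
  obtain ⟨Z, hZ⟩ := cauchySeq_tendsto_of_complete hcauchy
  have hpt : ∀ t : I01, Tendsto (fun m => y m t) atTop (𝓝 (Z t)) := fun t =>
    ((continuous_eval_const t).tendsto Z).comp hZ
  -- the integral equation passes to uniform limits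
  have hZe : Z = ContinuousMap.const _ e + primitive (pathBilin B Z Z) := by
    have h1 : ∀ m, Y m = ContinuousMap.const _ (y m 0) + primitive (pathBilin B (Y m) (Y m)) := by
      intro m
      have hc := hyc m
      have h2 : ContinuousOn (fun t => B (y m t) (y m t)) I01 := by fun_prop
      ext t
      exact eq_primitive_of_hasDerivWithinAt (hy m) h2 t
    refine tendsto_nhds_unique hZ ?_
    have h3 : Tendsto (fun m => ContinuousLinearMap.const ℝ I01 (y m 0)
        + primitive (pathBilin B (Y m) (Y m))) atTop
        (𝓝 (ContinuousLinearMap.const ℝ I01 e + primitive (pathBilin B Z Z))) := by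
      have hcont : Continuous fun p : C(I01, E) => primitive (pathBilin B p p) := by fun_prop
      exact (((ContinuousLinearMap.const ℝ I01).continuous.tendsto e).comp he).add
        ((hcont.tendsto Z).comp hZ)
    exact h3.congr fun m => (h1 m).symm
  refine ⟨extend01 Z, ?_, fun t ht => ?_, fun t ht => ?_⟩
  · rw [extend01_of_mem Z (by simp : (0 : ℝ) ∈ I01), hZe, ContinuousMap.add_apply,
      primitive_apply_zero]
    simp
  · have := hasDerivWithinAt_of_eq_primitive hZe ht
    rwa [extend01_of_mem _ ht, pathBilin_apply, ← extend01_of_mem _ ht] at this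
  · rw [extend01_of_mem _ ht]
    exact hpt ⟨t, ht⟩

end Banach

/-! ### Paths tangent to a Lie subalgebra of a finite-dimensional algebra -/

section LiePaths

set_option linter.unusedSectionVars false

attribute [local instance] LieRing.ofAssociativeRing

variable {𝔸 : Type*} [NormedRing 𝔸] [NormedAlgebra ℝ 𝔸] [FiniteDimensional ℝ 𝔸] [CompleteSpace 𝔸]

theorem exp_add_smul_self (x : 𝔸) (s t : ℝ) :
    NormedSpace.exp ((s + t) • x) = NormedSpace.exp (s • x) * NormedSpace.exp (t • x) := by
  let _ : NormedAlgebra ℚ 𝔸 := NormedAlgebra.restrictScalars ℚ ℝ 𝔸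
  rw [add_smul]
  exact NormedSpace.exp_add_of_commute (((Commute.refl x).smul_left s).smul_right t)

theorem exp_neg_mul_exp (x : 𝔸) :
    NormedSpace.exp (-x) * NormedSpace.exp x = 1 := by
  have := exp_add_smul_self x (-1) 1
  simpa using this.symm

theorem exp_mul_exp_neg (x : 𝔸) :
    NormedSpace.exp x * NormedSpace.exp (-x) = 1 := by
  simpa using exp_neg_mul_exp (-x)

theorem contDiff_exp {k : WithTop ℕ∞} :
    ContDiff ℝ k (NormedSpace.exp : 𝔸 → 𝔸) :=
  contDiff_iff_contDiffAt.2 fun x => (NormedSpace.exp_analytic (𝕂 := ℝ) x).contDiffAt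

theorem hasDerivAt_exp_neg_smul (x : 𝔸) (t : ℝ) :
    HasDerivAt (fun s : ℝ => NormedSpace.exp (-(s • x))) (-(NormedSpace.exp (-(t • x)) * x)) t := by
  have := hasDerivAt_exp_smul_const (-x) t
  simpa using this

/-- The adjoint action of `exp x` preserves every Lie subalgebra which contains `x`. -/
theorem exp_conj_mem (W : LieSubalgebra ℝ 𝔸) {x v : 𝔸} (hx : x ∈ W) (hv : v ∈ W) (s : ℝ) :
    NormedSpace.exp (-(s • x)) * v * NormedSpace.exp (s • x) ∈ W := by
  -- `t ↦ exp (-tz) v exp (tz)` solves a linear equation which preserves `W`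
  have key : ∀ z ∈ W, NormedSpace.exp (-((1 : ℝ) • z)) * v * NormedSpace.exp ((1 : ℝ) • z) ∈ W := by
    intro z hz
    let A : 𝔸 →L[ℝ] 𝔸 := (ContinuousLinearMap.mul ℝ 𝔸).flip z - ContinuousLinearMap.mul ℝ 𝔸 z
    refine mem_of_linear_ode (W := W.toSubmodule) (A := fun _ => A) (b := fun _ => 0)
      (v := fun t : ℝ => NormedSpace.exp (-(t • z)) * v * NormedSpace.exp (t • z))
      continuousOn_const ?_ (fun t _ => ?_) (fun t _ w hw => ?_) 1 (by simp)
    · simpa using hv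
    · have h := ((hasDerivAt_exp_neg_smul z t).mul_const v).mul (hasDerivAt_exp_smul_const' z t)
      refine (h.congr_deriv ?_).hasDerivWithinAt
      have hc : NormedSpace.exp (t • z) * z = z * NormedSpace.exp (t • z) :=
        (hasDerivAt_exp_smul_const z t).unique (hasDerivAt_exp_smul_const' z t)
      have hc' : NormedSpace.exp (-(t • z)) * z = z * NormedSpace.exp (-(t • z)) := by
        have := (hasDerivAt_exp_smul_const (-z) t).unique (hasDerivAt_exp_smul_const' (-z) t)
        simpa using this
      simp only [A, sub_apply, ContinuousLinearMap.flip_apply, ContinuousLinearMap.mul_apply',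
        add_zero]
      rw [hc', ← hc]
      noncomm_ring
    · have h := W.lie_mem hw hz
      simpa [A, Ring.lie_def] using h
  have := key (s • x) (W.smul_mem s hx)
  simpa using this

/-- Duhamel's formula. -/
theorem exp_neg_mul_exp_sub_one (x y : 𝔸) :
    NormedSpace.exp (-x) * NormedSpace.exp y - 1 =
      ∫ s in (0 : ℝ)..1, NormedSpace.exp (-(s • x)) * (y - x) * NormedSpace.exp (s • y) := by
  have hce : Continuous (NormedSpace.exp : 𝔸 → 𝔸) := (contDiff_exp (k := 0)).continuous
  have h := intervalIntegral.integral_eq_sub_of_hasDerivAt (a := 0) (b := 1)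
    (f := fun s : ℝ => NormedSpace.exp (-(s • x)) * NormedSpace.exp (s • y))
    (f' := fun s : ℝ => NormedSpace.exp (-(s • x)) * (y - x) * NormedSpace.exp (s • y))
    (fun s _ => by
      refine ((hasDerivAt_exp_neg_smul x s).mul (hasDerivAt_exp_smul_const' y s)).congr_deriv ?_
      noncomm_ring)
    (Continuous.intervalIntegrable (by fun_prop) _ _)
  rw [h]
  simp

/-- The differential of the exponential map at `x`, translated back to the identity. -/
noncomputable def leftDexp (x : 𝔸) : 𝔸 →L[ℝ] 𝔸 :=
  (ContinuousLinearMap.mul ℝ 𝔸 (NormedSpace.exp (-x))).comp (fderiv ℝ NormedSpace.exp x)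

theorem fderiv_exp_apply (x v : 𝔸) :
    fderiv ℝ NormedSpace.exp x v = NormedSpace.exp x * leftDexp x v := by
  simp only [leftDexp, ContinuousLinearMap.comp_apply, ContinuousLinearMap.mul_apply']
  rw [← mul_assoc, exp_mul_exp_neg, one_mul]

theorem contDiff_leftDexp : ContDiff ℝ 1 (leftDexp : 𝔸 → 𝔸 →L[ℝ] 𝔸) := by
  have h1 : ContDiff ℝ 1 (fderiv ℝ (NormedSpace.exp : 𝔸 → 𝔸)) :=
    (contDiff_exp (k := 2)).fderiv_right (by norm_num)
  have h2 : ContDiff ℝ 1 (fun x : 𝔸 => NormedSpace.exp (-x)) := contDiff_exp.comp contDiff_neg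
  exact ((ContinuousLinearMap.mul ℝ 𝔸).contDiff.comp h2).clm_comp h1

theorem leftDexp_zero : leftDexp (0 : 𝔸) = ContinuousLinearMap.id ℝ 𝔸 := by
  have h : fderiv ℝ (NormedSpace.exp : 𝔸 → 𝔸) 0 = 1 := (hasFDerivAt_exp_zero (𝕂 := ℝ)).fderiv
  ext v
  simp [leftDexp, h]

/-- The translated differential of the exponential map preserves every Lie subalgebra containing the
base point: by Duhamel's formula it is an average of adjoint actions of `exp (-sx)`. -/
theorem leftDexp_mem (W : LieSubalgebra ℝ 𝔸) {x v : 𝔸} (hx : x ∈ W) (hv : v ∈ W) :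
    leftDexp x v ∈ W := by
  have hce : Continuous (NormedSpace.exp : 𝔸 → 𝔸) := (contDiff_exp (k := 0)).continuous
  let g : ℝ → 𝔸 := fun ε => ∫ s in (0 : ℝ)..1,
    NormedSpace.exp (-(s • x)) * v * NormedSpace.exp (s • (x + ε • v))
  have hg : Continuous g :=
    intervalIntegral.continuous_parametric_intervalIntegral_of_continuous'
      (by simp only [Function.uncurry_def]; fun_prop) _ _
  have hg1 : ∀ ε : ℝ, NormedSpace.exp (-x) * NormedSpace.exp (x + ε • v) - 1 = ε • g ε := by
    intro ε
    rw [exp_neg_mul_exp_sub_one, ← intervalIntegral.integral_smul]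
    refine intervalIntegral.integral_congr fun s _ => ?_
    simp
  have h1 : HasDerivAt (fun ε : ℝ => ε • g ε) (g 0) 0 := by
    rw [hasDerivAt_iff_tendsto_slope]
    refine (hg.continuousAt.tendsto.mono_left nhdsWithin_le_nhds).congr' ?_
    filter_upwards [self_mem_nhdsWithin] with ε hε
    rw [slope_def_module]
    simp only [zero_smul, sub_zero]
    rw [smul_smul, inv_mul_cancel₀ hε, one_smul]
  have h2 : HasDerivAt (fun ε : ℝ => ε • g ε) (leftDexp x v) 0 := by
    have hl : HasDerivAt (fun ε : ℝ => x + ε • v) v 0 := by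
      simpa using ((hasDerivAt_id (0 : ℝ)).smul_const v).const_add x
    have hd : HasFDerivAt NormedSpace.exp (fderiv ℝ NormedSpace.exp x) (x + (0 : ℝ) • v) := by
      rw [zero_smul, add_zero]
      exact ((contDiff_exp (k := 1)).differentiable one_ne_zero).differentiableAt.hasFDerivAt
    exact (((hd.comp_hasDerivAt 0 hl).const_mul
      (NormedSpace.exp (-x))).sub_const 1).congr_of_eventuallyEq
        (Eventually.of_forall fun ε => (hg1 ε).symm)
  rw [h2.unique h1]
  obtain ⟨P, hP, hP'⟩ := exists_projection W.toSubmodule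
  have h3 : P (g 0) = g 0 := by
    simp only [g]
    rw [← ContinuousLinearMap.intervalIntegral_comp_comm _
      (Continuous.intervalIntegrable (by fun_prop) _ _)]
    refine intervalIntegral.integral_congr fun s _ => hP _ ?_
    simpa using exp_conj_mem W hx hv s
  rw [← h3]
  exact hP' _

/-- An injective linear map which preserves a finite-dimensional subspace is onto there, so that its
inverse preserves the subspace too. -/
theorem leftDexp_inverse_mem (W : LieSubalgebra ℝ 𝔸) {x v : 𝔸} (hx : x ∈ W) (hv : v ∈ W)
    (h : (leftDexp x).IsInvertible) : (leftDexp x).inverse v ∈ W := by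
  obtain ⟨e, he⟩ := h
  have hinj : Function.Injective (leftDexp x) := by rw [← he]; exact e.injective
  let f : W.toSubmodule →ₗ[ℝ] W.toSubmodule :=
    (leftDexp x).toLinearMap.restrict fun w hw => leftDexp_mem W hx hw
  have hf : Function.Injective f := fun a b hab =>
    Subtype.ext (hinj (congrArg Subtype.val hab))
  obtain ⟨a, ha⟩ := LinearMap.injective_iff_surjective.1 hf ⟨v, hv⟩
  have h1 : leftDexp x a = v := congrArg Subtype.val ha
  rw [← h1, ← he, ContinuousLinearMap.inverse_equiv]
  simp

/-- A short path in the group of units whose logarithmic derivative lies in a Lie subalgebra `W`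
ends in the exponential of a small element of `W`: the logarithm of the path solves a differential
equation which preserves `W`. -/
theorem exists_exp_eq_of_short_path (W : LieSubalgebra ℝ 𝔸) {ε : ℝ} (hε : 0 < ε) :
    ∃ δ > 0, ∀ u A : ℝ → 𝔸, u 0 = 1 → (∀ t ∈ I01, HasDerivWithinAt u (u t * A t) I01 t) →
      (∀ t ∈ I01, A t ∈ W) → ContinuousOn A I01 → (∀ t ∈ I01, ‖u t - 1‖ < δ) →
      ∃ ζ ∈ W, ‖ζ‖ < ε ∧ NormedSpace.exp ζ = u 1 := by
  obtain ⟨P, hP, hP'⟩ := exists_projection W.toSubmodule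
  have hexp1 : ContDiffAt ℝ 1 (NormedSpace.exp : 𝔸 → 𝔸) 0 := contDiff_exp.contDiffAt
  have hexp0 : HasFDerivAt (NormedSpace.exp : 𝔸 → 𝔸)
      ((ContinuousLinearEquiv.refl ℝ 𝔸 : 𝔸 ≃L[ℝ] 𝔸) : 𝔸 →L[ℝ] 𝔸) 0 :=
    hasFDerivAt_exp_zero (𝕂 := ℝ)
  set l : 𝔸 → 𝔸 := hexp1.localInverse hexp0 one_ne_zero with hl
  have hl1 : ContDiffAt ℝ 1 l 1 := by
    have := hexp1.to_localInverse hexp0 one_ne_zero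
    rwa [NormedSpace.exp_zero] at this
  have hl0 : l 1 = 0 := by
    have := hexp1.localInverse_apply_image hexp0 one_ne_zero
    rwa [NormedSpace.exp_zero] at this
  have hl2 : ∀ᶠ z in 𝓝 (1 : 𝔸), NormedSpace.exp (l z) = z := by
    have := (hexp1.hasStrictFDerivAt' hexp0 one_ne_zero).eventually_right_inverse
    rwa [NormedSpace.exp_zero] at this
  have hl3 : ∀ᶠ z in 𝓝 (1 : 𝔸), DifferentiableAt ℝ l z :=
    (hl1.eventually (by simp)).mono fun z hz => hz.differentiableAt one_ne_zero
  -- the vector field `x ↦ (leftDexp x)⁻¹ A` is Lipschitz near the origin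
  have hinv : ContDiffAt ℝ 1 (fun x : 𝔸 => (leftDexp x).inverse) 0 := by
    have h1 : ContDiffAt ℝ 1 ContinuousLinearMap.inverse (leftDexp (0 : 𝔸)) := by
      rw [leftDexp_zero]
      exact contDiffAt_map_inverse (ContinuousLinearEquiv.refl ℝ 𝔸)
    exact h1.comp 0 contDiff_leftDexp.contDiffAt
  obtain ⟨K, S, hS, hK⟩ := hinv.exists_lipschitzOnWith
  have hu : ∀ᶠ x in 𝓝 (0 : 𝔸), (leftDexp x).IsInvertible := by
    have h1 : ∀ᶠ T in 𝓝 (leftDexp (0 : 𝔸)), T.IsInvertible := by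
      rw [leftDexp_zero]
      exact (ContinuousLinearEquiv.refl ℝ 𝔸).nhds
    exact contDiff_leftDexp.continuous.continuousAt.eventually h1
  obtain ⟨r, hr, hrS⟩ := Metric.eventually_nhds_iff_ball.1 ((eventually_mem_set.2 hS).and hu)
  have hr' : 0 < min r ε / (1 + ‖P‖) := by positivity
  have hl4 : ∀ᶠ z in 𝓝 (1 : 𝔸), ‖l z‖ < min r ε / (1 + ‖P‖) := by
    have h1 := hl1.continuousAt.norm
    rw [ContinuousAt, hl0, norm_zero] at h1
    exact h1.eventually_lt_const hr'
  obtain ⟨δ, hδ, hδl⟩ := Metric.eventually_nhds_iff_ball.1 ((hl2.and hl3).and hl4)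
  refine ⟨δ, hδ, fun u A hu0 hud hAW hAc hclose => ?_⟩
  have hn : ∀ t ∈ I01, (NormedSpace.exp (l (u t)) = u t ∧ DifferentiableAt ℝ l (u t)) ∧
      ‖l (u t)‖ < min r ε / (1 + ‖P‖) := fun t ht =>
    hδl (u t) (by simpa [dist_eq_norm] using hclose t ht)
  have hP1 : (1 : ℝ) ≤ 1 + ‖P‖ := le_add_of_nonneg_right (norm_nonneg _)
  have hsmall : ∀ t ∈ I01, ‖l (u t)‖ < min r ε := fun t ht =>
    (hn t ht).2.trans_le (div_le_self (by positivity) hP1)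
  have hsmallP : ∀ t ∈ I01, ‖P (l (u t))‖ < min r ε := fun t ht => by
    have h1 := (lt_div_iff₀ (by positivity)).1 (hn t ht).2
    refine lt_of_le_of_lt ((P.le_opNorm _).trans ?_) h1
    rw [mul_comm]
    gcongr
    linarith
  have hball : ∀ x : 𝔸, ‖x‖ < min r ε → x ∈ S ∧ (leftDexp x).IsInvertible := fun x hx =>
    hrS x (by simpa using hx.trans_le (min_le_left _ _))
  -- the logarithm of `u` is an integral curve of this vector field
  have hderiv : ∀ t ∈ I01, HasDerivWithinAt (fun t => l (u t))
      ((leftDexp (l (u t))).inverse (A t)) I01 t := by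
    intro t ht
    have h1 : HasDerivWithinAt (fun t => l (u t)) (fderiv ℝ l (u t) (u t * A t)) I01 t :=
      (hn t ht).1.2.hasFDerivAt.comp_hasDerivWithinAt t (hud t ht)
    refine h1.congr_deriv ?_
    set z := fderiv ℝ l (u t) (u t * A t)
    have hd : HasFDerivAt NormedSpace.exp (fderiv ℝ NormedSpace.exp (l (u t))) (l (u t)) :=
      ((contDiff_exp (k := 1)).differentiable one_ne_zero).differentiableAt.hasFDerivAt
    have h2 : HasDerivWithinAt u (fderiv ℝ NormedSpace.exp (l (u t)) z) I01 t :=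
      (hd.comp_hasDerivWithinAt t h1).congr (fun s hs => (hn s hs).1.1.symm) (hn t ht).1.1.symm
    have h3 := (uniqueDiffOn_Icc zero_lt_one t ht).eq_deriv I01 h2 (hud t ht)
    have h5 : NormedSpace.exp (l (u t)) * leftDexp (l (u t)) z
        = NormedSpace.exp (l (u t)) * A t := by
      rw [← fderiv_exp_apply, h3, (hn t ht).1.1]
    have h4 : leftDexp (l (u t)) z = A t := by
      have := congrArg (NormedSpace.exp (-(l (u t))) * ·) h5
      simpa only [← mul_assoc, exp_neg_mul_exp, one_mul] using this
    obtain ⟨e, he⟩ := (hball _ (hsmall t ht)).2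
    rw [← h4, ← he, ContinuousLinearMap.inverse_equiv]
    simp
  obtain ⟨R, hR, hAR⟩ := exists_norm_le_of_continuousOn hAc
  have hmem := mem_of_invariant (F := fun t x => (leftDexp x).inverse (A t)) (K := K * R) hP hP'
    (by simp [hu0, hl0]) hderiv
    (fun t ht => leftDexp_inverse_mem W (hP' _) (hAW t ht) (hball _ (hsmallP t ht)).2)
    fun t ht => by
      rw [← sub_apply]
      refine (ContinuousLinearMap.le_opNorm _ _).trans ?_
      have h1 := hK.dist_le_mul _ (hball _ (hsmall t ht)).1 _ (hball _ (hsmallP t ht)).1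
      rw [dist_eq_norm, dist_eq_norm] at h1
      calc _ ≤ (K * ‖l (u t) - P (l (u t))‖) * R := by
              gcongr
              exact hAR t ht
        _ = _ := by ring
  have h1 : (1 : ℝ) ∈ I01 := by simp
  exact ⟨l (u 1), hmem 1 h1, (hsmall 1 h1).trans_le (min_le_right _ _), (hn 1 h1).1.1⟩

/-- A path of units whose logarithmic derivative lies in a Lie subalgebra `W` stays in every group
which contains its initial value and the exponentials of the elements of `W`. -/
theorem mem_subgroup_of_path (W : LieSubalgebra ℝ 𝔸) {H : Subgroup 𝔸ˣ}
    (hH : ∀ ζ ∈ W, ∀ g : 𝔸ˣ, (g : 𝔸) = NormedSpace.exp ζ → g ∈ H) {h : ℝ → 𝔸ˣ} {A : ℝ → 𝔸}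
    (hd : ∀ t ∈ I01, HasDerivWithinAt (fun t => (h t : 𝔸)) (h t * A t) I01 t)
    (hAW : ∀ t ∈ I01, A t ∈ W) (hA : ContinuousOn A I01) (h0 : h 0 ∈ H) :
    ∀ t ∈ I01, h t ∈ H := by
  obtain ⟨δ, hδ, hpath⟩ := exists_exp_eq_of_short_path W one_pos
  have hhc : ContinuousOn (fun t => (h t : 𝔸)) I01 := fun t ht => (hd t ht).continuousWithinAt
  -- membership in `H` is locally constant: nearby values of `h` differ by the end point of a short
  -- path, reparametrised to `[0,1]`
  have hconst : IsLocallyConstant fun t : I01 => h t ∈ H := by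
    refine (IsLocallyConstant.iff_eventually_eq _).2 fun t₀ => ?_
    have hc : ContinuousWithinAt (fun t => ‖((h t₀)⁻¹ : 𝔸ˣ) * (h t : 𝔸) - 1‖) I01 t₀ :=
      ((continuousWithinAt_const.mul (hhc t₀ t₀.2)).sub continuousWithinAt_const).norm
    have hlt := hc.tendsto.eventually_lt_const (u := δ) (by simpa using hδ)
    obtain ⟨η, hη, hball⟩ := Metric.mem_nhdsWithin_iff.1 hlt
    filter_upwards [Metric.ball_mem_nhds t₀ hη] with t ht
    have hmem : ∀ r ∈ I01, (t₀ : ℝ) + r * (t - t₀) ∈ I01 := fun r hr => by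
      obtain ⟨⟨a0, a1⟩, ⟨b0, b1⟩, c0, c1⟩ := And.intro t₀.2 (And.intro t.2 hr)
      constructor <;> nlinarith
    have hsub : ∀ r ∈ I01, ‖((h t₀)⁻¹ : 𝔸ˣ) * (h (t₀ + r * (t - t₀)) : 𝔸) - 1‖ < δ := by
      intro r hr
      refine hball ⟨?_, hmem r hr⟩
      have h1 : |(t : ℝ) - t₀| < η := ht
      rw [Metric.mem_ball, Real.dist_eq, add_sub_cancel_left, abs_mul, abs_of_nonneg hr.1]
      exact lt_of_le_of_lt (mul_le_of_le_one_left (abs_nonneg _) hr.2) h1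
    have hl : ∀ r, HasDerivWithinAt (fun r : ℝ => (t₀ : ℝ) + r * (t - t₀)) (t - t₀) I01 r :=
      fun r => by
        simpa using
          (((hasDerivAt_id r).mul_const ((t : ℝ) - t₀)).const_add (t₀ : ℝ)).hasDerivWithinAt
    obtain ⟨ζ, hζ, -, hexp⟩ := hpath
      (fun r => ((h t₀)⁻¹ : 𝔸ˣ) * (h (t₀ + r * (t - t₀)) : 𝔸))
      (fun r => ((t : ℝ) - t₀) • A (t₀ + r * (t - t₀))) (by simp)
      (fun r hr => by
        have h1 := ((hd _ (hmem r hr)).scomp r (hl r) hmem).const_mul (((h t₀)⁻¹ : 𝔸ˣ) : 𝔸)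
        refine h1.congr_deriv ?_
        simp [mul_assoc])
      (fun r hr => W.smul_mem _ (hAW _ (hmem r hr)))
      (continuousOn_const.smul (hA.comp (by fun_prop) hmem)) hsub
    have h2 : (h t₀)⁻¹ * h t ∈ H := hH ζ hζ _ (by rw [hexp]; simp)
    refine propext ⟨fun h3 => ?_, fun h3 => ?_⟩
    · have := H.mul_mem h3 (H.inv_mem h2)
      simpa using this
    · have := H.mul_mem h3 h2
      simpa using this
  have : PreconnectedSpace I01 := Subtype.preconnectedSpace isPreconnected_Icc
  intro t ht
  have := hconst.apply_eq_of_preconnectedSpace ⟨t, ht⟩ ⟨0, by simp⟩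
  exact this.mpr h0

/-- A local logarithm: a local inverse of the exponential map at the identity. -/
theorem exists_local_log : ∃ l : 𝔸 → 𝔸, l 1 = 0 ∧
    HasFDerivAt l (ContinuousLinearMap.id ℝ 𝔸) 1 ∧
    ∀ᶠ z in 𝓝 (1 : 𝔸), NormedSpace.exp (l z) = z := by
  have h : HasStrictFDerivAt (NormedSpace.exp : 𝔸 → 𝔸)
      ((ContinuousLinearEquiv.refl ℝ 𝔸 : 𝔸 ≃L[ℝ] 𝔸) : 𝔸 →L[ℝ] 𝔸) 0 :=
    hasStrictFDerivAt_exp_zero (𝕂 := ℝ)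
  have h1 := h.localInverse_apply_image
  have h2 := h.to_localInverse.hasFDerivAt
  have h3 := h.eventually_right_inverse
  rw [NormedSpace.exp_zero] at h1 h2 h3
  exact ⟨_, h1, h2, h3⟩

/-- Let `S` be a set such that the directions in which `S` approaches the identity lie in a subspace
`W`, and which is stable under multiplication by exponentials of elements of `W`. Then near the
identity `S` consists of such exponentials: otherwise the components transverse to `W` of elements
of `S` would yield a direction transverse to `W`. -/
theorem eventually_exists_exp_eq_of_directions (W : Submodule ℝ 𝔸) {S : Set 𝔸}
    (hdir : ∀ (f : Filter 𝔸) [f.NeBot] (Z : 𝔸 → 𝔸) (c : 𝔸 → ℝ) (X : 𝔸), Tendsto Z f (𝓝 0) →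
      (∀ᶠ i in f, NormedSpace.exp (Z i) ∈ S) → Tendsto (fun i => c i • Z i) f (𝓝 X) → X ∈ W)
    (hmul : ∀ w ∈ W, ∀ g ∈ S, NormedSpace.exp (-w) * g ∈ S) :
    ∀ᶠ M in 𝓝 (1 : 𝔸), M ∈ S → ∃ X ∈ W, NormedSpace.exp X = M := by
  have : ProperSpace 𝔸 := FiniteDimensional.proper ℝ 𝔸
  obtain ⟨P, hP, hP'⟩ := exists_projection W
  let Q : 𝔸 →L[ℝ] 𝔸 := ContinuousLinearMap.id ℝ _ - P
  have hQ : ∀ Z, Q Z = Z - P Z := fun Z => rfl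
  have hPQ : ∀ Z, P (Q Z) = 0 := fun Z => by rw [hQ, map_sub, hP _ (hP' Z), sub_self]
  have hQP : ∀ Z ∈ W, Q Z = 0 := fun Z hZ => by rw [hQ, hP Z hZ, sub_self]
  have hQQ : ∀ Z, Q (Q Z) = Q Z := fun Z => by rw [hQ (Q Z), hPQ, sub_zero]
  -- `Z ↦ exp (P Z) exp (Q Z)` is a local diffeomorphism
  have hΨ : HasStrictFDerivAt (fun Z => NormedSpace.exp (P Z) * NormedSpace.exp (Q Z) : 𝔸 → 𝔸)
      ((ContinuousLinearEquiv.refl ℝ 𝔸 : 𝔸 ≃L[ℝ] 𝔸) : 𝔸 →L[ℝ] 𝔸) 0 := by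
    have h0 : HasStrictFDerivAt (NormedSpace.exp : 𝔸 → 𝔸)
        (1 : 𝔸 →L[ℝ] 𝔸) 0 := hasStrictFDerivAt_exp_zero (𝕂 := ℝ)
    have hp : HasStrictFDerivAt (fun Z => NormedSpace.exp (P Z) : 𝔸 → 𝔸) P 0 := by
      rw [← map_zero P] at h0
      exact h0.comp 0 P.hasStrictFDerivAt
    have hq : HasStrictFDerivAt (fun Z => NormedSpace.exp (Q Z) : 𝔸 → 𝔸) Q 0 := by
      rw [← map_zero Q] at h0
      exact h0.comp 0 Q.hasStrictFDerivAt
    refine (hp.mul' hq).congr_fderiv (ContinuousLinearMap.ext fun Z => ?_)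
    change NormedSpace.exp (P 0) * Q Z + P Z * NormedSpace.exp (Q 0) = Z
    simp [hQ]
  have hΨ0 : NormedSpace.exp (P 0) * NormedSpace.exp (Q 0) = (1 : 𝔸) := by simp
  set l := hΨ.localInverse _ _ _ with hl
  have hl1 : ∀ᶠ M in 𝓝 (1 : 𝔸), NormedSpace.exp (P (l M)) * NormedSpace.exp (Q (l M)) = M := by
    have := hΨ.eventually_right_inverse
    rwa [hΨ0] at this
  have hl0 : Tendsto l (𝓝 1) (𝓝 0) := by
    have := hΨ.localInverse_tendsto
    rwa [hΨ0] at this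
  -- an ultrafilter of exceptional points converging to the identity
  by_contra hcon
  have hfr : ∃ᶠ M in 𝓝 (1 : 𝔸), M ∈ S ∧ ∀ X ∈ W, NormedSpace.exp X ≠ M := by
    intro h
    refine hcon (h.mono fun M hM hMS => ?_)
    by_contra hX
    push Not at hX
    exact hM ⟨hMS, hX⟩
  have hne := frequently_iff_neBot.1 hfr
  set f : Ultrafilter 𝔸 := Ultrafilter.of
    (𝓝 (1 : 𝔸) ⊓ 𝓟 {M | M ∈ S ∧ ∀ X ∈ W, NormedSpace.exp X ≠ M}) with hf
  have hfle : (f : Filter 𝔸) ≤ _ := Ultrafilter.of_le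
    (𝓝 (1 : 𝔸) ⊓ 𝓟 {M | M ∈ S ∧ ∀ X ∈ W, NormedSpace.exp X ≠ M})
  have hf1 : (f : Filter 𝔸) ≤ 𝓝 1 := hfle.trans inf_le_left
  have hf2 : ∀ᶠ M in (f : Filter 𝔸), M ∈ S ∧ ∀ X ∈ W, NormedSpace.exp X ≠ M :=
    le_principal_iff.1 (hfle.trans inf_le_right)
  let Y : 𝔸 → 𝔸 := fun M => Q (l M)
  have hY0 : Tendsto Y f (𝓝 0) := by
    have := (Q.continuous.tendsto 0).comp (hl0.mono_left hf1)
    rwa [map_zero] at this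
  have hYne : ∀ᶠ M in (f : Filter 𝔸), Y M ≠ 0 := by
    filter_upwards [hf1 hl1, hf2] with M hM ⟨_, hX⟩ hY
    rw [show Q (l M) = 0 from hY, NormedSpace.exp_zero, mul_one] at hM
    exact hX (P (l M)) (hP' _) hM
  have hYS : ∀ᶠ M in (f : Filter 𝔸), NormedSpace.exp (Y M) ∈ S := by
    filter_upwards [hf1 hl1, hf2] with M hM ⟨hMS, _⟩
    have h1 := hmul (P (l M)) (hP' _) M hMS
    nth_rewrite 2 [← hM] at h1
    rwa [← mul_assoc, exp_neg_mul_exp, one_mul] at h1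
  -- normalised transversal components accumulate at a unit vector of `W`
  obtain ⟨y, hy, hlim⟩ := isCompact_iff_ultrafilter_le_nhds.1 (isCompact_sphere (0 : 𝔸) 1)
    (f.map fun M => ‖Y M‖⁻¹ • Y M) (by
      rw [le_principal_iff]
      refine hYne.mono fun M hM => ?_
      simp [norm_smul, inv_mul_cancel₀ (norm_ne_zero_iff.2 hM)])
  have hlim' : Tendsto (fun M => ‖Y M‖⁻¹ • Y M) f (𝓝 y) := hlim
  have hyW := hdir f Y _ y hY0 hYS hlim'
  have h1 : Q y = y := by
    refine tendsto_nhds_unique ((Q.continuous.tendsto y).comp hlim') (hlim'.congr fun M => ?_)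
    simp [Y, hQQ]
  rw [hQP y hyW] at h1
  simp [← h1] at hy

end LiePaths

/-! ### The Lie algebra of a compact matrix group -/

section Group

set_option linter.unusedSectionVars false

/-- The Frobenius norm on complex matrices. The uniformity is the product uniformity on the nose, so
that the topology is the standard one. -/
noncomputable abbrev matNormedRing {n : ℕ} : NormedRing (Mat n) :=
  let R : NormedRing (Mat n) := Matrix.frobeniusNormedRing
  { Matrix.instRing with
    norm := R.norm
    dist := R.dist
    dist_self := R.dist_self
    dist_comm := R.dist_comm
    dist_triangle := R.dist_triangle
    eq_of_dist_eq_zero := R.eq_of_dist_eq_zero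
    dist_eq := R.dist_eq
    norm_mul_le := R.norm_mul_le
    edist := R.edist
    edist_dist := R.edist_dist
    toUniformSpace := (inferInstance : UniformSpace (Matrix (Fin n) (Fin n) ℂ))
    uniformity_dist := R.uniformity_dist
    toBornology := R.toBornology
    cobounded_sets := R.cobounded_sets }

attribute [local instance] matNormedRing

/-- Complex matrices with the Frobenius norm as a real normed algebra. -/
noncomputable abbrev matNormedAlgebra {n : ℕ} : NormedAlgebra ℝ (Mat n) :=
  { Matrix.instAlgebra with
    norm_smul_le := fun r x =>
      (Matrix.frobeniusNormedAlgebra (m := Fin n) (R := ℝ) (α := ℂ)).norm_smul_le r x }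

attribute [local instance] LieRing.ofAssociativeRing matNormedAlgebra

variable {n : ℕ} {G : Subgroup (GL (Fin n) ℂ)}

theorem exists_mem_of_tendsto (hG : IsCompactConnectedUnitary G) {ι : Type*} {f : Filter ι}
    [f.NeBot] {M : ι → Mat n} {M₀ : Mat n} (hM : ∀ᶠ i in f, ∃ g ∈ G, (g : Mat n) = M i)
    (h : Tendsto M f (𝓝 M₀)) : ∃ g ∈ G, (g : Mat n) = M₀ := by
  have hc : IsClosed ((fun g : GL (Fin n) ℂ => (g : Mat n)) '' (G : Set (GL (Fin n) ℂ))) :=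
    (hG.compact.image Units.continuous_val).isClosed
  exact hc.mem_of_tendsto h hM

/-- The unit of the matrix algebra given by an exponential. -/
noncomputable def expGL (X : Mat n) : GL (Fin n) ℂ :=
  ⟨NormedSpace.exp X, NormedSpace.exp (-X), exp_mul_exp_neg X, exp_neg_mul_exp X⟩

@[simp]
theorem coe_expGL (X : Mat n) : (expGL X : Mat n) = NormedSpace.exp X := rfl

@[simp]
theorem coe_expGL_inv (X : Mat n) : (((expGL X)⁻¹ : GL (Fin n) ℂ) : Mat n) = NormedSpace.exp (-X) :=
  rfl

theorem mem_lieAlg_iff {X : Mat n} : X ∈ lieAlg G ↔ ∀ t : ℝ, expGL (t • X) ∈ G := by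
  refine forall_congr' fun t => ⟨?_, fun h => ⟨_, h, rfl⟩⟩
  rintro ⟨g, hg, h⟩
  have : g = expGL (t • X) := Units.ext h
  rwa [← this]

theorem expGL_zpow (X : Mat n) (k : ℤ) : expGL X ^ k = expGL ((k : ℝ) • X) := by
  have h1 : ∀ s t : ℝ, expGL (s • X) * expGL (t • X) = expGL ((s + t) • X) := fun s t =>
    Units.ext (exp_add_smul_self X s t).symm
  have h2 : expGL X = expGL ((1 : ℝ) • X) := by rw [one_smul]
  have h3 : (expGL X)⁻¹ = expGL ((-1 : ℝ) • X) := by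
    rw [neg_one_smul]; exact Units.ext rfl
  induction k with
  | zero => ext1; simp [NormedSpace.exp_zero]
  | succ k ih =>
    rw [zpow_add_one, ih, h2, h1]
    push_cast
    rfl
  | pred k ih =>
    rw [zpow_sub_one, ih, h3, h1]
    push_cast
    rfl

/-- Directions of approach of `G` to the identity lie in its Lie algebra. -/
theorem mem_lieAlg_of_tendsto (hG : IsCompactConnectedUnitary G) {ι : Type*} {f : Filter ι}
    [f.NeBot] {Z : ι → Mat n} {c : ι → ℝ} {X : Mat n} (hZ : Tendsto Z f (𝓝 0))
    (hZG : ∀ᶠ i in f, ∃ g ∈ G, (g : Mat n) = NormedSpace.exp (Z i))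
    (hX : Tendsto (fun i => c i • Z i) f (𝓝 X)) : X ∈ lieAlg G := by
  intro t
  -- the powers of `exp (Z i)` to the integer parts of `t * c i` lie in `G` and tend to `exp (tX)`
  have h1 : Tendsto (fun i => Int.fract (t * c i) • Z i) f (𝓝 0) := by
    refine squeeze_zero_norm (fun i => ?_) (by simpa using hZ.norm)
    rw [norm_smul, Real.norm_of_nonneg (Int.fract_nonneg _)]
    exact mul_le_of_le_one_left (norm_nonneg _) (Int.fract_lt_one _).le
  have h2 : Tendsto (fun i => ((⌊t * c i⌋ : ℤ) : ℝ) • Z i) f (𝓝 (t • X)) := by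
    have := (hX.const_smul t).sub h1
    rw [sub_zero] at this
    refine this.congr fun i => ?_
    rw [smul_smul, ← sub_smul, Int.self_sub_fract]
  have h3 := ((contDiff_exp (𝔸 := Mat n) (k := 0)).continuous.tendsto _).comp h2
  refine exists_mem_of_tendsto hG ?_ h3
  filter_upwards [hZG] with i hi
  obtain ⟨g, hg, h⟩ := hi
  have hge : g = expGL (Z i) := Units.ext h
  refine ⟨expGL (Z i) ^ ⌊t * c i⌋, G.zpow_mem (hge ▸ hg) _, ?_⟩
  rw [expGL_zpow]
  rfl

theorem zero_mem_lieAlg : (0 : Mat n) ∈ lieAlg G := fun t =>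
  ⟨1, G.one_mem, by simp [NormedSpace.exp_zero]⟩

theorem smul_mem_lieAlg {X : Mat n} (hX : X ∈ lieAlg G) (c : ℝ) : c • X ∈ lieAlg G := fun t => by
  rw [smul_smul]; exact hX _

/-- The Lie algebra is closed under sums: `X + Y` is the direction in which `exp (sX) exp (sY)`
leaves the identity. -/
theorem add_mem_lieAlg (hG : IsCompactConnectedUnitary G) {X Y : Mat n} (hX : X ∈ lieAlg G)
    (hY : Y ∈ lieAlg G) : X + Y ∈ lieAlg G := by
  obtain ⟨l, hl0, hl, hexp⟩ := exists_local_log (𝔸 := Mat n)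
  have h1 : HasDerivAt (fun s : ℝ => NormedSpace.exp (s • X) * NormedSpace.exp (s • Y))
      (X + Y) 0 := by
    simpa using (hasDerivAt_exp_smul_const X (0 : ℝ)).fun_mul (hasDerivAt_exp_smul_const Y (0 : ℝ))
  have h10 : NormedSpace.exp ((0 : ℝ) • X) * NormedSpace.exp ((0 : ℝ) • Y) = (1 : Mat n) := by simp
  have h2 : HasDerivAt (fun s : ℝ => l (NormedSpace.exp (s • X) * NormedSpace.exp (s • Y)))
      (X + Y) 0 := by
    rw [← h10] at hl
    exact hl.comp_hasDerivAt 0 h1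
  have h3 := h2.tendsto_slope_zero_right
  simp only [zero_add, h10, hl0, sub_zero] at h3
  refine mem_lieAlg_of_tendsto hG (f := 𝓝[>] (0 : ℝ)) (c := fun s => s⁻¹) ?_ ?_ h3
  · have := h2.continuousAt.tendsto
    rw [h10, hl0] at this
    exact this.mono_left nhdsWithin_le_nhds
  · have h4 : Tendsto (fun s : ℝ => NormedSpace.exp (s • X) * NormedSpace.exp (s • Y)) (𝓝[>] 0)
        (𝓝 1) := by
      have := h1.continuousAt.tendsto
      rw [h10] at this
      exact this.mono_left nhdsWithin_le_nhds
    filter_upwards [h4.eventually hexp] with s hs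
    exact ⟨_, G.mul_mem (mem_lieAlg_iff.1 hX s) (mem_lieAlg_iff.1 hY s), by rw [hs]; rfl⟩

theorem conj_mem_lieAlg {g : GL (Fin n) ℂ} (hg : g ∈ G) {X : Mat n} (hX : X ∈ lieAlg G) :
    (g : Mat n) * X * ((g⁻¹ : GL (Fin n) ℂ) : Mat n) ∈ lieAlg G := by
  intro t
  refine ⟨g * expGL (t • X) * g⁻¹, G.mul_mem (G.mul_mem hg (mem_lieAlg_iff.1 hX t))
    (G.inv_mem hg), ?_⟩
  let _ : NormedAlgebra ℚ (Mat n) := NormedAlgebra.restrictScalars ℚ ℝ (Mat n)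
  have := NormedSpace.exp_units_conj g (t • X)
  rw [mul_smul_comm, smul_mul_assoc] at this
  rw [this]
  rfl

/-- The bracket is the derivative at `0` of `exp (sX) Y exp (-sX)`. -/
theorem lie_mem_lieAlg (hG : IsCompactConnectedUnitary G) {X Y : Mat n} (hX : X ∈ lieAlg G)
    (hY : Y ∈ lieAlg G) : ⁅X, Y⁆ ∈ lieAlg G := by
  let S : Submodule ℝ (Mat n) :=
    { carrier := lieAlg G
      add_mem' := add_mem_lieAlg hG
      zero_mem' := zero_mem_lieAlg
      smul_mem' := fun c _ h => smul_mem_lieAlg h c }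
  have hS : IsClosed (S : Set (Mat n)) := S.closed_of_finiteDimensional
  have h1 : HasDerivAt (fun s : ℝ => NormedSpace.exp (s • X) * Y * NormedSpace.exp (-(s • X)))
      ⁅X, Y⁆ 0 := by
    refine (((hasDerivAt_exp_smul_const X (0 : ℝ)).mul_const Y).mul
      (hasDerivAt_exp_neg_smul X 0)).congr_deriv ?_
    simp [Ring.lie_def, sub_eq_add_neg]
  refine hS.mem_of_tendsto h1.tendsto_slope_zero_right (Eventually.of_forall fun s => ?_)
  refine S.smul_mem _ (S.sub_mem ?_ ?_)
  · exact conj_mem_lieAlg (mem_lieAlg_iff.1 hX _) hY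
  · exact conj_mem_lieAlg (mem_lieAlg_iff.1 hX _) hY

/-- The Lie algebra of `G` as a real Lie subalgebra of the algebra of matrices. -/
def realLie (hG : IsCompactConnectedUnitary G) : LieSubalgebra ℝ (Mat n) :=
  { carrier := lieAlg G
    add_mem' := add_mem_lieAlg hG
    zero_mem' := zero_mem_lieAlg
    smul_mem' := fun c _ h => smul_mem_lieAlg h c
    lie_mem' := lie_mem_lieAlg hG }

/-- The Lie algebra of a group of unitary matrices consists of skew-Hermitian matrices. -/
theorem conjTranspose_of_mem_lieAlg (hG : IsCompactConnectedUnitary G) {X : Mat n}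
    (hX : X ∈ lieAlg G) : X.conjTranspose = -X := by
  have h1 : HasDerivAt (fun s : ℝ => NormedSpace.exp (s • X.conjTranspose)
      * NormedSpace.exp (s • X)) (X.conjTranspose + X) 0 := by
    simpa using (hasDerivAt_exp_smul_const X.conjTranspose (0 : ℝ)).fun_mul
      (hasDerivAt_exp_smul_const X (0 : ℝ))
  have h2 : (fun s : ℝ => NormedSpace.exp (s • X.conjTranspose) * NormedSpace.exp (s • X))
      = fun _ => 1 := by
    funext s
    have h3 := Matrix.mem_unitaryGroup_iff'.1 (hG.unitary _ (mem_lieAlg_iff.1 hX s))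
    have h4 : NormedSpace.exp (s • X.conjTranspose) = (NormedSpace.exp (s • X)).conjTranspose := by
      rw [← Matrix.exp_conjTranspose, Matrix.conjTranspose_smul, star_trivial]
    rw [h4]
    exact h3
  rw [h2] at h1
  exact eq_neg_of_add_eq_zero_left (h1.unique (hasDerivAt_const _ _))

/-- The complexified Lie algebra, as a real Lie subalgebra. -/
def complexLie (hG : IsCompactConnectedUnitary G) : LieSubalgebra ℝ (Mat n) :=
  { carrier := lieAlgC G
    add_mem' := by
      rintro _ _ ⟨X, hX, Y, hY, rfl⟩ ⟨X', hX', Y', hY', rfl⟩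
      exact ⟨X + X', add_mem_lieAlg hG hX hX', Y + Y', add_mem_lieAlg hG hY hY', by
        rw [smul_add]; abel⟩
    zero_mem' := ⟨0, zero_mem_lieAlg, 0, zero_mem_lieAlg, by simp⟩
    smul_mem' := by
      rintro c _ ⟨X, hX, Y, hY, rfl⟩
      exact ⟨c • X, smul_mem_lieAlg hX c, c • Y, smul_mem_lieAlg hY c, by
        rw [smul_add, smul_comm]⟩
    lie_mem' := by
      rintro _ _ ⟨X, hX, Y, hY, rfl⟩ ⟨X', hX', Y', hY', rfl⟩
      refine ⟨⁅X, X'⁆ + (-1 : ℝ) • ⁅Y, Y'⁆, add_mem_lieAlg hG (lie_mem_lieAlg hG hX hX')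
        (smul_mem_lieAlg (lie_mem_lieAlg hG hY hY') _), ⁅X, Y'⁆ + ⁅Y, X'⁆,
        add_mem_lieAlg hG (lie_mem_lieAlg hG hX hY') (lie_mem_lieAlg hG hY hX'), ?_⟩
      simp only [Ring.lie_def, mul_add, add_mul, mul_smul_comm, smul_mul_assoc, smul_add, smul_sub,
        smul_smul, Complex.I_mul_I, neg_smul, one_smul]
      abel }

theorem lieAlg_subset_lieAlgC {X : Mat n} (hX : X ∈ lieAlg G) : X ∈ lieAlgC G :=
  ⟨X, hX, 0, zero_mem_lieAlg, by simp⟩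

theorem conjTranspose_mem_lieAlgC (hG : IsCompactConnectedUnitary G) {Z : Mat n}
    (hZ : Z ∈ lieAlgC G) : Z.conjTranspose ∈ lieAlgC G := by
  obtain ⟨X, hX, Y, hY, rfl⟩ := hZ
  refine ⟨(-1 : ℝ) • X, smul_mem_lieAlg hX _, Y, hY, ?_⟩
  simp [conjTranspose_of_mem_lieAlg hG hX, conjTranspose_of_mem_lieAlg hG hY,
    Matrix.conjTranspose_smul]

/-- The compact form consists of the skew-Hermitian elements of its complexification. -/
theorem mem_lieAlg_of_skew (hG : IsCompactConnectedUnitary G) {Z : Mat n} (hZ : Z ∈ lieAlgC G)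
    (h : Z.conjTranspose = -Z) : Z ∈ lieAlg G := by
  obtain ⟨X, hX, Y, hY, rfl⟩ := hZ
  have h1 : Complex.I • Y = 0 := by
    rw [Matrix.conjTranspose_add, Matrix.conjTranspose_smul, conjTranspose_of_mem_lieAlg hG hX,
      conjTranspose_of_mem_lieAlg hG hY, Complex.star_def, Complex.conj_I, neg_smul, smul_neg,
      neg_neg, neg_add, add_right_inj] at h
    have h2 : (2 : ℝ) • (Complex.I • Y) = 0 := by
      rw [two_smul]; nth_rewrite 1 [h]; exact neg_add_cancel _
    exact (smul_eq_zero.1 h2).resolve_left two_ne_zero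
  rw [h1, add_zero]
  exact hX

theorem subset_complexification {g : GL (Fin n) ℂ} (hg : g ∈ G) : g ∈ complexification G :=
  Subgroup.subset_closure (Or.inl hg)

theorem exp_mem_complexification {Z : Mat n} (hZ : Z ∈ lieAlgC G) {g : GL (Fin n) ℂ}
    (hg : (g : Mat n) = NormedSpace.exp Z) : g ∈ complexification G :=
  Subgroup.subset_closure (Or.inr ⟨Z, hZ, hg⟩)

theorem conj_mem_lieAlgC_of_mem {g : GL (Fin n) ℂ} (hg : g ∈ G) {X : Mat n} (hX : X ∈ lieAlgC G) :
    (g : Mat n) * X * ((g⁻¹ : GL (Fin n) ℂ) : Mat n) ∈ lieAlgC G := by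
  obtain ⟨X, hX, Y, hY, rfl⟩ := hX
  refine ⟨_, conj_mem_lieAlg hg hX, _, conj_mem_lieAlg hg hY, ?_⟩
  rw [mul_add, add_mul, mul_smul_comm, smul_mul_assoc]

/-- The complexified Lie algebra is stable under the adjoint action of the complexified group. -/
theorem conj_mem_lieAlgC (hG : IsCompactConnectedUnitary G) {g : GL (Fin n) ℂ}
    (hg : g ∈ complexification G) {X : Mat n} (hX : X ∈ lieAlgC G) :
    (g : Mat n) * X * ((g⁻¹ : GL (Fin n) ℂ) : Mat n) ∈ lieAlgC G := by
  suffices h : ∀ X ∈ lieAlgC G, (g : Mat n) * X * ((g⁻¹ : GL (Fin n) ℂ) : Mat n) ∈ lieAlgC G ∧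
      ((g⁻¹ : GL (Fin n) ℂ) : Mat n) * X * (g : Mat n) ∈ lieAlgC G from (h X hX).1
  induction hg using Subgroup.closure_induction with
  | mem g hg =>
    intro X hX
    rcases hg with hg | ⟨Z, hZ, hg⟩
    · exact ⟨conj_mem_lieAlgC_of_mem hg hX, by
        simpa using conj_mem_lieAlgC_of_mem (G.inv_mem hg) hX⟩
    · have hg' : g = expGL Z := Units.ext hg
      subst hg'
      have h1 := exp_conj_mem (complexLie hG) hZ hX 1
      have h2 := exp_conj_mem (complexLie hG) hZ hX (-1)
      simp only [neg_smul, one_smul, neg_neg] at h1 h2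
      exact ⟨h2, h1⟩
  | one => intro X hX; simpa using hX
  | mul g h _ _ ihg ihh =>
    intro X hX
    have h1 := (ihg _ (ihh X hX).1).1
    have h2 := (ihh _ (ihg X hX).2).2
    simp only [mul_inv_rev, Units.val_mul, mul_assoc] at h1 h2 ⊢
    exact ⟨h1, h2⟩
  | inv g _ ih =>
    intro X hX
    rw [inv_inv]
    exact ⟨(ih X hX).2, (ih X hX).1⟩

theorem conj_mem_lieAlgC' (hG : IsCompactConnectedUnitary G) {g : GL (Fin n) ℂ}
    (hg : g ∈ complexification G) {X : Mat n} (hX : X ∈ lieAlgC G) :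
    ((g⁻¹ : GL (Fin n) ℂ) : Mat n) * X * (g : Mat n) ∈ lieAlgC G := by
  simpa using conj_mem_lieAlgC hG ((complexification G).inv_mem hg) hX

/-- Near the identity every element of the closed group `G` is the exponential of an element of its
Lie algebra. -/
theorem eventually_exists_exp_eq (hG : IsCompactConnectedUnitary G) :
    ∀ᶠ M in 𝓝 (1 : Mat n), ∀ g ∈ G, (g : Mat n) = M → ∃ X ∈ lieAlg G, expGL X = g := by
  have h := eventually_exists_exp_eq_of_directions (realLie hG).toSubmodule
    (S := {M | ∃ g ∈ G, (g : Mat n) = M})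
    (fun f _ Z c X hZ hZS hX => mem_lieAlg_of_tendsto hG hZ hZS hX) (by
      rintro w hw _ ⟨g, hg, rfl⟩
      have h1 : expGL w ∈ G := by simpa using mem_lieAlg_iff.1 hw 1
      exact ⟨(expGL w)⁻¹ * g, G.mul_mem (G.inv_mem h1) hg, rfl⟩)
  refine h.mono fun M hM g hg hgM => ?_
  obtain ⟨X, hX, hexp⟩ := hM ⟨g, hg, hgM⟩
  exact ⟨X, hX, Units.ext (hexp.trans hgM.symm)⟩

theorem isClass_of_contDiffOn {k : ℕ∞} {A : ℝ → Mat n} (h : ContDiffOn ℝ k A I01) : IsClass k A :=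
  fun i j => (Matrix.entryLinearMap ℝ ℂ i j).toContinuousLinearMap.contDiff.comp_contDiffOn h

end Group

/-! ### Convexity of the distance between solutions -/

section Convexity

set_option linter.unusedSectionVars false

attribute [local instance] matNormedRing matNormedAlgebra

open scoped Matrix

variable {n : ℕ}

/-- The real part of the trace. -/
noncomputable def reTr : Mat n →L[ℝ] ℝ :=
  (Complex.reLm.comp (Matrix.traceLinearMap (Fin n) ℝ ℂ)).toContinuousLinearMap

theorem reTr_apply (A : Mat n) : reTr A = A.trace.re := rfl

theorem reTr_mul_comm (A B : Mat n) : reTr (A * B) = reTr (B * A) := by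
  rw [reTr_apply, reTr_apply, Matrix.trace_mul_comm]

theorem reTr_conjTranspose (A : Mat n) : reTr Aᴴ = reTr A := by
  rw [reTr_apply, reTr_apply, Matrix.trace_conjTranspose, Complex.star_def, Complex.conj_re]

/-- The Frobenius norm is the norm of the real inner product `Re tr (Aᴴ B)`. -/
theorem reTr_conjTranspose_mul_self (A : Mat n) : reTr (Aᴴ * A) = ‖A‖ ^ 2 := by
  have h : ‖A‖ = (∑ i, ∑ j, ‖A i j‖ ^ (2 : ℝ)) ^ (1 / 2 : ℝ) := Matrix.frobenius_norm_def A
  rw [h, ← Real.sqrt_eq_rpow, Real.sq_sqrt (by positivity), reTr_apply, Matrix.trace,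
    Complex.re_sum, Finset.sum_comm]
  refine Finset.sum_congr rfl fun i _ => ?_
  rw [Matrix.diag_apply, Matrix.mul_apply, Complex.re_sum]
  refine Finset.sum_congr rfl fun j _ => ?_
  rw [Matrix.conjTranspose_apply, Complex.star_def, ← Complex.normSq_eq_conj_mul_self,
    Complex.ofReal_re, Complex.normSq_eq_norm_sq, Real.rpow_two]

theorem norm_conjTranspose (A : Mat n) : ‖Aᴴ‖ = ‖A‖ := Matrix.frobenius_norm_conjTranspose A

theorem reTr_conjTranspose_mul_comm (A B : Mat n) : reTr (Aᴴ * B) = reTr (Bᴴ * A) := by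
  rw [← reTr_conjTranspose, Matrix.conjTranspose_mul, Matrix.conjTranspose_conjTranspose]

/-- The Cauchy–Schwarz inequality for the real inner product `Re tr (Aᴴ B)`. -/
theorem reTr_mul_sq_le (A B : Mat n) : reTr (Aᴴ * B) ^ 2 ≤ ‖A‖ ^ 2 * ‖B‖ ^ 2 := by
  rcases eq_or_ne B 0 with rfl | hB
  · simp
  have hx : 0 < ‖B‖ ^ 2 := by positivity
  set x := ‖B‖ ^ 2 with hxd
  set y := reTr (Aᴴ * B) with hy
  have h : 0 ≤ ‖x • A - y • B‖ ^ 2 := by positivity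
  have hyx : reTr (Bᴴ * A) = y := by rw [reTr_conjTranspose_mul_comm]
  rw [← reTr_conjTranspose_mul_self] at h
  simp only [Matrix.conjTranspose_sub, Matrix.conjTranspose_smul, star_trivial, sub_mul, mul_sub,
    smul_mul_assoc, mul_smul_comm, map_sub, map_smul, smul_eq_mul, ← hy, hyx,
    reTr_conjTranspose_mul_self] at h
  nlinarith

theorem reTr_mul_le (A B : Mat n) : |reTr (Aᴴ * B)| ≤ ‖A‖ * ‖B‖ := by
  refine abs_le_of_sq_le_sq ?_ (by positivity)
  rw [mul_pow]
  exact reTr_mul_sq_le A B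

/-- The conjugate transpose as a real linear map. -/
noncomputable def ctL : Mat n →L[ℝ] Mat n :=
  LinearMap.toContinuousLinearMap
    { toFun := fun A => Aᴴ
      map_add' := Matrix.conjTranspose_add
      map_smul' := fun c A => by simp [Matrix.conjTranspose_smul] }

theorem hasDerivWithinAt_conjTranspose {u : ℝ → Mat n} {u' : Mat n} {s : Set ℝ} {t : ℝ}
    (h : HasDerivWithinAt u u' s t) : HasDerivWithinAt (fun t => (u t)ᴴ) u'ᴴ s t :=
  ctL.hasFDerivAt.comp_hasDerivWithinAt t h

theorem hasDerivWithinAt_reTr {u : ℝ → Mat n} {u' : Mat n} {s : Set ℝ} {t : ℝ}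
    (h : HasDerivWithinAt u u' s t) : HasDerivWithinAt (fun t => reTr (u t)) (reTr u') s t :=
  reTr.hasFDerivAt.comp_hasDerivWithinAt t h

theorem reTr_cycle (p q r s : Mat n) : reTr (p * q * r * s) = reTr (q * r * s * p) := by
  rw [mul_assoc, mul_assoc, reTr_mul_comm]
  simp only [mul_assoc]

/-- The contribution of the connection to the second derivative of `‖u‖²`; the letters `v`, `a'`,
`b'` stand for the adjoints of `u`, `a`, `b`. -/
theorem reTr_connection_identity (u v a a' b b' : Mat n) :
    reTr (((b' * v - v * a') * u + v * (u * b - a * u)) * (b + b') - v * u * (b * b' - b' * b))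
      - reTr (((u * b - a * u) * v + u * (b' * v - v * a')) * (a + a') - u * v * (a * a' - a' * a))
      = reTr (((b + b') * v - v * (a + a')) * (u * (b + b') - (a + a') * u)) := by
  have e1 : ∀ p s, reTr (p * v * u * s) = reTr (v * u * s * p) := fun p s => reTr_cycle p v u s
  have e2 : ∀ p s, reTr (p * u * v * s) = reTr (u * v * s * p) := fun p s => reTr_cycle p u v s
  have e3 : ∀ p s, reTr (u * p * v * s) = reTr (v * s * u * p) := fun p s => by
    rw [reTr_cycle, reTr_cycle]
  have e4 : ∀ p q, reTr (v * p * q * u) = reTr (u * v * p * q) := fun p q =>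
    (reTr_cycle _ _ _ _).symm
  have e5 : ∀ p s, reTr (p * v * s * u) = reTr (v * s * u * p) := fun p s => reTr_cycle _ _ _ _
  simp only [mul_add, add_mul, mul_sub, sub_mul, map_add, map_sub, ← mul_assoc, e1, e2, e3, e4, e5]
  ring

/-- The contribution of a Higgs field to the second derivative of `‖u‖²`, when `u` intertwines `c`
and `d`; the letters `v`, `c'`, `d'` stand for the adjoints of `u`, `c`, `d`. -/
theorem reTr_higgs_identity (u v c c' d d' : Mat n) (h : u * c = d * u) (h' : c' * v = v * d') :
    reTr (u * v * (d * d' - d' * d)) - reTr (v * u * (c * c' - c' * c))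
      = reTr ((c * v - v * d) * (u * c' - d' * u)) := by
  have h1 : reTr (u * v * (d' * d)) = reTr (v * u * (c * c')) := by
    rw [show u * v * (d' * d) = u * (v * d') * d by noncomm_ring, ← h', reTr_mul_comm,
      show d * (u * (c' * v)) = (d * u) * (c' * v) by noncomm_ring, ← h,
      show u * c * (c' * v) = (u * (c * c')) * v by noncomm_ring, reTr_mul_comm]
    congr 1; noncomm_ring
  have h2 : reTr (c * v * (d' * u)) = reTr (v * u * (c * c')) := by
    rw [show c * v * (d' * u) = c * (v * d') * u by noncomm_ring, ← h', reTr_mul_comm]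
    rw [show u * (c * (c' * v)) = (u * (c * c')) * v by noncomm_ring, reTr_mul_comm]
    congr 1; noncomm_ring
  have h3 : reTr (v * d * (u * c')) = reTr (v * u * (c * c')) := by
    rw [show v * d * (u * c') = v * (d * u) * c' by noncomm_ring, ← h]
    congr 1; noncomm_ring
  have h4 : reTr (v * d * (d' * u)) = reTr (u * v * (d * d')) := by
    rw [← mul_assoc, reTr_mul_comm]
    congr 1; noncomm_ring
  have h5 : reTr (c * v * (u * c')) = reTr (v * u * (c' * c)) := by
    rw [mul_assoc, reTr_mul_comm]
    congr 1; noncomm_ring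
  simp only [mul_sub, sub_mul, map_sub, h1, h2, h3, h4, h5]
  ring

/-- Two derivatives of `‖u‖²` for a path `u` which intertwines two sets of data `(b, c)` and
`(a, d)` satisfying the real equation up to errors `Ry` and `Rx`. Up to the error terms the second
derivative is a sum of squares. -/
theorem hasDerivWithinAt_normSq {u a b Rx Ry : ℝ → Mat n} {c d : Fin 3 → ℝ → Mat n}
    (hu : ∀ t ∈ I01, HasDerivWithinAt u ((2 : ℝ) • (u t * b t - a t * u t)) I01 t)
    (hb : ∀ t ∈ I01, HasDerivWithinAt (fun t => b t + (b t)ᴴ)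
      (Ry t - (2 : ℝ) • (⁅b t, (b t)ᴴ⁆ + ∑ i, ⁅c i t, (c i t)ᴴ⁆)) I01 t)
    (ha : ∀ t ∈ I01, HasDerivWithinAt (fun t => a t + (a t)ᴴ)
      (Rx t - (2 : ℝ) • (⁅a t, (a t)ᴴ⁆ + ∑ i, ⁅d i t, (d i t)ᴴ⁆)) I01 t)
    (huc : ∀ i, ∀ t ∈ I01, u t * c i t = d i t * u t) {t : ℝ} (ht : t ∈ I01) :
    HasDerivWithinAt (fun t => ‖u t‖ ^ 2)
      (2 * reTr ((u t)ᴴ * u t * (b t + (b t)ᴴ)) - 2 * reTr (u t * (u t)ᴴ * (a t + (a t)ᴴ))) I01 t ∧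
    HasDerivWithinAt (fun t => 2 * reTr ((u t)ᴴ * u t * (b t + (b t)ᴴ))
        - 2 * reTr (u t * (u t)ᴴ * (a t + (a t)ᴴ)))
      (4 * ‖u t * (b t + (b t)ᴴ) - (a t + (a t)ᴴ) * u t‖ ^ 2
        + 4 * ∑ i, ‖u t * (c i t)ᴴ - (d i t)ᴴ * u t‖ ^ 2
        + 2 * reTr ((u t)ᴴ * u t * Ry t) - 2 * reTr (u t * (u t)ᴴ * Rx t)) I01 t := by
  have hv := hasDerivWithinAt_conjTranspose (hu t ht)
  rw [Matrix.conjTranspose_smul, star_trivial, Matrix.conjTranspose_sub, Matrix.conjTranspose_mul,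
    Matrix.conjTranspose_mul] at hv
  constructor
  · simp only [← reTr_conjTranspose_mul_self]
    refine (hasDerivWithinAt_reTr (hv.fun_mul (hu t ht))).congr_deriv ?_
    have e1 : reTr ((b t)ᴴ * (u t)ᴴ * u t) = reTr ((u t)ᴴ * u t * (b t)ᴴ) := by
      rw [mul_assoc, reTr_mul_comm]
    have e2 : reTr ((u t)ᴴ * (a t)ᴴ * u t) = reTr (u t * (u t)ᴴ * (a t)ᴴ) := by
      rw [reTr_mul_comm, mul_assoc]
    have e3 : reTr ((u t)ᴴ * (a t * u t)) = reTr (u t * (u t)ᴴ * a t) := by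
      rw [← mul_assoc, reTr_mul_comm, mul_assoc]
    simp only [smul_mul_assoc, mul_smul_comm, map_add, map_smul, smul_eq_mul, sub_mul, mul_sub,
      map_sub, mul_add, e1, e2, e3, ← mul_assoc (u t)ᴴ (u t) (b t)]
    ring
  · have h1 := (hasDerivWithinAt_reTr ((hv.fun_mul (hu t ht)).fun_mul (hb t ht))).const_mul 2
    have h2 := (hasDerivWithinAt_reTr (((hu t ht).fun_mul hv).fun_mul (ha t ht))).const_mul 2
    refine (h1.sub h2).congr_deriv ?_
    have i1 := reTr_connection_identity (u t) (u t)ᴴ (a t) (a t)ᴴ (b t) (b t)ᴴ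
    have i2 : ∀ i, _ := fun i => reTr_higgs_identity (u t) (u t)ᴴ (c i t) (c i t)ᴴ (d i t) (d i t)ᴴ
      (huc i t ht) (by
        rw [← Matrix.conjTranspose_mul, huc i t ht, Matrix.conjTranspose_mul])
    have n1 : ‖u t * (b t + (b t)ᴴ) - (a t + (a t)ᴴ) * u t‖ ^ 2
        = reTr (((b t + (b t)ᴴ) * (u t)ᴴ - (u t)ᴴ * (a t + (a t)ᴴ))
          * (u t * (b t + (b t)ᴴ) - (a t + (a t)ᴴ) * u t)) := by
      rw [← reTr_conjTranspose_mul_self]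
      simp only [Matrix.conjTranspose_sub, Matrix.conjTranspose_mul, Matrix.conjTranspose_add,
        Matrix.conjTranspose_conjTranspose, add_comm]
    have n2 : ∀ i, ‖u t * (c i t)ᴴ - (d i t)ᴴ * u t‖ ^ 2
        = reTr ((c i t * (u t)ᴴ - (u t)ᴴ * d i t) * (u t * (c i t)ᴴ - (d i t)ᴴ * u t)) := by
      intro i
      rw [← reTr_conjTranspose_mul_self]
      simp only [Matrix.conjTranspose_sub, Matrix.conjTranspose_mul,
        Matrix.conjTranspose_conjTranspose]
    simp only [n1, n2, ← i1, ← i2, Finset.sum_sub_distrib, Ring.lie_def]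
    simp only [smul_mul_assoc, mul_smul_comm, map_add, map_smul, smul_eq_mul, add_mul,
      map_sub, mul_add, mul_sub, sub_mul, Finset.mul_sum, map_sum, smul_add,
      Finset.sum_sub_distrib, smul_sub]
    ring_nf

theorem convexOn_of_second_deriv_nonneg {f g k : ℝ → ℝ}
    (hf : ∀ t ∈ I01, HasDerivWithinAt f (g t) I01 t)
    (hg : ∀ t ∈ I01, HasDerivWithinAt g (k t) I01 t) (hk : ∀ t ∈ I01, 0 ≤ k t) :
    ConvexOn ℝ I01 f :=
  convexOn_of_hasDerivWithinAt2_nonneg (convex_Icc 0 1)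
    (fun t ht => (hf t ht).continuousWithinAt)
    (fun t ht => (hf t (interior_subset ht)).mono interior_subset)
    (fun t ht => (hg t (interior_subset ht)).mono interior_subset)
    fun t ht => hk t (interior_subset ht)

theorem le_of_second_deriv_nonneg {f g k : ℝ → ℝ} {M : ℝ}
    (hf : ∀ t ∈ I01, HasDerivWithinAt f (g t) I01 t)
    (hg : ∀ t ∈ I01, HasDerivWithinAt g (k t) I01 t) (hk : ∀ t ∈ I01, 0 ≤ k t)
    (h0 : f 0 ≤ M) (h1 : f 1 ≤ M) {t : ℝ} (ht : t ∈ I01) : f t ≤ M :=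
  ((convexOn_of_second_deriv_nonneg hf hg hk).le_max_of_mem_Icc (by simp) (by simp) ht).trans
    (max_le h0 h1)

/-- A function whose second derivative is at least `L` dips by `L / 8` at the midpoint. -/
theorem second_deriv_le_of_midpoint {f g k : ℝ → ℝ} {L M : ℝ}
    (hf : ∀ t ∈ I01, HasDerivWithinAt f (g t) I01 t)
    (hg : ∀ t ∈ I01, HasDerivWithinAt g (k t) I01 t) (hk : ∀ t ∈ I01, L ≤ k t)
    (h0 : f 0 ≤ M) (h1 : f 1 ≤ M) (hpos : 0 ≤ f (1 / 2)) : L ≤ 8 * M := by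
  -- adding `L t (1 - t) / 2` leaves a convex function with the same values at the ends
  have h := le_of_second_deriv_nonneg (f := fun t => f t + L / 2 * (t * (1 - t)))
    (g := fun t => g t + L / 2 * (1 - 2 * t)) (k := fun t => k t - L) (M := M)
    (fun t ht => by
      have hq : HasDerivAt (fun t : ℝ => t * (1 - t)) (1 - 2 * t) t :=
        ((hasDerivAt_id' t).fun_mul ((hasDerivAt_id' t).const_sub 1)).congr_deriv (by ring)
      exact (hf t ht).add (hq.const_mul (L / 2)).hasDerivWithinAt)
    (fun t ht => by
      refine ((hg t ht).add ((((hasDerivAt_id t).const_mul (2 : ℝ)).const_sub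
        (1 : ℝ)).const_mul (L / 2)).hasDerivWithinAt).congr_deriv ?_
      ring)
    (fun t ht => by have := hk t ht; linarith) (by simpa using h0) (by simpa using h1)
    (t := 1 / 2) (by constructor <;> norm_num)
  norm_num at h hpos
  linarith

/-- A bound on `[0,1]` for a nonnegative function `f` in terms of its values at the ends. The lower
bound on `f''` and the inequality `f'² ≤ 4fN` imply that the second derivative of `log (1 + f)` is
at least `-C`. -/
theorem le_of_log_second_deriv {f g k N : ℝ → ℝ} {C M : ℝ}
    (hf : ∀ t ∈ I01, HasDerivWithinAt f (g t) I01 t)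
    (hg : ∀ t ∈ I01, HasDerivWithinAt g (k t) I01 t) (hpos : ∀ t ∈ I01, 0 ≤ f t)
    (hN : ∀ t ∈ I01, 0 ≤ N t) (hgN : ∀ t ∈ I01, g t ^ 2 ≤ 4 * f t * N t) (hC : 0 ≤ C)
    (hk : ∀ t ∈ I01, 4 * N t - C * f t ≤ k t) (h0 : f 0 ≤ M) (h1 : f 1 ≤ M) {t : ℝ}
    (ht : t ∈ I01) : f t ≤ (1 + M) * Real.exp (C / 2) := by
  have hM : 0 ≤ M := (hpos 0 (by simp)).trans h0
  have hlog : ∀ s ∈ I01, f s ≤ M → Real.log (1 + f s) ≤ Real.log (1 + M) := fun s hs h =>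
    Real.log_le_log (by linarith [hpos s hs]) (by linarith)
  have h := le_of_second_deriv_nonneg (f := fun t => Real.log (1 + f t) + C / 2 * t ^ 2)
    (g := fun t => g t / (1 + f t) + C * t)
    (k := fun t => (k t * (1 + f t) - g t * g t) / (1 + f t) ^ 2 + C)
    (M := Real.log (1 + M) + C / 2)
    (fun t ht => by
      have h1 : (1 : ℝ) + f t ≠ 0 := by linarith [hpos t ht]
      refine (((hf t ht).const_add 1).log h1 |>.add
        (((hasDerivAt_pow 2 t).const_mul (C / 2)).hasDerivWithinAt)).congr_deriv ?_
      simp; ring)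
    (fun t ht => by
      have h1 : (1 : ℝ) + f t ≠ 0 := by linarith [hpos t ht]
      refine (((hg t ht).div ((hf t ht).const_add 1) h1).add
        (((hasDerivAt_id t).const_mul C).hasDerivWithinAt)).congr_deriv ?_
      simp)
    (fun t ht => by
      have h1 := hpos t ht
      have h2 : (k t * (1 + f t) - g t * g t) / (1 + f t) ^ 2 + C
          = (k t * (1 + f t) - g t * g t + C * (1 + f t) ^ 2) / (1 + f t) ^ 2 := by
        field_simp
      rw [h2]
      refine div_nonneg ?_ (by positivity)
      have h3 := hgN t ht
      have h4 := mul_le_mul_of_nonneg_right (hk t ht) (by linarith : (0 : ℝ) ≤ 1 + f t)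
      have h5 := hN t ht
      have h6 := mul_nonneg hC h1
      nlinarith)
    (by
      have := hlog 0 (by simp) h0
      simp only [ne_eq, OfNat.ofNat_ne_zero, not_false_eq_true, zero_pow, mul_zero, add_zero]
      linarith)
    (by
      have := hlog 1 (by simp) h1
      simp only [one_pow, mul_one]
      linarith) ht
  have h2 : Real.log (1 + f t) ≤ Real.log (1 + M) + C / 2 := by
    have : 0 ≤ C / 2 * t ^ 2 := by positivity
    linarith
  rw [← Real.log_exp (C / 2), ← Real.log_mul (by linarith) (by positivity)] at h2
  have h3 := (Real.log_le_log_iff (by linarith [hpos t ht]) (by positivity)).1 h2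
  linarith

/-- A complex gauge transformation between solutions of the real equation is bounded by its values
at the ends. -/
theorem norm_sq_le_of_real_eq {u a b : ℝ → Mat n} {c d : Fin 3 → ℝ → Mat n} {M : ℝ}
    (hu : ∀ t ∈ I01, HasDerivWithinAt u ((2 : ℝ) • (u t * b t - a t * u t)) I01 t)
    (hb : ∀ t ∈ I01, HasDerivWithinAt (fun t => b t + (b t)ᴴ)
      (-((2 : ℝ) • (⁅b t, (b t)ᴴ⁆ + ∑ i, ⁅c i t, (c i t)ᴴ⁆))) I01 t)
    (ha : ∀ t ∈ I01, HasDerivWithinAt (fun t => a t + (a t)ᴴ)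
      (-((2 : ℝ) • (⁅a t, (a t)ᴴ⁆ + ∑ i, ⁅d i t, (d i t)ᴴ⁆))) I01 t)
    (huc : ∀ i, ∀ t ∈ I01, u t * c i t = d i t * u t)
    (h0 : ‖u 0‖ ^ 2 ≤ M) (h1 : ‖u 1‖ ^ 2 ≤ M) {t : ℝ} (ht : t ∈ I01) : ‖u t‖ ^ 2 ≤ M := by
  have key := fun t ht => hasDerivWithinAt_normSq (Rx := fun _ => 0) (Ry := fun _ => 0) hu
    (fun t ht => (hb t ht).congr_deriv (zero_sub _).symm)
    (fun t ht => (ha t ht).congr_deriv (zero_sub _).symm) huc (t := t) ht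
  refine le_of_second_deriv_nonneg (f := fun t => ‖u t‖ ^ 2) (fun t ht => (key t ht).1)
    (fun t ht => (key t ht).2) (fun t _ => ?_) h0 h1 ht
  simp only [mul_zero, map_zero, add_zero, sub_zero]
  positivity

/-- If a complex gauge transformation which is the identity at both ends takes one solution of the
real equation to another, then it is unitary: `‖u‖²` and `‖u⁻¹‖²` are convex. -/
theorem conjTranspose_eq_of_real_eq {u w a b : ℝ → Mat n} {c d : Fin 3 → ℝ → Mat n}
    (hu : ∀ t ∈ I01, HasDerivWithinAt u ((2 : ℝ) • (u t * b t - a t * u t)) I01 t)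
    (hw : ∀ t ∈ I01, HasDerivWithinAt w ((2 : ℝ) • (w t * a t - b t * w t)) I01 t)
    (hb : ∀ t ∈ I01, HasDerivWithinAt (fun t => b t + (b t)ᴴ)
      (-((2 : ℝ) • (⁅b t, (b t)ᴴ⁆ + ∑ i, ⁅c i t, (c i t)ᴴ⁆))) I01 t)
    (ha : ∀ t ∈ I01, HasDerivWithinAt (fun t => a t + (a t)ᴴ)
      (-((2 : ℝ) • (⁅a t, (a t)ᴴ⁆ + ∑ i, ⁅d i t, (d i t)ᴴ⁆))) I01 t)
    (huc : ∀ i, ∀ t ∈ I01, u t * c i t = d i t * u t)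
    (hwu : ∀ t ∈ I01, w t * u t = 1) (h0 : u 0 = 1) (h1 : u 1 = 1) {t : ℝ} (ht : t ∈ I01) :
    (u t)ᴴ = w t := by
  have huw : ∀ t ∈ I01, u t * w t = 1 := fun t ht => mul_eq_one_comm.1 (hwu t ht)
  have hwd : ∀ i, ∀ t ∈ I01, w t * d i t = c i t * w t := fun i t ht => by
    calc w t * d i t = w t * (d i t * u t) * w t := by
          rw [mul_assoc, mul_assoc, huw t ht, mul_one]
      _ = c i t * w t := by
          rw [← huc i t ht, ← mul_assoc, hwu t ht, one_mul]
  have w0 : w 0 = 1 := by have := hwu 0 (by simp); rwa [h0, mul_one] at this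
  have w1 : w 1 = 1 := by have := hwu 1 (by simp); rwa [h1, mul_one] at this
  have b1 : ‖u t‖ ^ 2 ≤ ‖(1 : Mat n)‖ ^ 2 :=
    norm_sq_le_of_real_eq hu hb ha huc (by rw [h0]) (by rw [h1]) ht
  have b2 : ‖w t‖ ^ 2 ≤ ‖(1 : Mat n)‖ ^ 2 :=
    norm_sq_le_of_real_eq hw ha hb hwd (by rw [w0]) (by rw [w1]) ht
  -- since `w = u⁻¹`, the cross term is `tr 1 = ‖1‖²`
  have e : ‖(u t)ᴴ - w t‖ ^ 2 = ‖u t‖ ^ 2 + ‖w t‖ ^ 2 - 2 * ‖(1 : Mat n)‖ ^ 2 := by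
    have h3 : reTr ((1 : Mat n)) = ‖(1 : Mat n)‖ ^ 2 := by
      rw [← reTr_conjTranspose_mul_self]; simp
    have h4 : reTr ((w t)ᴴ * (u t)ᴴ) = reTr (1 : Mat n) := by
      rw [← Matrix.conjTranspose_mul, huw t ht, Matrix.conjTranspose_one]
    rw [← norm_conjTranspose (u t), ← reTr_conjTranspose_mul_self, Matrix.conjTranspose_sub,
      sub_mul, mul_sub, mul_sub, map_sub, map_sub, map_sub, reTr_conjTranspose_mul_self,
      reTr_conjTranspose_mul_self, h4,
      Matrix.conjTranspose_conjTranspose, huw t ht, h3]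
    ring
  have h5 : ‖(u t)ᴴ - w t‖ ^ 2 ≤ 0 := by rw [e]; linarith
  have h6 : ‖(u t)ᴴ - w t‖ = 0 := by
    have := norm_nonneg ((u t)ᴴ - w t)
    nlinarith
  exact sub_eq_zero.1 (norm_eq_zero.1 h6)

/-- The contribution of the connection `α` and its variation `a` to the second derivative of `tr (η
+ θ)²`, where `θ` stands for the adjoint of `η`. -/
theorem linearised_connection_identity (α η θ a : Mat n) :
    8 * reTr ((2 : ℝ) • (a - ⁅α, η⁆ + (a + ⁅α, θ⁆)) * a)
      - 4 * reTr (((2 : ℝ) • (a - ⁅α, η⁆ + (a + ⁅α, θ⁆))) * ⁅α, η - θ⁆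
        + (η + θ) * ⁅α, (2 : ℝ) • (a - ⁅α, η⁆ - (a + ⁅α, θ⁆))⁆)
      = 8 * reTr ((2 : ℝ) • (a + ⁅α, θ⁆) * ((2 : ℝ) • (a - ⁅α, η⁆))) := by
  have e1 : ∀ p q : Mat n, reTr (α * p * α * q) = reTr (α * q * α * p) := fun p q => by
    rw [reTr_cycle, reTr_cycle]
  have e2 : ∀ p q r : Mat n, reTr (p * q * r * α) = reTr (α * p * q * r) :=
    fun p q r => (reTr_cycle _ _ _ _).symm
  have e3 : ∀ p q : Mat n, reTr (p * α * α * q) = reTr (α * α * q * p) := fun p q =>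
    reTr_cycle _ _ _ _
  have c3 : ∀ p q r : Mat n, reTr (p * q * r) = reTr (q * r * p) := fun p q r => by
    rw [mul_assoc, reTr_mul_comm]
  have e5 : ∀ p q : Mat n, reTr (p * q * α) = reTr (α * p * q) := fun p q => (c3 _ _ _).symm
  have e6 : ∀ p q : Mat n, reTr (p * α * q) = reTr (α * q * p) := fun p q => c3 _ _ _
  simp only [Ring.lie_def, mul_add, add_mul, mul_sub, sub_mul, map_add, map_sub, smul_add, smul_sub,
    smul_mul_assoc, mul_smul_comm, map_smul, smul_eq_mul, ← mul_assoc]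
  simp only [e5 a η, e5 η a, e5 a θ, e5 θ a, e6 a η, e6 η a, e6 a θ, e6 θ a, e3, e2, e1 θ η]
  ring

/-- The contribution of a Higgs field to the second derivative of `tr (η + θ)²`; the letters `β'`,
`θ` stand for the adjoints of `β`, `η`. -/
theorem linearised_higgs_identity (β β' η θ : Mat n) :
    -(8 * reTr ((η + θ) * (⁅⁅β, η⁆, β'⁆ + ⁅β, ⁅θ, β'⁆⁆)))
      + 4 * reTr ((η + θ) * ⁅⁅β, β'⁆, η - θ⁆) = 8 * reTr (⁅β, η + θ⁆ * ⁅η + θ, β'⁆) := by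
  have e1 : ∀ p q r s : Mat n, reTr (p * q * r * s) = reTr (q * r * s * p) := fun p q r s =>
    reTr_cycle _ _ _ _
  have f1 : ∀ p q : Mat n, reTr (p * β * q * β') = reTr (β * q * β' * p) := fun p q => e1 _ _ _ _
  have f2 : ∀ p q : Mat n, reTr (p * β' * q * β) = reTr (β * p * β' * q) := fun p q => by
    rw [e1, e1, e1]
  have f4 : ∀ p q : Mat n, reTr (p * q * β * β') = reTr (β * β' * p * q) := fun p q => by
    rw [e1, e1]
  have f5 : ∀ p q : Mat n, reTr (p * q * β' * β) = reTr (β' * β * p * q) := fun p q => by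
    rw [e1, e1]
  have f6 : ∀ p q : Mat n, reTr (p * β * β' * q) = reTr (β * β' * q * p) := fun p q => e1 _ _ _ _
  have f7 : ∀ p q : Mat n, reTr (p * β' * β * q) = reTr (β' * β * q * p) := fun p q => e1 _ _ _ _
  have f9 : ∀ p q : Mat n, reTr (β * p * q * β') = reTr (β' * β * p * q) := fun p q => by
    rw [e1, e1, e1]
  simp only [Ring.lie_def, mul_add, add_mul, mul_sub, sub_mul, map_add, map_sub, ← mul_assoc]
  simp only [f1, f2, f4, f5, f6, f7, f9]
  ring

/-- Injectivity of the linearised boundary value problem: an infinitesimal deformation of a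
solution with Hermitian connection which moves the end point only in unitary directions is
trivial. The Hermitian part `χ` of the infinitesimal gauge transformation `η` vanishes at both ends
and `tr χ²` is convex. -/
theorem linearised_eq_zero {α η a : ℝ → Mat n} {β b : Fin 3 → ℝ → Mat n}
    (hα : ∀ t ∈ I01, HasDerivWithinAt α (-∑ i, ⁅β i t, (β i t)ᴴ⁆) I01 t)
    (ha : ∀ t ∈ I01, HasDerivWithinAt a (-∑ i, (⁅b i t, (β i t)ᴴ⁆ + ⁅β i t, (b i t)ᴴ⁆)) I01 t)
    (hb : ∀ i, ∀ t ∈ I01, b i t = ⁅β i t, η t⁆)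
    (hη : ∀ t ∈ I01, HasDerivWithinAt η ((2 : ℝ) • (a t - ⁅α t, η t⁆)) I01 t)
    (hαh : ∀ t ∈ I01, (α t)ᴴ = α t) (hah : ∀ t ∈ I01, (a t)ᴴ = a t)
    (h0 : η 0 = 0) (h1 : η 1 + (η 1)ᴴ = 0) : ∀ t ∈ I01, a t = 0 ∧ η t = 0 := by
  have hθ : ∀ t ∈ I01, HasDerivWithinAt (fun t => (η t)ᴴ)
      ((2 : ℝ) • (a t + ⁅α t, (η t)ᴴ⁆)) I01 t := by
    intro t ht
    refine (hasDerivWithinAt_conjTranspose (hη t ht)).congr_deriv ?_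
    rw [Matrix.conjTranspose_smul, star_trivial, Matrix.conjTranspose_sub, hah t ht, Ring.lie_def,
      Matrix.conjTranspose_sub, Matrix.conjTranspose_mul, Matrix.conjTranspose_mul, hαh t ht,
      Ring.lie_def]
    congr 1
    abel
  have hχ : ∀ t ∈ I01, HasDerivWithinAt (fun t => η t + (η t)ᴴ)
      ((2 : ℝ) • (a t - ⁅α t, η t⁆ + (a t + ⁅α t, (η t)ᴴ⁆))) I01 t := fun t ht => by
    rw [smul_add]; exact (hη t ht).fun_add (hθ t ht)
  have hκ : ∀ t ∈ I01, HasDerivWithinAt (fun t => η t - (η t)ᴴ)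
      ((2 : ℝ) • (a t - ⁅α t, η t⁆ - (a t + ⁅α t, (η t)ᴴ⁆))) I01 t := fun t ht => by
    rw [smul_sub]; exact (hη t ht).fun_sub (hθ t ht)
  have hαη : ∀ t ∈ I01, reTr (⁅α t, η t + (η t)ᴴ⁆ * (η t - (η t)ᴴ))
      = -reTr ((η t + (η t)ᴴ) * ⁅α t, η t - (η t)ᴴ⁆) := by
    intro t ht
    simp only [Ring.lie_def, sub_mul, mul_sub, map_sub]
    rw [reTr_mul_comm ((η t + (η t)ᴴ) * α t)]
    simp only [mul_add, add_mul, map_add, ← mul_assoc]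
    have c3 : ∀ p q r : Mat n, reTr (p * q * r) = reTr (q * r * p) := fun p q r => by
      rw [mul_assoc, reTr_mul_comm]
    have e5 : ∀ p q, reTr (p * q * α t) = reTr (α t * p * q) := fun p q => (c3 _ _ _).symm
    have e6 : ∀ p q, reTr (p * α t * q) = reTr (α t * q * p) := fun p q => c3 _ _ _
    simp only [e5, e6]
    ring
  -- the first and second derivatives of `f = tr χ²`; the second is a sum of squares
  have hf : ∀ t ∈ I01, HasDerivWithinAt (fun t => reTr ((η t + (η t)ᴴ) * (η t + (η t)ᴴ)))
      (8 * reTr ((η t + (η t)ᴴ) * a t)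
        - 4 * reTr ((η t + (η t)ᴴ) * ⁅α t, η t - (η t)ᴴ⁆)) I01 t := by
    intro t ht
    refine (hasDerivWithinAt_reTr ((hχ t ht).fun_mul (hχ t ht))).congr_deriv ?_
    rw [map_add, reTr_mul_comm (_ • _)]
    have e : a t - ⁅α t, η t⁆ + (a t + ⁅α t, (η t)ᴴ⁆)
        = (2 : ℝ) • a t - ⁅α t, η t - (η t)ᴴ⁆ := by
      rw [two_smul, Ring.lie_def, Ring.lie_def, Ring.lie_def]; noncomm_ring
    rw [e]
    simp only [smul_sub, mul_sub, map_sub, mul_smul_comm, map_smul, smul_eq_mul]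
    ring
  have hlieα : ∀ t ∈ I01, HasDerivWithinAt (fun t => ⁅α t, η t - (η t)ᴴ⁆)
      (⁅-∑ i, ⁅β i t, (β i t)ᴴ⁆, η t - (η t)ᴴ⁆
        + ⁅α t, (2 : ℝ) • (a t - ⁅α t, η t⁆ - (a t + ⁅α t, (η t)ᴴ⁆))⁆) I01 t := by
    intro t ht
    simp only [Ring.lie_def]
    refine (((hα t ht).fun_mul (hκ t ht)).fun_sub ((hκ t ht).fun_mul (hα t ht))).congr_deriv ?_
    simp only [Ring.lie_def]
    abel
  have hg : ∀ t ∈ I01, HasDerivWithinAt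
      (fun t => 8 * reTr ((η t + (η t)ᴴ) * a t) - 4 * reTr ((η t + (η t)ᴴ) * ⁅α t, η t - (η t)ᴴ⁆))
      (8 * ‖(2 : ℝ) • (a t - ⁅α t, η t⁆)‖ ^ 2
        + ∑ i, 8 * ‖⁅η t + (η t)ᴴ, (β i t)ᴴ⁆‖ ^ 2) I01 t := by
    intro t ht
    refine (((hasDerivWithinAt_reTr ((hχ t ht).fun_mul (ha t ht))).const_mul 8).fun_sub
      ((hasDerivWithinAt_reTr ((hχ t ht).fun_mul (hlieα t ht))).const_mul 4)).congr_deriv ?_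
    have i1 := linearised_connection_identity (α t) (η t) (η t)ᴴ (a t)
    have i2 := fun i => linearised_higgs_identity (β i t) (β i t)ᴴ (η t) (η t)ᴴ
    have n1 : ‖(2 : ℝ) • (a t - ⁅α t, η t⁆)‖ ^ 2 = reTr ((2 : ℝ) • (a t + ⁅α t, (η t)ᴴ⁆)
        * ((2 : ℝ) • (a t - ⁅α t, η t⁆))) := by
      rw [← reTr_conjTranspose_mul_self, Matrix.conjTranspose_smul, star_trivial,
        Matrix.conjTranspose_sub, hah t ht, Ring.lie_def, Matrix.conjTranspose_sub,
        Matrix.conjTranspose_mul, Matrix.conjTranspose_mul, hαh t ht, Ring.lie_def]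
      congr 3
      abel
    have n2 : ∀ i, ‖⁅η t + (η t)ᴴ, (β i t)ᴴ⁆‖ ^ 2
        = reTr (⁅β i t, η t + (η t)ᴴ⁆ * ⁅η t + (η t)ᴴ, (β i t)ᴴ⁆) := by
      intro i
      rw [← reTr_conjTranspose_mul_self]
      congr 2
      simp only [Ring.lie_def, Matrix.conjTranspose_sub, Matrix.conjTranspose_mul,
        Matrix.conjTranspose_add, Matrix.conjTranspose_conjTranspose, add_comm]
    have hbh : ∀ i, (b i t)ᴴ = ⁅(η t)ᴴ, (β i t)ᴴ⁆ := fun i => by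
      rw [hb i t ht, Ring.lie_def, Matrix.conjTranspose_sub, Matrix.conjTranspose_mul,
        Matrix.conjTranspose_mul, Ring.lie_def]
    have hl : ⁅-∑ i, ⁅β i t, (β i t)ᴴ⁆, η t - (η t)ᴴ⁆
        = -∑ i, ⁅⁅β i t, (β i t)ᴴ⁆, η t - (η t)ᴴ⁆ := by
      have : ∑ i, ⁅⁅β i t, (β i t)ᴴ⁆, η t - (η t)ᴴ⁆
          = (∑ i, ⁅β i t, (β i t)ᴴ⁆) * (η t - (η t)ᴴ)
            - (η t - (η t)ᴴ) * ∑ i, ⁅β i t, (β i t)ᴴ⁆ := by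
        rw [Finset.sum_mul, Finset.mul_sum, ← Finset.sum_sub_distrib]
        exact Finset.sum_congr rfl fun i _ => Ring.lie_def _ _
      rw [this, Ring.lie_def, neg_mul, mul_neg]
      abel
    have i3 : ∑ i, 8 * ‖⁅η t + (η t)ᴴ, (β i t)ᴴ⁆‖ ^ 2
        = 8 * reTr ((η t + (η t)ᴴ) * -∑ i, (⁅b i t, (β i t)ᴴ⁆ + ⁅β i t, (b i t)ᴴ⁆))
          - 4 * reTr ((η t + (η t)ᴴ) * ⁅-∑ i, ⁅β i t, (β i t)ᴴ⁆, η t - (η t)ᴴ⁆) := by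
      simp only [hbh]
      simp only [hl, mul_neg, map_neg, Finset.mul_sum, map_sum, hb _ t ht]
      rw [sub_neg_eq_add, ← Finset.sum_neg_distrib, ← Finset.sum_add_distrib]
      exact Finset.sum_congr rfl fun i _ => by rw [n2, ← i2 i]
    rw [i3, n1, ← i1]
    simp only [mul_add, map_add]
    ring
  have hfpos : ∀ t ∈ I01, reTr ((η t + (η t)ᴴ) * (η t + (η t)ᴴ)) = ‖η t + (η t)ᴴ‖ ^ 2 := by
    intro t ht
    rw [← reTr_conjTranspose_mul_self]
    simp [add_comm]
  -- `f` is convex, nonnegative and vanishes at both ends, so all the squares vanish; one of them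
  -- is `‖η'‖²`
  have hf0 : ∀ t ∈ I01, reTr ((η t + (η t)ᴴ) * (η t + (η t)ᴴ)) = 0 := fun t ht => by
    refine le_antisymm (le_of_second_deriv_nonneg hf hg (fun t _ => by positivity)
      (by simp [h0]) (by simp [h1]) ht) ?_
    rw [hfpos t ht]; positivity
  have hg0 : ∀ t ∈ I01, 8 * reTr ((η t + (η t)ᴴ) * a t)
      - 4 * reTr ((η t + (η t)ᴴ) * ⁅α t, η t - (η t)ᴴ⁆) = 0 := fun t ht =>
    (uniqueDiffOn_Icc zero_lt_one t ht).eq_deriv I01 (hf t ht)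
      ((hasDerivWithinAt_const t I01 (0 : ℝ)).congr hf0 (hf0 t ht))
  have hk0 : ∀ t ∈ I01, (2 : ℝ) • (a t - ⁅α t, η t⁆) = 0 := fun t ht => by
    have h2 := (uniqueDiffOn_Icc zero_lt_one t ht).eq_deriv I01 (hg t ht)
      ((hasDerivWithinAt_const t I01 (0 : ℝ)).congr hg0 (hg0 t ht))
    have h3 : 0 ≤ ∑ i, 8 * ‖⁅η t + (η t)ᴴ, (β i t)ᴴ⁆‖ ^ 2 := by positivity
    have h4 : ‖(2 : ℝ) • (a t - ⁅α t, η t⁆)‖ ^ 2 = 0 :=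
      le_antisymm (by linarith) (by positivity)
    exact norm_eq_zero.1 (pow_eq_zero_iff two_ne_zero |>.1 h4)
  have hη0 : ∀ t ∈ I01, η t = 0 := eq_zero_of_norm_deriv_le (K := 0) hη h0 fun t ht => by
    rw [hk0 t ht]; simp
  intro t ht
  refine ⟨?_, hη0 t ht⟩
  have h2 := (smul_eq_zero.1 (hk0 t ht)).resolve_left two_ne_zero
  rw [hη0 t ht] at h2
  simpa [Ring.lie_def] using h2

end Convexity

/-! ### Paths in the complexified group -/

section TangentPaths

set_option linter.unusedSectionVars false

attribute [local instance] LieRing.ofAssociativeRing matNormedRing matNormedAlgebra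

variable {n : ℕ} {G : Subgroup (GL (Fin n) ℂ)}

/-- A path `u` in the complexified group whose logarithmic derivative `u⁻¹u'` is a continuous path
in the complexified Lie algebra. -/
structure TangentPath (G : Subgroup (GL (Fin n) ℂ)) (u : ℝ → GL (Fin n) ℂ) : Prop where
  mem : ∀ t ∈ I01, u t ∈ complexification G
  deriv : ∃ A : ℝ → Mat n, ContinuousOn A I01 ∧ (∀ t ∈ I01, A t ∈ lieAlgC G) ∧
    ∀ t ∈ I01, HasDerivWithinAt (fun t => (u t : Mat n)) (u t * A t) I01 t

theorem hasDerivWithinAt_coe_inv {u : ℝ → GL (Fin n) ℂ} {u' : Mat n} {s : Set ℝ} {t : ℝ}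
    (h : HasDerivWithinAt (fun t => (u t : Mat n)) u' s t) :
    HasDerivWithinAt (fun t => (((u t)⁻¹ : GL (Fin n) ℂ) : Mat n))
      (-((((u t)⁻¹ : GL (Fin n) ℂ) : Mat n) * u' * (((u t)⁻¹ : GL (Fin n) ℂ) : Mat n))) s t := by
  have h1 := (hasFDerivAt_ringInverse (𝕜 := ℝ) (u t)).comp_hasDerivWithinAt t h
  have e : (fun t => (((u t)⁻¹ : GL (Fin n) ℂ) : Mat n))
      = Ring.inverse ∘ fun t => (u t : Mat n) := by
    funext t; simp
  rw [e]
  exact h1.congr_deriv (by simp)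

namespace TangentPath

theorem continuousOn {u : ℝ → GL (Fin n) ℂ} (hu : TangentPath G u) :
    ContinuousOn (fun t => (u t : Mat n)) I01 := by
  obtain ⟨A, -, -, h⟩ := hu.deriv
  exact fun t ht => (h t ht).continuousWithinAt

/-- A path with logarithmic derivative in the complexified Lie algebra does not leave the
complexified group. -/
theorem of_deriv (hG : IsCompactConnectedUnitary G) {u : ℝ → GL (Fin n) ℂ} {A : ℝ → Mat n}
    (h0 : u 0 ∈ complexification G) (hA : ContinuousOn A I01) (hAV : ∀ t ∈ I01, A t ∈ lieAlgC G)
    (hd : ∀ t ∈ I01, HasDerivWithinAt (fun t => (u t : Mat n)) (u t * A t) I01 t) :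
    TangentPath G u :=
  ⟨mem_subgroup_of_path (complexLie hG) (fun _ hζ _ hg => exp_mem_complexification hζ hg) hd hAV hA
    h0, A, hA, hAV, hd⟩

theorem inv (hG : IsCompactConnectedUnitary G) {u : ℝ → GL (Fin n) ℂ} (hu : TangentPath G u) :
    TangentPath G fun t => (u t)⁻¹ := by
  obtain ⟨A, hA, hAV, hd⟩ := hu.deriv
  have hi : ContinuousOn (fun t => (((u t)⁻¹ : GL (Fin n) ℂ) : Mat n)) I01 := fun t ht =>
    (hasDerivWithinAt_coe_inv (hd t ht)).continuousWithinAt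
  refine ⟨fun t ht => inv_mem (hu.mem t ht),
    fun t => -((u t : Mat n) * A t * ((u t)⁻¹ : GL (Fin n) ℂ)),
    ((hu.continuousOn.mul hA).mul hi).neg, fun t ht => ?_, fun t ht => ?_⟩
  · exact (complexLie hG).neg_mem (conj_mem_lieAlgC hG (hu.mem t ht) (hAV t ht))
  · refine (hasDerivWithinAt_coe_inv (hd t ht)).congr_deriv ?_
    simp only [mul_neg, mul_assoc]

theorem mul (hG : IsCompactConnectedUnitary G) {u v : ℝ → GL (Fin n) ℂ} (hu : TangentPath G u)
    (hv : TangentPath G v) : TangentPath G fun t => u t * v t := by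
  have hi := (hv.inv hG).continuousOn
  obtain ⟨A, hA, hAV, hd⟩ := hu.deriv
  obtain ⟨A', hA', hAV', hd'⟩ := hv.deriv
  refine ⟨fun t ht => mul_mem (hu.mem t ht) (hv.mem t ht),
    fun t => (((v t)⁻¹ : GL (Fin n) ℂ) : Mat n) * A t * v t + A' t,
    ((hi.mul hA).mul hv.continuousOn).add hA', fun t ht => ?_, fun t ht => ?_⟩
  · exact (complexLie hG).add_mem (conj_mem_lieAlgC' hG (hv.mem t ht) (hAV t ht)) (hAV' t ht)
  · simp only [Units.val_mul]
    refine ((hd t ht).fun_mul (hd' t ht)).congr_deriv ?_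
    have e : (v t : Mat n) * (((v t)⁻¹ : GL (Fin n) ℂ) : Mat n) = 1 := Units.mul_inv _
    calc _ = (u t : Mat n) * (1 : Mat n) * A t * v t + u t * (v t * A' t) := by noncomm_ring
      _ = _ := by rw [← e]; noncomm_ring

theorem expGL_smul (hG : IsCompactConnectedUnitary G) {Z : Mat n} (hZ : Z ∈ lieAlgC G) :
    TangentPath G fun t => expGL (t • Z) :=
  ⟨fun t _ => exp_mem_complexification ((complexLie hG).smul_mem t hZ) rfl, fun _ => Z,
    continuousOn_const, fun _ _ => hZ, fun t _ => (hasDerivAt_exp_smul_const Z t).hasDerivWithinAt⟩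

/-- A short path from the identity ends at the exponential of a short vector. -/
theorem exists_exp_eq (hG : IsCompactConnectedUnitary G) {ε : ℝ} (hε : 0 < ε) :
    ∃ δ > 0, ∀ u : ℝ → GL (Fin n) ℂ, TangentPath G u → u 0 = 1 →
      (∀ t ∈ I01, ‖(u t : Mat n) - 1‖ < δ) →
      ∃ ζ ∈ lieAlgC G, ‖ζ‖ < ε ∧ NormedSpace.exp ζ = (u 1 : Mat n) := by
  obtain ⟨δ, hδ, h⟩ := exists_exp_eq_of_short_path (complexLie hG) hε
  refine ⟨δ, hδ, fun u hu h0 hs => ?_⟩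
  obtain ⟨A, hA, hAV, hd⟩ := hu.deriv
  exact h (fun t => u t) A (by simp [h0]) hd hAV hA hs

end TangentPath

/-- The elements of `G` which are joined to `1` by a smooth path in `G`. -/
def smoothlyReachable (hG : IsCompactConnectedUnitary G) : Subgroup (GL (Fin n) ℂ) where
  carrier := {k | ∃ u : ℝ → GL (Fin n) ℂ, (∀ t, u t ∈ G) ∧ u 0 = 1 ∧ u 1 = k ∧
    IsClass ⊤ (fun t => (u t : Mat n)) ∧ TangentPath G u}
  one_mem' := ⟨fun _ => 1, fun _ => G.one_mem, rfl, rfl, fun _ _ => contDiffOn_const,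
    fun _ _ => one_mem _, fun _ => 0, continuousOn_const, fun _ _ => (complexLie hG).zero_mem,
    fun t _ => (hasDerivWithinAt_const _ _ _).congr_deriv (mul_zero _).symm⟩
  mul_mem' := by
    rintro _ _ ⟨u, hu, hu0, rfl, hc, ht⟩ ⟨v, hv, hv0, rfl, hc', ht'⟩
    exact ⟨fun t => u t * v t, fun t => G.mul_mem (hu t) (hv t), by simp [hu0, hv0], rfl,
      by simpa only [Units.val_mul] using hc.mul hc', ht.mul hG ht'⟩
  inv_mem' := by
    rintro _ ⟨u, hu, hu0, rfl, hc, ht⟩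
    exact ⟨fun t => (u t)⁻¹, fun t => G.inv_mem (hu t), by simp [hu0], rfl, hc.inv, ht.inv hG⟩

/-- Every element of the connected group `G` is smoothly reachable from the identity: the smoothly
reachable elements form a subgroup which contains the exponentials, and hence is open. -/
theorem mem_smoothlyReachable (hG : IsCompactConnectedUnitary G) {k : GL (Fin n) ℂ} (hk : k ∈ G) :
    k ∈ smoothlyReachable hG := by
  have hnhds : ((smoothlyReachable hG).subgroupOf G : Set G) ∈ 𝓝 (1 : G) := by
    have hc : ContinuousAt (fun g : G => ((g : GL (Fin n) ℂ) : Mat n)) 1 :=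
      (Units.continuous_val.comp continuous_subtype_val).continuousAt
    have h1 : ((((1 : G) : GL (Fin n) ℂ)) : Mat n) = 1 := rfl
    rw [ContinuousAt, h1] at hc
    filter_upwards [hc.eventually (eventually_exists_exp_eq hG)] with g hg
    obtain ⟨X, hX, hXg⟩ := hg g g.2 rfl
    refine ⟨fun t => expGL (t • X), mem_lieAlg_iff.1 hX, ?_, ?_, isClass_of_contDiffOn ?_,
      TangentPath.expGL_smul hG (lieAlg_subset_lieAlgC hX)⟩
    · ext1; simp
    · simpa using hXg
    · exact (contDiff_exp.comp (contDiff_id.smul contDiff_const)).contDiffOn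
  have hopen : IsOpen ((smoothlyReachable hG).subgroupOf G : Set G) :=
    Subgroup.isOpen_of_mem_nhds _ hnhds
  have : PreconnectedSpace G := Subtype.preconnectedSpace hG.connected.isPreconnected
  have huniv := IsClopen.eq_univ ⟨Subgroup.isClosed_of_isOpen _ hopen, hopen⟩ ⟨1, one_mem _⟩
  have : (⟨k, hk⟩ : G) ∈ ((smoothlyReachable hG).subgroupOf G : Set G) := by rw [huniv]; trivial
  exact this

/-- The complexified Lie algebra as a real vector space. -/
def complexLieSpace (hG : IsCompactConnectedUnitary G) : Submodule ℝ (Mat n) :=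
  (complexLie hG).toSubmodule

theorem mem_complexLieSpace {hG : IsCompactConnectedUnitary G} {X : Mat n} :
    X ∈ complexLieSpace hG ↔ X ∈ lieAlgC G := Iff.rfl

theorem mul_sub_mul_mem_lieAlgC (hG : IsCompactConnectedUnitary G) {X Y : Mat n}
    (hX : X ∈ lieAlgC G) (hY : Y ∈ lieAlgC G) : X * Y - Y * X ∈ lieAlgC G :=
  (complexLie hG).lie_mem hX hY

end TangentPaths

/-! ### The equations for a Hermitian connection -/

section HermitianGauge

attribute [local instance] matNormedRing matNormedAlgebra

open scoped Matrix

variable {n : ℕ} {G : Subgroup (GL (Fin n) ℂ)}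

/-- The values `(α, β, h, h⁻¹)` of a solution together with its complex gauge transformation. -/
abbrev NahmSpace (n : ℕ) : Type := Mat n × (Fin 3 → Mat n) × Mat n × Mat n

/-- The bilinear map whose diagonal is the vector field of the Nahm equations for Hermitian `α`,
together with `h' = 2hα` and `k' = -2αk`. The inverse `k` of `h` is a separate variable, so that the
field is defined, and quadratic, on a whole vector space. -/
noncomputable def nahmField : NahmSpace n →L[ℝ] NahmSpace n →L[ℝ] NahmSpace n :=
  LinearMap.toContinuousBilinearMap <| LinearMap.mk₂ ℝ
    (fun y z : NahmSpace n => ((-∑ i, (y.2.1 i * (z.2.1 i)ᴴ - (z.2.1 i)ᴴ * y.2.1 i),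
      (fun i => -((2 : ℝ) • (y.1 * z.2.1 i - z.2.1 i * y.1))),
      (2 : ℝ) • (y.2.2.1 * z.1), -((2 : ℝ) • (y.1 * z.2.2.2))) : NahmSpace n))
    (fun x y z => by
      refine Prod.ext ?_ (Prod.ext (funext fun i => ?_) (Prod.ext ?_ ?_)) <;>
      simp only [Prod.fst_add, Prod.snd_add, Pi.add_apply, add_mul, mul_add, smul_add,
        Finset.sum_add_distrib, Finset.sum_sub_distrib, smul_sub] <;> abel)
    (fun c x y => by
      refine Prod.ext ?_ (Prod.ext (funext fun i => ?_) (Prod.ext ?_ ?_)) <;>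
      simp only [Prod.smul_fst, Prod.smul_snd, Pi.smul_apply, smul_mul_assoc, mul_smul_comm,
        Finset.smul_sum, smul_sub, smul_neg, smul_comm c (2 : ℝ)])
    (fun x y z => by
      refine Prod.ext ?_ (Prod.ext (funext fun i => ?_) (Prod.ext ?_ ?_)) <;>
      simp only [Prod.fst_add, Prod.snd_add, Pi.add_apply, add_mul, mul_add, smul_add,
        Finset.sum_add_distrib, Finset.sum_sub_distrib, smul_sub,
        Matrix.conjTranspose_add] <;> abel)
    (fun c x y => by
      refine Prod.ext ?_ (Prod.ext (funext fun i => ?_) (Prod.ext ?_ ?_)) <;>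
      simp only [Prod.smul_fst, Prod.smul_snd, Pi.smul_apply, smul_mul_assoc, mul_smul_comm,
        Finset.smul_sum, smul_sub, smul_neg, smul_comm c (2 : ℝ), Matrix.conjTranspose_smul,
        star_trivial])

theorem nahmField_apply (y z : NahmSpace n) : nahmField y z =
    (-∑ i, (y.2.1 i * (z.2.1 i)ᴴ - (z.2.1 i)ᴴ * y.2.1 i),
      (fun i => -((2 : ℝ) • (y.1 * z.2.1 i - z.2.1 i * y.1))),
      (2 : ℝ) • (y.2.2.1 * z.1), -((2 : ℝ) • (y.1 * z.2.2.2))) := rfl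

/-- A solution in Hermitian gauge with `β(0) = τ`, with the gauge transformation `h` determined by
`h' = 2hα`, `h(0) = 1`. That `α` is Hermitian and that `α` and `β` take values in the complexified
Lie algebra is required at time `0` only, since the equation preserves both properties. -/
structure HermitianNahm (G : Subgroup (GL (Fin n) ℂ)) (τ : Fin 3 → Mat n) (y : ℝ → NahmSpace n) :
    Prop where
  ode : ∀ t ∈ I01, HasDerivWithinAt y (nahmField (y t) (y t)) I01 t
  mem_zero : (y 0).1 ∈ lieAlgC G
  herm_zero : (y 0).1ᴴ = (y 0).1
  init : (y 0).2 = (τ, 1, 1)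

theorem hasDerivWithinAt_fst {E F : Type*} [NormedAddCommGroup E] [NormedSpace ℝ E]
    [NormedAddCommGroup F] [NormedSpace ℝ F] {y : ℝ → E × F} {y' : E × F} {s : Set ℝ} {t : ℝ}
    (h : HasDerivWithinAt y y' s t) : HasDerivWithinAt (fun t => (y t).1) y'.1 s t :=
  (ContinuousLinearMap.fst ℝ E F).hasFDerivAt.comp_hasDerivWithinAt t h

theorem hasDerivWithinAt_snd {E F : Type*} [NormedAddCommGroup E] [NormedSpace ℝ E]
    [NormedAddCommGroup F] [NormedSpace ℝ F] {y : ℝ → E × F} {y' : E × F} {s : Set ℝ} {t : ℝ}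
    (h : HasDerivWithinAt y y' s t) : HasDerivWithinAt (fun t => (y t).2) y'.2 s t :=
  (ContinuousLinearMap.snd ℝ E F).hasFDerivAt.comp_hasDerivWithinAt t h

/-- A path with vanishing derivative is constant. -/
theorem eq_of_hasDerivWithinAt_zero {E : Type*} [NormedAddCommGroup E] [NormedSpace ℝ E]
    {f : ℝ → E} (h : ∀ t ∈ I01, HasDerivWithinAt f 0 I01 t) : ∀ t ∈ I01, f t = f 0 := by
  intro t ht
  have := eq_zero_of_norm_deriv_le (f := fun t => f t - f 0) (f' := fun _ => 0) (K := 0)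
    (fun t ht => (h t ht).sub_const _) (sub_self _) (fun t _ => by simp) t ht
  exact sub_eq_zero.1 this

/-- Uniqueness for a path `w` with `w' = a w + w b`. -/
theorem eq_zero_of_hasDerivWithinAt_mul {w a b : ℝ → Mat n} (ha : ContinuousOn a I01)
    (hb : ContinuousOn b I01)
    (hw : ∀ t ∈ I01, HasDerivWithinAt w (a t * w t + w t * b t) I01 t) (h0 : w 0 = 0) :
    ∀ t ∈ I01, w t = 0 := by
  obtain ⟨K, -, hK⟩ := exists_norm_le_of_continuousOn ha
  obtain ⟨L, -, hL⟩ := exists_norm_le_of_continuousOn hb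
  refine eq_zero_of_norm_deriv_le (K := K + L) hw h0 fun t ht => ?_
  refine (norm_add_le_of_le (norm_mul_le_of_le (hK t ht) le_rfl)
    (norm_mul_le_of_le le_rfl (hL t ht))).trans ?_
  linarith

/-- Data in the complexified Lie algebra, with arbitrary gauge transformation. -/
noncomputable def nahmSubspace (hG : IsCompactConnectedUnitary G) : Submodule ℝ (NahmSpace n) :=
  (complexLieSpace hG).prod ((Submodule.pi Set.univ fun _ => complexLieSpace hG).prod ⊤)

theorem mem_nahmSubspace {hG : IsCompactConnectedUnitary G} {y : NahmSpace n} :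
    y ∈ nahmSubspace hG ↔ y.1 ∈ lieAlgC G ∧ ∀ i, y.2.1 i ∈ lieAlgC G := by
  simp [nahmSubspace, Submodule.mem_prod, mem_complexLieSpace]

theorem nahmField_mem (hG : IsCompactConnectedUnitary G) {y z : NahmSpace n}
    (hy : y ∈ nahmSubspace hG) (hz : z ∈ nahmSubspace hG) : nahmField y z ∈ nahmSubspace hG := by
  rw [mem_nahmSubspace] at hy hz ⊢
  rw [nahmField_apply]
  refine ⟨(complexLieSpace hG).neg_mem ((complexLieSpace hG).sum_mem fun i _ =>
    mul_sub_mul_mem_lieAlgC hG (hy.2 i) (conjTranspose_mem_lieAlgC hG (hz.2 i))), fun i => ?_⟩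
  exact (complexLieSpace hG).neg_mem ((complexLieSpace hG).smul_mem _
    (mul_sub_mul_mem_lieAlgC hG hy.1 (hz.2 i)))

namespace HermitianNahm

variable {τ : Fin 3 → Mat n} {y : ℝ → NahmSpace n}

theorem deriv_α (hy : HermitianNahm G τ y) {t : ℝ} (ht : t ∈ I01) :
    HasDerivWithinAt (fun t => (y t).1) (-∑ i, ⁅(y t).2.1 i, ((y t).2.1 i)ᴴ⁆) I01 t :=
  hasDerivWithinAt_fst (hy.ode t ht)

theorem deriv_β (hy : HermitianNahm G τ y) (i : Fin 3) {t : ℝ} (ht : t ∈ I01) :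
    HasDerivWithinAt (fun t => (y t).2.1 i) (-((2 : ℝ) • ⁅(y t).1, (y t).2.1 i⁆)) I01 t :=
  hasDerivWithinAt_pi.1 (hasDerivWithinAt_fst (hasDerivWithinAt_snd (hy.ode t ht))) i

theorem deriv_h (hy : HermitianNahm G τ y) {t : ℝ} (ht : t ∈ I01) :
    HasDerivWithinAt (fun t => (y t).2.2.1) ((2 : ℝ) • ((y t).2.2.1 * (y t).1)) I01 t :=
  hasDerivWithinAt_fst (hasDerivWithinAt_snd (hasDerivWithinAt_snd (hy.ode t ht)))

theorem deriv_k (hy : HermitianNahm G τ y) {t : ℝ} (ht : t ∈ I01) :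
    HasDerivWithinAt (fun t => (y t).2.2.2) (-((2 : ℝ) • ((y t).1 * (y t).2.2.2))) I01 t :=
  hasDerivWithinAt_snd (hasDerivWithinAt_snd (hasDerivWithinAt_snd (hy.ode t ht)))

theorem continuousOn (hy : HermitianNahm G τ y) : ContinuousOn y I01 := fun t ht =>
  (hy.ode t ht).continuousWithinAt

theorem β_zero (hy : HermitianNahm G τ y) (i : Fin 3) : (y 0).2.1 i = τ i := by rw [hy.init]

theorem h_zero (hy : HermitianNahm G τ y) : (y 0).2.2.1 = 1 := by rw [hy.init]

theorem k_zero (hy : HermitianNahm G τ y) : (y 0).2.2.2 = 1 := by rw [hy.init]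

theorem h_mul_k (hy : HermitianNahm G τ y) : ∀ t ∈ I01, (y t).2.2.1 * (y t).2.2.2 = 1 := by
  intro t ht
  rw [eq_of_hasDerivWithinAt_zero (f := fun t => (y t).2.2.1 * (y t).2.2.2) (fun t ht => ?_) t ht]
  · simp [hy.h_zero, hy.k_zero]
  · refine ((hy.deriv_h ht).fun_mul (hy.deriv_k ht)).congr_deriv ?_
    simp only [smul_mul_assoc, mul_neg, mul_smul_comm, mul_assoc, add_neg_cancel]

theorem k_mul_h (hy : HermitianNahm G τ y) : ∀ t ∈ I01, (y t).2.2.2 * (y t).2.2.1 = 1 :=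
  fun t ht => mul_eq_one_comm.1 (hy.h_mul_k t ht)

/-- The gauge transformation `h` takes the Higgs fields to their constant initial values. -/
theorem h_mul_β (hy : HermitianNahm G τ y) (i : Fin 3) :
    ∀ t ∈ I01, (y t).2.2.1 * (y t).2.1 i = τ i * (y t).2.2.1 := by
  intro t ht
  have hα : ContinuousOn (fun t => (y t).1) I01 := continuous_fst.comp_continuousOn hy.continuousOn
  have := eq_zero_of_hasDerivWithinAt_mul (w := fun t => (y t).2.2.1 * (y t).2.1 i
    - τ i * (y t).2.2.1) (a := fun _ => 0) (b := fun t => (2 : ℝ) • (y t).1) continuousOn_const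
    ((continuous_const_smul (2 : ℝ)).comp_continuousOn hα) (fun t ht => ?_)
    (by simp [hy.h_zero, hy.β_zero]) t ht
  · exact sub_eq_zero.1 this
  · refine (((hy.deriv_h ht).fun_mul (hy.deriv_β i ht)).fun_sub
      ((hy.deriv_h ht).const_mul (τ i))).congr_deriv ?_
    simp only [Ring.lie_def, smul_mul_assoc, mul_neg, mul_smul_comm, smul_sub, mul_sub, zero_mul,
      sub_mul, mul_assoc]
    abel

theorem k_mul_τ (hy : HermitianNahm G τ y) (i : Fin 3) :
    ∀ t ∈ I01, (y t).2.2.2 * τ i = (y t).2.1 i * (y t).2.2.2 := by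
  intro t ht
  calc _ = (y t).2.2.2 * (τ i * (y t).2.2.1) * (y t).2.2.2 := by
        rw [mul_assoc, mul_assoc, hy.h_mul_k t ht, mul_one]
    _ = _ := by rw [← hy.h_mul_β i t ht, ← mul_assoc, hy.k_mul_h t ht, one_mul]

theorem β_eq (hy : HermitianNahm G τ y) (i : Fin 3) :
    ∀ t ∈ I01, (y t).2.1 i = (y t).2.2.2 * τ i * (y t).2.2.1 := by
  intro t ht
  rw [hy.k_mul_τ i t ht, mul_assoc, hy.k_mul_h t ht, mul_one]

theorem α_herm (hy : HermitianNahm G τ y) : ∀ t ∈ I01, ((y t).1)ᴴ = (y t).1 := by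
  intro t ht
  have := eq_of_hasDerivWithinAt_zero (f := fun t => ((y t).1)ᴴ - (y t).1) (fun t ht => ?_) t ht
  · exact sub_eq_zero.1 (this.trans (sub_eq_zero.2 hy.herm_zero))
  · refine ((hasDerivWithinAt_conjTranspose (hy.deriv_α ht)).fun_sub (hy.deriv_α ht)).congr_deriv ?_
    simp [Ring.lie_def, Matrix.conjTranspose_sum]

theorem mem (hG : IsCompactConnectedUnitary G) (hτ : ∀ i, τ i ∈ lieAlgC G)
    (hy : HermitianNahm G τ y) : ∀ t ∈ I01, y t ∈ nahmSubspace hG :=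
  mem_of_quadratic_ode (mem_nahmSubspace.2 ⟨hy.mem_zero, fun i => by rw [hy.β_zero]; exact hτ i⟩)
    hy.ode fun _ hw => nahmField_mem hG hw hw

/-- The gauge transformation of a solution in Hermitian gauge as a path of invertible matrices. -/
theorem exists_tangentPath (hG : IsCompactConnectedUnitary G) (hτ : ∀ i, τ i ∈ lieAlgC G)
    (hy : HermitianNahm G τ y) : ∃ u : ℝ → GL (Fin n) ℂ, TangentPath G u ∧ u 0 = 1 ∧
      ∀ t ∈ I01, (u t : Mat n) = (y t).2.2.1 ∧
        (((u t)⁻¹ : GL (Fin n) ℂ) : Mat n) = (y t).2.2.2 := by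
  classical
  let u : ℝ → GL (Fin n) ℂ := fun t => if ht : t ∈ I01 then
    ⟨(y t).2.2.1, (y t).2.2.2, hy.h_mul_k t ht, hy.k_mul_h t ht⟩ else 1
  have hu : ∀ t ∈ I01, (u t : Mat n) = (y t).2.2.1 ∧
      (((u t)⁻¹ : GL (Fin n) ℂ) : Mat n) = (y t).2.2.2 := by
    intro t ht
    have : u t = ⟨(y t).2.2.1, (y t).2.2.2, hy.h_mul_k t ht, hy.k_mul_h t ht⟩ := dif_pos ht
    rw [this]; exact ⟨rfl, rfl⟩
  have h0 : u 0 = 1 := Units.ext ((hu 0 (by simp)).1.trans hy.h_zero)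
  refine ⟨u, TangentPath.of_deriv hG (A := fun t => (2 : ℝ) • (y t).1)
    (by rw [h0]; exact one_mem _) ?_ (fun t ht => ?_) (fun t ht => ?_), h0, hu⟩
  · exact (continuous_const_smul (2 : ℝ)).comp_continuousOn
      (continuous_fst.comp_continuousOn hy.continuousOn)
  · exact (complexLieSpace hG).smul_mem _ (mem_nahmSubspace.1 (hy.mem hG hτ t ht)).1
  · rw [(hu t ht).1, mul_smul_comm]
    exact (hy.deriv_h ht).congr (fun t ht => (hu t ht).1) (hu t ht).1

end HermitianNahm

end HermitianGauge

/-! ### A priori bounds -/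

section Bounds

attribute [local instance] matNormedRing matNormedAlgebra

open scoped Matrix

variable {n : ℕ} {G : Subgroup (GL (Fin n) ℂ)}

theorem reTr_mul_mul_le (u R : Mat n) : |reTr (uᴴ * u * R)| ≤ ‖R‖ * ‖u‖ ^ 2 := by
  rw [mul_assoc]
  refine (reTr_mul_le _ _).trans ((mul_le_mul_of_nonneg_left (norm_mul_le u R)
    (norm_nonneg _)).trans (le_of_eq ?_))
  ring

theorem reTr_mul_mul_le' (u R : Mat n) : |reTr (u * uᴴ * R)| ≤ ‖R‖ * ‖u‖ ^ 2 := by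
  rw [mul_assoc, reTr_mul_comm, mul_assoc]
  refine (reTr_mul_le u (R * u)).trans ((mul_le_mul_of_nonneg_left (norm_mul_le R u)
    (norm_nonneg _)).trans (le_of_eq ?_))
  ring

/-- The sum of the commutators of the `τᵢ` with their adjoints. It measures the failure of the
constant Higgs fields `τ` with the zero connection to solve the real equation. -/
noncomputable def momentMap (τ : Fin 3 → Mat n) : Mat n := ∑ i, ⁅τ i, (τ i)ᴴ⁆

theorem norm_momentMap_le {τ : Fin 3 → Mat n} {M : ℝ} (hM : ∀ i, ‖τ i‖ ≤ M) :
    ‖momentMap τ‖ ≤ 6 * M ^ 2 := by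
  have h0 : 0 ≤ M := (norm_nonneg _).trans (hM 0)
  have h1 : ∀ i, ‖⁅τ i, (τ i)ᴴ⁆‖ ≤ 2 * M ^ 2 := fun i => by
    have h2 : ‖(τ i)ᴴ‖ ≤ M := by rw [norm_conjTranspose]; exact hM i
    rw [Ring.lie_def]
    refine (norm_sub_le_of_le (norm_mul_le_of_le (hM i) h2) (norm_mul_le_of_le h2 (hM i))).trans ?_
    exact le_of_eq (by ring)
  refine (norm_sum_le_of_le Finset.univ fun i _ => h1 i).trans (le_of_eq ?_)
  rw [Finset.sum_const, Finset.card_univ, Fintype.card_fin, nsmul_eq_mul]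
  push_cast; ring

namespace HermitianNahm

variable {τ : Fin 3 → Mat n} {y : ℝ → NahmSpace n}

/-- Derivatives of `‖h‖²`: comparison with the trivial connection and constant Higgs fields `τ`. -/
theorem deriv_normSq_h (hy : HermitianNahm G τ y) :
    ∃ f'' : ℝ → ℝ, ∀ t ∈ I01,
      HasDerivWithinAt (fun t => ‖(y t).2.2.1‖ ^ 2)
        (4 * reTr (((y t).2.2.1)ᴴ * ((y t).2.2.1 * (y t).1))) I01 t ∧
      HasDerivWithinAt (fun t => 4 * reTr (((y t).2.2.1)ᴴ * ((y t).2.2.1 * (y t).1)))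
        (f'' t) I01 t ∧
      16 * ‖(y t).2.2.1 * (y t).1‖ ^ 2 - 4 * ‖momentMap τ‖ * ‖(y t).2.2.1‖ ^ 2 ≤ f'' t := by
  have key := fun t ht => hasDerivWithinAt_normSq (u := fun t => (y t).2.2.1)
    (b := fun t => (y t).1) (a := fun _ => 0) (Ry := fun _ => 0)
    (Rx := fun _ => (2 : ℝ) • momentMap τ)
    (c := fun i t => (y t).2.1 i) (d := fun i _ => τ i)
    (fun t ht => (hy.deriv_h ht).congr_deriv (by simp))
    (fun t ht => ((hy.deriv_α ht).fun_add
      (hasDerivWithinAt_conjTranspose (hy.deriv_α ht))).congr_deriv (by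
        rw [hy.α_herm t ht, Ring.lie_def (y t).1, sub_self, zero_add, two_smul, zero_sub, neg_add]
        congr 1
        simp [Ring.lie_def, Matrix.conjTranspose_sum]))
    (fun t ht => by
      simp only [Matrix.conjTranspose_zero, add_zero]
      exact (hasDerivWithinAt_const _ _ _).congr_deriv (by simp [momentMap, Ring.lie_def]))
    (fun i t ht => hy.h_mul_β i t ht) (t := t) ht
  have e : ∀ t ∈ I01, 2 * reTr (((y t).2.2.1)ᴴ * (y t).2.2.1 * ((y t).1 + ((y t).1)ᴴ))
      - 2 * reTr ((y t).2.2.1 * ((y t).2.2.1)ᴴ * (0 + (0 : Mat n)ᴴ))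
      = 4 * reTr (((y t).2.2.1)ᴴ * ((y t).2.2.1 * (y t).1)) := fun t ht => by
    rw [hy.α_herm t ht, ← two_smul ℝ (y t).1, mul_smul_comm, map_smul, smul_eq_mul,
      Matrix.conjTranspose_zero, add_zero, mul_zero, map_zero, mul_assoc]
    ring
  refine ⟨_, fun t ht => ⟨(key t ht).1.congr_deriv (e t ht),
    (key t ht).2.congr (fun t ht => (e t ht).symm) (e t ht).symm, ?_⟩⟩
  have h1 := (abs_le.1 (reTr_mul_mul_le' (y t).2.2.1 ((2 : ℝ) • momentMap τ))).2
  have h2 : ‖(y t).2.2.1 * ((y t).1 + ((y t).1)ᴴ) - (0 + (0 : Mat n)ᴴ) * (y t).2.2.1‖ ^ 2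
      = 4 * ‖(y t).2.2.1 * (y t).1‖ ^ 2 := by
    rw [hy.α_herm t ht, ← two_smul ℝ (y t).1, mul_smul_comm, Matrix.conjTranspose_zero, add_zero,
      zero_mul, sub_zero, norm_smul, mul_pow]
    norm_num
  have h3 : 0 ≤ ∑ i, ‖(y t).2.2.1 * ((y t).2.1 i)ᴴ - (τ i)ᴴ * (y t).2.2.1‖ ^ 2 :=
    Finset.sum_nonneg fun i _ => sq_nonneg _
  rw [norm_smul, Real.norm_two] at h1
  rw [h2, mul_zero, map_zero]
  linarith

/-- Derivatives of `‖h⁻¹‖²`. -/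
theorem deriv_normSq_k (hy : HermitianNahm G τ y) :
    ∃ f'' : ℝ → ℝ, ∀ t ∈ I01,
      HasDerivWithinAt (fun t => ‖(y t).2.2.2‖ ^ 2)
        (-4 * reTr (((y t).2.2.2)ᴴ * ((y t).1 * (y t).2.2.2))) I01 t ∧
      HasDerivWithinAt (fun t => -4 * reTr (((y t).2.2.2)ᴴ * ((y t).1 * (y t).2.2.2)))
        (f'' t) I01 t ∧
      16 * ‖(y t).1 * (y t).2.2.2‖ ^ 2 - 4 * ‖momentMap τ‖ * ‖(y t).2.2.2‖ ^ 2 ≤ f'' t := by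
  have key := fun t ht => hasDerivWithinAt_normSq (u := fun t => (y t).2.2.2)
    (a := fun t => (y t).1) (b := fun _ => 0) (Rx := fun _ => 0)
    (Ry := fun _ => (2 : ℝ) • momentMap τ)
    (d := fun i t => (y t).2.1 i) (c := fun i _ => τ i)
    (fun t ht => (hy.deriv_k ht).congr_deriv (by simp))
    (fun t ht => by
      simp only [Matrix.conjTranspose_zero, add_zero]
      exact (hasDerivWithinAt_const _ _ _).congr_deriv (by simp [momentMap, Ring.lie_def]))
    (fun t ht => ((hy.deriv_α ht).fun_add
      (hasDerivWithinAt_conjTranspose (hy.deriv_α ht))).congr_deriv (by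
        rw [hy.α_herm t ht, Ring.lie_def (y t).1, sub_self, zero_add, two_smul, zero_sub, neg_add]
        congr 1
        simp [Ring.lie_def, Matrix.conjTranspose_sum]))
    (fun i t ht => hy.k_mul_τ i t ht) (t := t) ht
  have e : ∀ t ∈ I01, 2 * reTr (((y t).2.2.2)ᴴ * (y t).2.2.2 * (0 + (0 : Mat n)ᴴ))
      - 2 * reTr ((y t).2.2.2 * ((y t).2.2.2)ᴴ * ((y t).1 + ((y t).1)ᴴ))
      = -4 * reTr (((y t).2.2.2)ᴴ * ((y t).1 * (y t).2.2.2)) := fun t ht => by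
    rw [hy.α_herm t ht, ← two_smul ℝ (y t).1, mul_smul_comm, map_smul, smul_eq_mul,
      Matrix.conjTranspose_zero, add_zero, mul_zero, map_zero, mul_assoc, reTr_mul_comm, mul_assoc]
    ring
  refine ⟨_, fun t ht => ⟨(key t ht).1.congr_deriv (e t ht),
    (key t ht).2.congr (fun t ht => (e t ht).symm) (e t ht).symm, ?_⟩⟩
  have h1 := (abs_le.1 (reTr_mul_mul_le (y t).2.2.2 ((2 : ℝ) • momentMap τ))).1
  have h2 : ‖(y t).2.2.2 * (0 + (0 : Mat n)ᴴ) - ((y t).1 + ((y t).1)ᴴ) * (y t).2.2.2‖ ^ 2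
      = 4 * ‖(y t).1 * (y t).2.2.2‖ ^ 2 := by
    rw [hy.α_herm t ht, ← two_smul ℝ (y t).1, smul_mul_assoc, Matrix.conjTranspose_zero, add_zero,
      mul_zero, zero_sub, norm_neg, norm_smul, mul_pow]
    norm_num
  have h3 : 0 ≤ ∑ i, ‖(y t).2.2.2 * (τ i)ᴴ - ((y t).2.1 i)ᴴ * (y t).2.2.2‖ ^ 2 :=
    Finset.sum_nonneg fun i _ => sq_nonneg _
  rw [norm_smul, Real.norm_two] at h1
  rw [h2, mul_zero, map_zero]
  linarith

/-- A bound for `h` on the whole interval in terms of `τ` and `h(1)`: the second derivative of `log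
(1 + ‖h‖²)` is bounded below. -/
theorem norm_h_sq_le (hy : HermitianNahm G τ y) {M : ℝ} (h0 : ‖(1 : Mat n)‖ ^ 2 ≤ M)
    (h1 : ‖(y 1).2.2.1‖ ^ 2 ≤ M) {t : ℝ} (ht : t ∈ I01) :
    ‖(y t).2.2.1‖ ^ 2 ≤ (1 + M) * Real.exp (4 * ‖momentMap τ‖ / 2) := by
  obtain ⟨f'', hf⟩ := hy.deriv_normSq_h
  refine le_of_log_second_deriv (f := fun t => ‖(y t).2.2.1‖ ^ 2)
    (N := fun t => 4 * ‖(y t).2.2.1 * (y t).1‖ ^ 2) (fun t ht => (hf t ht).1)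
    (fun t ht => (hf t ht).2.1) (fun t _ => by positivity) (fun t _ => by positivity)
    (fun t ht => ?_) (by positivity) (fun t ht => ?_) (by rw [hy.h_zero]; exact h0) h1 ht
  · have := reTr_mul_sq_le (y t).2.2.1 ((y t).2.2.1 * (y t).1)
    rw [mul_pow]; linarith
  · have := (hf t ht).2.2
    linarith

theorem norm_k_sq_le (hy : HermitianNahm G τ y) {M : ℝ} (h0 : ‖(1 : Mat n)‖ ^ 2 ≤ M)
    (h1 : ‖(y 1).2.2.2‖ ^ 2 ≤ M) {t : ℝ} (ht : t ∈ I01) :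
    ‖(y t).2.2.2‖ ^ 2 ≤ (1 + M) * Real.exp (4 * ‖momentMap τ‖ / 2) := by
  obtain ⟨f'', hf⟩ := hy.deriv_normSq_k
  refine le_of_log_second_deriv (f := fun t => ‖(y t).2.2.2‖ ^ 2)
    (N := fun t => 4 * ‖(y t).1 * (y t).2.2.2‖ ^ 2) (fun t ht => (hf t ht).1)
    (fun t ht => (hf t ht).2.1) (fun t _ => by positivity) (fun t _ => by positivity)
    (fun t ht => ?_) (by positivity) (fun t ht => ?_) (by rw [hy.k_zero]; exact h0) h1 ht
  · have := reTr_mul_sq_le (y t).2.2.2 ((y t).1 * (y t).2.2.2)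
    rw [mul_pow]; linarith
  · have := (hf t ht).2.2
    linarith

/-- Solutions in Hermitian gauge are bounded in terms of their gauge transformations at the end
point. If `α` were large then `‖h‖²` would be too convex to stay nonnegative. -/
theorem exists_bound (M : ℝ) : ∃ R, ∀ (τ : Fin 3 → Mat n) (y : ℝ → NahmSpace n),
    HermitianNahm G τ y → (∀ i, ‖τ i‖ ≤ M) → ‖(1 : Mat n)‖ ^ 2 ≤ M → ‖(y 1).2.2.1‖ ^ 2 ≤ M →
      ‖(y 1).2.2.2‖ ^ 2 ≤ M → ∀ t ∈ I01, ‖y t‖ ≤ R := by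
  -- `K` bounds `‖h‖²` and `‖h⁻¹‖²`; `c` bounds `α'`; `q` bounds `(‖α(0)‖ - c)²`
  set C : ℝ := 4 * (6 * M ^ 2) with hC
  set K : ℝ := (1 + M) * Real.exp (C / 2) with hK
  set c : ℝ := 6 * (K * M) ^ 2 with hc
  set q : ℝ := K * (8 * K + C * K) / 16 with hq
  refine ⟨max (c + 1 + q + c) (max (K * M) (1 + K)), fun τ y hy hτ hM0 h1 k1 => ?_⟩
  have hM : 0 ≤ M := (sq_nonneg _).trans hM0
  have hK0 : 0 ≤ K := by positivity
  have hC1 : 4 * ‖momentMap τ‖ ≤ C := by have := norm_momentMap_le hτ; linarith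
  have hexp : (1 + M) * Real.exp (4 * ‖momentMap τ‖ / 2) ≤ K := by
    rw [hK]; gcongr
  have hh : ∀ t ∈ I01, ‖(y t).2.2.1‖ ^ 2 ≤ K := fun t ht => (hy.norm_h_sq_le hM0 h1 ht).trans hexp
  have hk : ∀ t ∈ I01, ‖(y t).2.2.2‖ ^ 2 ≤ K := fun t ht => (hy.norm_k_sq_le hM0 k1 ht).trans hexp
  have hβ : ∀ t ∈ I01, ∀ i, ‖(y t).2.1 i‖ ≤ K * M := fun t ht i => by
    rw [hy.β_eq i t ht]
    refine (norm_mul_le_of_le (norm_mul_le_of_le le_rfl (hτ i)) le_rfl).trans ?_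
    have h2 : ‖(y t).2.2.2‖ * ‖(y t).2.2.1‖ ≤ K := by
      nlinarith [hh t ht, hk t ht, sq_nonneg (‖(y t).2.2.2‖ - ‖(y t).2.2.1‖)]
    calc _ = ‖(y t).2.2.2‖ * ‖(y t).2.2.1‖ * M := by ring
      _ ≤ K * M := by gcongr
  have hα : ∀ t ∈ I01, ‖(y t).1 - (y 0).1‖ ≤ c := fun t ht => by
    have := (convex_Icc (0 : ℝ) 1).norm_image_sub_le_of_norm_hasDerivWithin_le
      (fun t ht => hy.deriv_α ht) (C := c) (fun t ht => by
        rw [norm_neg]; exact norm_momentMap_le (hβ t ht)) (by simp : (0 : ℝ) ∈ I01) ht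
    refine this.trans (mul_le_of_le_one_right (by positivity) ?_)
    rw [sub_zero, Real.norm_eq_abs, abs_of_nonneg ht.1]; exact ht.2
  -- `α` differs by at most `c` from `α(0)`, so that `‖hα‖` is large throughout if `α(0)` is
  have hα0 : ‖(y 0).1‖ ≤ c + 1 + q := by
    have hq0 : 0 ≤ q := by positivity
    rcases le_or_gt ‖(y 0).1‖ c with h | h
    · linarith
    obtain ⟨f'', hf⟩ := hy.deriv_normSq_h
    set x := ‖(y 0).1‖ - c with hx
    have hx0 : 0 < x := sub_pos.2 h
    have hlow : ∀ t ∈ I01, x ^ 2 ≤ K * ‖(y t).2.2.1 * (y t).1‖ ^ 2 := fun t ht => by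
      have h2 : x ≤ ‖(y t).1‖ := by
        have h3 := norm_sub_norm_le (y 0).1 (y t).1
        rw [norm_sub_rev] at h3
        have := hα t ht
        linarith
      have h3 : ‖(y t).1‖ ≤ ‖(y t).2.2.2‖ * ‖(y t).2.2.1 * (y t).1‖ := by
        refine le_trans (le_of_eq ?_) (norm_mul_le _ _)
        rw [← mul_assoc, hy.k_mul_h t ht, one_mul]
      calc x ^ 2 ≤ (‖(y t).2.2.2‖ * ‖(y t).2.2.1 * (y t).1‖) ^ 2 :=
            pow_le_pow_left₀ hx0.le (h2.trans h3) 2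
        _ ≤ _ := by rw [mul_pow]; gcongr; exact hk t ht
    have hKpos : 0 < K := by
      rcases hK0.eq_or_lt with h4 | h4
      · have := hlow 0 (by simp)
        rw [← h4, zero_mul] at this
        nlinarith
      · exact h4
    have h5 := second_deriv_le_of_midpoint (f := fun t => ‖(y t).2.2.1‖ ^ 2)
      (L := 16 * (x ^ 2 / K) - C * K) (M := K) (fun t ht => (hf t ht).1)
      (fun t ht => (hf t ht).2.1) (fun t ht => by
        refine le_trans ?_ (hf t ht).2.2
        have h6 : x ^ 2 / K ≤ ‖(y t).2.2.1 * (y t).1‖ ^ 2 := by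
          rw [div_le_iff₀ hKpos, mul_comm]; exact hlow t ht
        have h7 : 4 * ‖momentMap τ‖ * ‖(y t).2.2.1‖ ^ 2 ≤ C * K :=
          mul_le_mul hC1 (hh t ht) (by positivity) (by positivity)
        linarith) (hh 0 (by simp)) (hh 1 (by simp)) (by positivity)
    have h8 : x ^ 2 ≤ q := by
      have h9 : x ^ 2 / K ≤ (8 * K + C * K) / 16 := by linarith
      rw [div_le_iff₀ hKpos] at h9
      rw [hq]; linarith
    nlinarith [sq_nonneg (x - 1)]
  intro t ht
  have hsq : ∀ z : ℝ, z ^ 2 ≤ K → z ≤ 1 + K := fun z hz => by nlinarith [sq_nonneg (z - 1)]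
  refine max_le_max ?_ (max_le_max ?_ (max_le (hsq _ (hh t ht)) (hsq _ (hk t ht))))
  · have := norm_le_norm_add_norm_sub' (y t).1 (y 0).1
    have := hα t ht
    linarith
  · exact (pi_norm_le_iff_of_nonneg (by positivity)).2 (hβ t ht)

end HermitianNahm

end Bounds

/-! ### Deforming the end point of a solution -/

section Retraction

set_option linter.unusedSectionVars false

variable {𝔸 : Type*} [NormedRing 𝔸] [NormedAlgebra ℝ 𝔸] [FiniteDimensional ℝ 𝔸] [CompleteSpace 𝔸]

/-- Near `0` in a subspace, a linear retraction detects whether `exp ζ = 1`. -/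
theorem exists_eq_zero_of_retract_exp (W : Submodule ℝ 𝔸) {π : 𝔸 →L[ℝ] W}
    (hπ : ∀ w : W, π w = w) :
    ∃ ε > 0, ∀ ζ ∈ W, ‖ζ‖ < ε → π (NormedSpace.exp ζ - 1) = 0 → ζ = 0 := by
  have h1 : HasStrictFDerivAt (fun w : W => π (NormedSpace.exp (w : 𝔸) - 1))
      ((ContinuousLinearEquiv.refl ℝ W : W ≃L[ℝ] W) : W →L[ℝ] W) 0 := by
    have h2 : HasStrictFDerivAt (NormedSpace.exp : 𝔸 → 𝔸) (1 : 𝔸 →L[ℝ] 𝔸)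
        (W.subtypeL 0) := by
      rw [map_zero]; exact hasStrictFDerivAt_exp_zero (𝕂 := ℝ)
    refine (π.hasStrictFDerivAt.comp (0 : W)
      ((h2.comp (0 : W) W.subtypeL.hasStrictFDerivAt).sub_const 1)).congr_fderiv ?_
    ext w
    simp [hπ]
  have h0 : π (NormedSpace.exp ((0 : W) : 𝔸) - 1) = 0 := by simp
  have h3 := h1.eventually_left_inverse
  have h4 := h1.localInverse_apply_image
  rw [h0] at h4
  obtain ⟨ε, hε, h5⟩ := Metric.eventually_nhds_iff.1 h3
  refine ⟨ε, hε, fun ζ hζ hζε hz => ?_⟩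
  have h6 := h5 (y := ⟨ζ, hζ⟩) (by simpa [dist_eq_norm] using hζε)
  simp only [hz] at h6
  rw [h4] at h6
  exact (congrArg Subtype.val h6).symm

/-- The derivative at `0` of `exp (L p) k H(p) exp (R p)` when `k = H(0)⁻¹`. -/
theorem hasStrictFDerivAt_exp_mul_mul_exp {P : Type*} [NormedAddCommGroup P] [NormedSpace ℝ P]
    {L R : P →L[ℝ] 𝔸} {H : P → 𝔸} {H' : P →L[ℝ] 𝔸} {k : 𝔸} (hH : HasStrictFDerivAt H H' 0)
    (hk : k * H 0 = 1) :
    HasStrictFDerivAt (fun p => NormedSpace.exp (L p) * (k * H p) * NormedSpace.exp (R p))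
      (L + (ContinuousLinearMap.mul ℝ 𝔸 k).comp H' + R) 0 := by
  have he : ∀ L : P →L[ℝ] 𝔸, HasStrictFDerivAt (fun p => NormedSpace.exp (L p)) L 0 := by
    intro L
    have h2 : HasStrictFDerivAt (NormedSpace.exp : 𝔸 → 𝔸) (1 : 𝔸 →L[ℝ] 𝔸) (L 0) := by
      rw [map_zero]; exact hasStrictFDerivAt_exp_zero (𝕂 := ℝ)
    exact h2.comp (0 : P) L.hasStrictFDerivAt
  have h1 : HasStrictFDerivAt (fun p => k * H p) ((ContinuousLinearMap.mul ℝ 𝔸 k).comp H') 0 :=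
    (ContinuousLinearMap.mul ℝ 𝔸 k).hasStrictFDerivAt.comp (0 : P) hH
  refine (((he L).mul' h1).mul' (he R)).congr_fderiv ?_
  ext p
  simp [hk, NormedSpace.exp_zero]
  abel

end Retraction

section Openness

attribute [local instance] matNormedRing matNormedAlgebra

open scoped Matrix

variable {n : ℕ} {G : Subgroup (GL (Fin n) ℂ)}

namespace HermitianNahm

variable {τ : Fin 3 → Mat n} {y v : ℝ → NahmSpace n}

/-- The infinitesimal gauge transformation `η = h⁻¹δh` of a deformation. -/
theorem deriv_infinitesimal_gauge (hy : HermitianNahm G τ y)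
    (hv : ∀ t ∈ I01, HasDerivWithinAt v (nahmField (y t) (v t) + nahmField (v t) (y t)) I01 t)
    {t : ℝ} (ht : t ∈ I01) :
    HasDerivWithinAt (fun t => (y t).2.2.2 * (v t).2.2.1)
      ((2 : ℝ) • ((v t).1 - ⁅(y t).1, (y t).2.2.2 * (v t).2.2.1⁆)) I01 t := by
  have h1 : HasDerivWithinAt (fun t => (v t).2.2.1)
      ((2 : ℝ) • ((y t).2.2.1 * (v t).1) + (2 : ℝ) • ((v t).2.2.1 * (y t).1)) I01 t :=
    hasDerivWithinAt_fst (hasDerivWithinAt_snd (hasDerivWithinAt_snd (hv t ht)))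
  refine ((hy.deriv_k ht).fun_mul h1).congr_deriv ?_
  simp only [mul_add, mul_smul_comm, ← mul_assoc, hy.k_mul_h t ht, one_mul, Ring.lie_def, neg_mul,
    smul_mul_assoc, smul_sub]
  abel

/-- Deformations inherit the values in the complexified Lie algebra from their initial values. -/
theorem deformation_mem (hG : IsCompactConnectedUnitary G) (hτ : ∀ i, τ i ∈ lieAlgC G)
    (hy : HermitianNahm G τ y)
    (hv : ∀ t ∈ I01, HasDerivWithinAt v (nahmField (y t) (v t) + nahmField (v t) (y t)) I01 t)
    (h0 : v 0 ∈ nahmSubspace hG) : ∀ t ∈ I01, v t ∈ nahmSubspace hG := by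
  have hc := hy.continuousOn
  refine mem_of_linear_ode (A := fun t => nahmField (y t) + nahmField.flip (y t)) (b := fun _ => 0)
    (by fun_prop) h0 (fun t ht => (hv t ht).congr_deriv (by simp)) fun t ht w hw => ?_
  have := hy.mem hG hτ t ht
  simpa using (nahmSubspace hG).add_mem (nahmField_mem hG this hw) (nahmField_mem hG hw this)

/-- The infinitesimal gauge transformation takes values in the complexified Lie algebra, which is
preserved by the linear equation it solves. -/
theorem infinitesimal_gauge_mem (hG : IsCompactConnectedUnitary G) (hτ : ∀ i, τ i ∈ lieAlgC G)
    (hy : HermitianNahm G τ y)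
    (hv : ∀ t ∈ I01, HasDerivWithinAt v (nahmField (y t) (v t) + nahmField (v t) (y t)) I01 t)
    (h0 : v 0 ∈ nahmSubspace hG) (hh : (v 0).2.2.1 = 0) :
    ∀ t ∈ I01, (y t).2.2.2 * (v t).2.2.1 ∈ lieAlgC G := by
  have hc : ContinuousOn (fun t => (y t).1) I01 := continuous_fst.comp_continuousOn hy.continuousOn
  refine mem_of_linear_ode (W := complexLieSpace hG)
    (A := fun t => -((2 : ℝ) • (ContinuousLinearMap.mul ℝ (Mat n) (y t).1
      - (ContinuousLinearMap.mul ℝ (Mat n)).flip (y t).1)))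
    (b := fun t => (2 : ℝ) • (v t).1) (by fun_prop)
    (by rw [hh, mul_zero]; exact zero_mem _)
    (fun t ht => (hy.deriv_infinitesimal_gauge hv ht).congr_deriv ?_) fun t ht w hw => ?_
  · simp only [neg_apply, smul_apply, sub_apply,
      ContinuousLinearMap.mul_apply', ContinuousLinearMap.flip_apply,
      Ring.lie_def, smul_sub]
    abel
  · have h1 := (mem_nahmSubspace.1 (hy.mem hG hτ t ht)).1
    have h2 := (mem_nahmSubspace.1 (hy.deformation_mem hG hτ hv h0 t ht)).1
    exact (complexLieSpace hG).add_mem ((complexLieSpace hG).neg_mem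
      ((complexLieSpace hG).smul_mem _ (mul_sub_mul_mem_lieAlgC hG h1 hw)))
      ((complexLieSpace hG).smul_mem _ h2)

/-- A deformation by Hermitian `α(0)` with fixed `β(0)` which moves the end point only in unitary
directions is trivial. -/
theorem deformation_eq_zero (hy : HermitianNahm G τ y)
    (hv : ∀ t ∈ I01, HasDerivWithinAt v (nahmField (y t) (v t) + nahmField (v t) (y t)) I01 t)
    (hα : ((v 0).1)ᴴ = (v 0).1) (hβ : ∀ i, (v 0).2.1 i = 0) (hh : (v 0).2.2.1 = 0)
    (h1 : (y 1).2.2.2 * (v 1).2.2.1 + ((y 1).2.2.2 * (v 1).2.2.1)ᴴ = 0) :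
    (v 0).1 = 0 ∧ (y 1).2.2.2 * (v 1).2.2.1 = 0 := by
  have hc : ContinuousOn (fun t => (y t).1) I01 := continuous_fst.comp_continuousOn hy.continuousOn
  have ha : ∀ t ∈ I01, HasDerivWithinAt (fun t => (v t).1)
      (-∑ i, (⁅(v t).2.1 i, ((y t).2.1 i)ᴴ⁆ + ⁅(y t).2.1 i, ((v t).2.1 i)ᴴ⁆)) I01 t :=
    fun t ht => (hasDerivWithinAt_fst (hv t ht)).congr_deriv (by
      rw [Finset.sum_add_distrib, neg_add, add_comm]; rfl)
  have hb : ∀ i, ∀ t ∈ I01, HasDerivWithinAt (fun t => (v t).2.1 i)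
      (-((2 : ℝ) • ⁅(y t).1, (v t).2.1 i⁆) + -((2 : ℝ) • ⁅(v t).1, (y t).2.1 i⁆)) I01 t :=
    fun i t ht => hasDerivWithinAt_pi.1 (hasDerivWithinAt_fst (hasDerivWithinAt_snd (hv t ht))) i
  have hη := fun t ht => hy.deriv_infinitesimal_gauge hv (t := t) ht
  -- since `hβh⁻¹` is constant and `β(0)` is fixed, `β` varies by the commutator with `η`
  have hbη : ∀ i, ∀ t ∈ I01, (v t).2.1 i = ⁅(y t).2.1 i, (y t).2.2.2 * (v t).2.2.1⁆ := by
    intro i t ht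
    have := eq_zero_of_hasDerivWithinAt_mul
      (w := fun t => (v t).2.1 i - ⁅(y t).2.1 i, (y t).2.2.2 * (v t).2.2.1⁆)
      (a := fun t => -((2 : ℝ) • (y t).1)) (b := fun t => (2 : ℝ) • (y t).1)
      ((continuous_const_smul (2 : ℝ)).comp_continuousOn hc).neg
      ((continuous_const_smul (2 : ℝ)).comp_continuousOn hc) (fun t ht => ?_)
      (by simp [hβ, hh, Ring.lie_def]) t ht
    · exact sub_eq_zero.1 this
    · simp only [Ring.lie_def]
      refine ((hb i t ht).fun_sub (((hy.deriv_β i ht).fun_mul (hη t ht)).fun_sub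
        ((hη t ht).fun_mul (hy.deriv_β i ht)))).congr_deriv ?_
      simp only [Ring.lie_def]
      generalize (y t).2.2.2 * (v t).2.2.1 = η
      simp only [smul_sub, mul_sub, sub_mul, neg_mul, mul_neg, smul_mul_assoc, mul_smul_comm,
        mul_assoc]
      abel
  have hah : ∀ t ∈ I01, ((v t).1)ᴴ = (v t).1 := by
    intro t ht
    have := eq_of_hasDerivWithinAt_zero (f := fun t => ((v t).1)ᴴ - (v t).1) (fun t ht => ?_) t ht
    · exact sub_eq_zero.1 (this.trans (sub_eq_zero.2 hα))
    · refine ((hasDerivWithinAt_conjTranspose (ha t ht)).fun_sub (ha t ht)).congr_deriv ?_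
      simp [Ring.lie_def, Matrix.conjTranspose_sum, add_comm]
  have := linearised_eq_zero (fun t ht => hy.deriv_α ht) ha hbη hη hy.α_herm hah
    (by simp [hh]) h1
  exact ⟨(this 0 (by simp)).1, (this 1 (by simp)).2⟩

end HermitianNahm

/-- The Hermitian part of a matrix. -/
noncomputable def hermPart : Mat n →L[ℝ] Mat n := (1 / 2 : ℝ) • (ContinuousLinearMap.id ℝ _ + ctL)

/-- The skew-Hermitian part of a matrix. -/
noncomputable def skewPart : Mat n →L[ℝ] Mat n := (1 / 2 : ℝ) • (ContinuousLinearMap.id ℝ _ - ctL)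

theorem hermPart_apply (A : Mat n) : hermPart A = (1 / 2 : ℝ) • (A + Aᴴ) := rfl

theorem skewPart_apply (A : Mat n) : skewPart A = (1 / 2 : ℝ) • (A - Aᴴ) := rfl

theorem hermPart_add_skewPart (A : Mat n) : hermPart A + skewPart A = A := by
  rw [hermPart_apply, skewPart_apply, ← smul_add, add_add_sub_cancel, ← two_smul ℝ A, smul_smul]
  norm_num

theorem conjTranspose_hermPart (A : Mat n) : (hermPart A)ᴴ = hermPart A := by
  simp [hermPart_apply, Matrix.conjTranspose_smul, add_comm]

theorem conjTranspose_skewPart (A : Mat n) : (skewPart A)ᴴ = -skewPart A := by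
  rw [skewPart_apply, Matrix.conjTranspose_smul, star_trivial, Matrix.conjTranspose_sub,
    Matrix.conjTranspose_conjTranspose, ← smul_neg, neg_sub]

theorem hermPart_mem (hG : IsCompactConnectedUnitary G) {A : Mat n} (hA : A ∈ lieAlgC G) :
    hermPart A ∈ lieAlgC G :=
  (complexLieSpace hG).smul_mem _
    ((complexLieSpace hG).add_mem hA (conjTranspose_mem_lieAlgC hG hA))

theorem skewPart_mem (hG : IsCompactConnectedUnitary G) {A : Mat n} (hA : A ∈ lieAlgC G) :
    skewPart A ∈ lieAlgC G :=
  (complexLieSpace hG).smul_mem _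
    ((complexLieSpace hG).sub_mem hA (conjTranspose_mem_lieAlgC hG hA))

theorem expGL_skewPart_mem (hG : IsCompactConnectedUnitary G) {A : Mat n} (hA : A ∈ lieAlgC G) :
    expGL (skewPart A) ∈ G := by
  simpa using mem_lieAlg_iff.1
    (mem_lieAlg_of_skew hG (skewPart_mem hG hA) (conjTranspose_skewPart A)) 1

end Openness

section Openness

attribute [local instance] matNormedRing matNormedAlgebra

open scoped Matrix

variable {n : ℕ} {G : Subgroup (GL (Fin n) ℂ)}

namespace HermitianNahm

variable {τ : Fin 3 → Mat n} {y : ℝ → NahmSpace n}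

/-- If a deformed solution `z` has its gauge transformation near to that of `y`, then a linear
retraction `π` onto the complexified Lie algebra detects whether the end points agree up to the
factors `exp X` and `exp κ`. The discrepancy is the end of a short path in the complexified group,
hence an exponential of a short vector of the Lie algebra; that the group might not be closed does
not matter. -/
theorem end_eq_of_retract_eq_zero (hG : IsCompactConnectedUnitary G) (hτ : ∀ i, τ i ∈ lieAlgC G)
    (hy : HermitianNahm G τ y) {π : Mat n →L[ℝ] complexLieSpace hG}
    (hπ : ∀ w : complexLieSpace hG, π w = w) :
    ∃ δ > 0, ∀ (τ' : Fin 3 → Mat n) (z : ℝ → NahmSpace n) (X κ : Mat n),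
      (∀ i, τ' i ∈ lieAlgC G) → HermitianNahm G τ' z → X ∈ lieAlgC G → κ ∈ lieAlgC G →
      (∀ t ∈ I01, ‖NormedSpace.exp (t • X) * ((y t).2.2.2 * (z t).2.2.1)
        * NormedSpace.exp (t • κ) - 1‖ < δ) →
      π (NormedSpace.exp X * ((y 1).2.2.2 * (z 1).2.2.1) * NormedSpace.exp κ - 1) = 0 →
      NormedSpace.exp X * ((y 1).2.2.2 * (z 1).2.2.1) * NormedSpace.exp κ = 1 := by
  obtain ⟨ε, hε, hret⟩ := exists_eq_zero_of_retract_exp (complexLieSpace hG) hπ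
  obtain ⟨δ, hδ, hpath⟩ := TangentPath.exists_exp_eq hG hε
  refine ⟨δ, hδ, fun τ' z X κ hτ' hz hX hκ hshort h0 => ?_⟩
  obtain ⟨u, hu, hu0, huy⟩ := hy.exists_tangentPath hG hτ
  obtain ⟨w, hw, hw0, hwz⟩ := hz.exists_tangentPath hG hτ'
  have e : ∀ t ∈ I01, ((expGL (t • X) * ((u t)⁻¹ * w t) * expGL (t • κ) : GL (Fin n) ℂ) : Mat n)
      = NormedSpace.exp (t • X) * ((y t).2.2.2 * (z t).2.2.1) * NormedSpace.exp (t • κ) := by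
    intro t ht
    rw [Units.val_mul, Units.val_mul, Units.val_mul, (huy t ht).2, (hwz t ht).1, coe_expGL,
      coe_expGL]
  have e1 := e 1 (by simp)
  obtain ⟨ζ, hζ, hζε, hexp⟩ := hpath (fun t => expGL (t • X) * ((u t)⁻¹ * w t) * expGL (t • κ))
    (((TangentPath.expGL_smul hG hX).mul hG ((hu.inv hG).mul hG hw)).mul hG
      (TangentPath.expGL_smul hG hκ)) (Units.ext (by simp [hu0, hw0]))
    (fun t ht => by rw [e t ht]; exact hshort t ht)
  rw [e1, one_smul, one_smul] at hexp
  rw [← hexp] at h0 ⊢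
  rw [hret ζ hζ hζε h0, NormedSpace.exp_zero]

/-- The deformations of `α(0)` and `β(0)` by Hermitian vectors and multiples of `τ₁`. -/
noncomputable def initDeform (hG : IsCompactConnectedUnitary G) (τ₁ : Fin 3 → Mat n) :
    complexLieSpace hG × ℝ →L[ℝ] NahmSpace n :=
  ((hermPart.comp (complexLieSpace hG).subtypeL).comp (ContinuousLinearMap.fst ℝ _ _)).prod
    (((ContinuousLinearMap.snd ℝ _ _).smulRight τ₁).prod 0)

theorem initDeform_apply (hG : IsCompactConnectedUnitary G) (τ₁ : Fin 3 → Mat n)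
    (p : complexLieSpace hG × ℝ) :
    initDeform hG τ₁ p = (hermPart (p.1 : Mat n), p.2 • τ₁, 0, 0) := rfl

/-- The family `z` of solutions near `y`. A parameter `(ζ, ρ)` moves `α(0)` by the Hermitian part of
`ζ` and `β(0)` by `ρτ₁`; the discrepancy between the end point of `z` and the prescribed one, up to
a right factor `exp` of the skew-Hermitian part of `ζ`, is differentiable in the parameter, and its
derivative with respect to `ζ` is injective. The dimensions agree, since Hermitian and
skew-Hermitian parts of `ζ` together make up the complexified Lie algebra. -/
theorem exists_end_map (hG : IsCompactConnectedUnitary G) (hτ : ∀ i, τ i ∈ lieAlgC G)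
    (hy : HermitianNahm G τ y) {τ₁ : Fin 3 → Mat n} {Z : Mat n}
    {π : Mat n →L[ℝ] complexLieSpace hG} (hπ : ∀ w : complexLieSpace hG, π w = w) {δ : ℝ}
    (hδ : 0 < δ) :
    ∃ (z : complexLieSpace hG × ℝ → ℝ → NahmSpace n)
      (Ψ' : complexLieSpace hG × ℝ →L[ℝ] complexLieSpace hG),
      HasStrictFDerivAt (fun p => π (NormedSpace.exp (-(p.2 • Z))
        * ((y 1).2.2.2 * (z p 1).2.2.1) * NormedSpace.exp (-skewPart (p.1 : Mat n)) - 1)) Ψ' 0 ∧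
      (∀ ζ, Ψ' (ζ, 0) = 0 → ζ = 0) ∧ (∀ t ∈ I01, z 0 t = y t) ∧
      (∀ᶠ p in 𝓝 0, z p 0 = y 0 + initDeform hG τ₁ p ∧
        (∀ t ∈ I01, HasDerivWithinAt (z p) (nahmField (z p t) (z p t)) I01 t) ∧
        ∀ t ∈ I01, ‖NormedSpace.exp (t • -(p.2 • Z)) * ((y t).2.2.2 * (z p t).2.2.1)
          * NormedSpace.exp (t • -skewPart (p.1 : Mat n)) - 1‖ < δ) := by
  obtain ⟨Φ, Φ', hΦ, hΦy, hΦode, hΦ'⟩ := exists_quadratic_flow nahmField hy.ode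
  have hι : HasStrictFDerivAt (fun p => y 0 + initDeform hG τ₁ p) (initDeform hG τ₁) 0 :=
    (initDeform hG τ₁).hasStrictFDerivAt.const_add _
  have hι0 : y 0 + initDeform hG τ₁ 0 = y 0 := by rw [map_zero, add_zero]
  have hΦι := (hι0.symm ▸ hΦ).comp (0 : complexLieSpace hG × ℝ) hι
  have h1mem : (1 : ℝ) ∈ I01 := by simp
  let ev : C(I01, NahmSpace n) →L[ℝ] Mat n :=
    (ContinuousLinearMap.fst ℝ _ _).comp ((ContinuousLinearMap.snd ℝ _ _).comp
      ((ContinuousLinearMap.snd ℝ _ _).comp (ContinuousMap.evalCLM ℝ (⟨1, h1mem⟩ : I01))))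
  have hev : ∀ f, ev f = (extend01 f 1).2.2.1 := fun f => by rw [extend01_of_mem f h1mem]; rfl
  have hH := ev.hasStrictFDerivAt.comp (0 : complexLieSpace hG × ℝ) hΦι
  let L : complexLieSpace hG × ℝ →L[ℝ] Mat n := -((ContinuousLinearMap.snd ℝ _ _).smulRight Z)
  let R : complexLieSpace hG × ℝ →L[ℝ] Mat n :=
    -((skewPart.comp (complexLieSpace hG).subtypeL).comp
      (ContinuousLinearMap.fst ℝ (complexLieSpace hG) ℝ))
  have hend := hasStrictFDerivAt_exp_mul_mul_exp (L := L) (R := R) (k := (y 1).2.2.2) hH (by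
    simp only [hι0, hev, hΦy 1 h1mem]
    exact hy.k_mul_h 1 h1mem)
  refine ⟨fun p => extend01 (Φ (y 0 + initDeform hG τ₁ p)), _,
    (π.hasStrictFDerivAt.comp (0 : complexLieSpace hG × ℝ) (hend.sub_const 1)).congr_of_eventuallyEq
      (Eventually.of_forall fun p => ?_), fun ζ hζ => ?_, fun t ht => ?_, ?_⟩
  · simp only [hev]; rfl
  -- a direction in the kernel is a deformation which moves the end point in a unitary direction
  · set v : ℝ → NahmSpace n := extend01 (Φ' (initDeform hG τ₁ (ζ, 0))) with hv
    obtain ⟨hv0, hvd⟩ := hΦ' (initDeform hG τ₁ (ζ, 0))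
    rw [← hv] at hv0 hvd
    rw [initDeform_apply, zero_smul] at hv0
    have hvm : v 0 ∈ nahmSubspace hG := by
      rw [hv0]
      exact mem_nahmSubspace.2 ⟨hermPart_mem hG ζ.2, fun i => (complexLieSpace hG).zero_mem⟩
    have hvh : (v 0).2.2.1 = 0 := by rw [hv0]
    have hη := hy.infinitesimal_gauge_mem hG hτ hvd hvm hvh 1 h1mem
    have hsum : (y 1).2.2.2 * (v 1).2.2.1 - skewPart (ζ : Mat n) = 0 := by
      have h2 : π ((y 1).2.2.2 * (v 1).2.2.1 - skewPart (ζ : Mat n)) = 0 := by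
        rw [← hζ]
        have h3 : L (ζ, 0) = 0 := by simp [L]
        have h4 : R (ζ, 0) = -skewPart (ζ : Mat n) := rfl
        simp only [ContinuousLinearMap.comp_apply, add_apply, ContinuousLinearMap.mul_apply', hev,
          h3, h4, zero_add, sub_eq_add_neg, ← hv]
      have h5 := hπ ⟨_, (complexLieSpace hG).sub_mem hη (skewPart_mem hG ζ.2)⟩
      exact congrArg Subtype.val (h5.symm.trans h2)
    rw [sub_eq_zero] at hsum
    obtain ⟨h6, h7⟩ := hy.deformation_eq_zero hvd (by rw [hv0]; exact conjTranspose_hermPart _)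
      (fun i => by rw [hv0]; rfl) hvh (by rw [hsum, conjTranspose_skewPart, add_neg_cancel])
    replace h6 : hermPart (ζ : Mat n) = 0 := by rw [hv0] at h6; exact h6
    rw [hsum] at h7
    refine Subtype.ext ?_
    rw [← hermPart_add_skewPart (ζ : Mat n), h6, h7, add_zero]; rfl
  · simp only [hι0]; exact hΦy t ht
  · have hcont : ContinuousAt (fun p => Φ (y 0 + initDeform hG τ₁ p)) 0 := hΦι.continuousAt
    rw [← hι0] at hΦode
    have hode := hι.continuousAt.eventually hΦode
    -- the path of discrepancies is `1` at `p = 0`, hence uniformly short for small `p`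
    have hshort : ∀ᶠ p in 𝓝 (0 : complexLieSpace hG × ℝ), ∀ t ∈ (Set.univ : Set I01),
        ‖NormedSpace.exp ((t : ℝ) • L p) * ((Φ (y 0) t).2.2.2
          * (Φ (y 0 + initDeform hG τ₁ p) t).2.2.1)
          * NormedSpace.exp ((t : ℝ) • R p) - 1‖ < δ := by
      refine isCompact_univ.eventually_forall_of_forall_eventually fun t _ => ?_
      have hc : ContinuousAt (fun q : (complexLieSpace hG × ℝ) × I01 =>
          ‖NormedSpace.exp ((q.2 : ℝ) • L q.1) * ((Φ (y 0) q.2).2.2.2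
          * (Φ (y 0 + initDeform hG τ₁ q.1) q.2).2.2.1)
          * NormedSpace.exp ((q.2 : ℝ) • R q.1) - 1‖) (0, t) := by
        have he : Continuous (NormedSpace.exp : Mat n → Mat n) :=
          (contDiff_exp (k := 0)).continuous
        have h1 : ContinuousAt (fun q : (complexLieSpace hG × ℝ) × I01 =>
            Φ (y 0 + initDeform hG τ₁ q.1) q.2) (0, t) := by
          have h2 : ContinuousAt (fun q : (complexLieSpace hG × ℝ) × I01 =>
              Φ (y 0 + initDeform hG τ₁ q.1)) (0, t) :=
            ContinuousAt.comp (f := Prod.fst) (x := ((0 : complexLieSpace hG × ℝ), t)) hcont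
              continuousAt_fst
          exact ContinuousAt.comp (g := fun r : C(I01, NahmSpace n) × I01 => r.1 r.2)
            continuous_eval.continuousAt (h2.prodMk continuousAt_snd)
        have h3 : ∀ L : complexLieSpace hG × ℝ →L[ℝ] Mat n,
            Continuous fun q : (complexLieSpace hG × ℝ) × I01 =>
              NormedSpace.exp ((q.2 : ℝ) • L q.1) := fun L => he.comp (by fun_prop)
        have h4 : Continuous fun q : (complexLieSpace hG × ℝ) × I01 => (Φ (y 0) q.2).2.2.2 := by
          fun_prop
        have h5 : ContinuousAt (fun q : (complexLieSpace hG × ℝ) × I01 =>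
            (Φ (y 0 + initDeform hG τ₁ q.1) q.2).2.2.1) (0, t) :=
          ContinuousAt.comp (g := fun e : NahmSpace n => e.2.2.1) (by fun_prop) h1
        exact ((((h3 L).continuousAt.mul (h4.continuousAt.mul h5)).mul
          (h3 R).continuousAt).sub continuousAt_const).norm
      refine hc.eventually_lt continuousAt_const ?_
      have h5 := hΦy t t.2
      rw [extend01_of_mem _ t.2] at h5
      simp only [map_zero, add_zero, smul_zero, NormedSpace.exp_zero, one_mul, mul_one]
      rw [h5, hy.k_mul_h t t.2, sub_self, norm_zero]
      exact hδ
    filter_upwards [hode, hshort] with p hp hs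
    refine ⟨hp.1, hp.2, fun t ht => ?_⟩
    have h6 := hs ⟨t, ht⟩ (Set.mem_univ _)
    rw [← extend01_of_mem _ ht, ← extend01_of_mem _ ht, hΦy t ht] at h6
    exact h6

/-- The solutions whose end point lies in a given coset of `G` persist when the data `β(0)` and the
coset are moved a little. -/
theorem eventually_exists (hG : IsCompactConnectedUnitary G) (hτ : ∀ i, τ i ∈ lieAlgC G)
    (hy : HermitianNahm G τ y) {τ₁ : Fin 3 → Mat n} (hτ₁ : ∀ i, τ₁ i ∈ lieAlgC G) {Z : Mat n}
    (hZ : Z ∈ lieAlgC G) :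
    ∀ᶠ ρ in 𝓝 (0 : ℝ), ∃ z, HermitianNahm G (τ + ρ • τ₁) z ∧
      ∃ k ∈ G, (z 1).2.2.1 = (y 1).2.2.1 * NormedSpace.exp (ρ • Z) * (k : Mat n) := by
  obtain ⟨P, hP, hP'⟩ := exists_projection (complexLieSpace hG)
  set π : Mat n →L[ℝ] complexLieSpace hG := P.codRestrict (complexLieSpace hG) hP' with hπd
  have hπ : ∀ w : complexLieSpace hG, π w = w := fun w => Subtype.ext (hP w w.2)
  obtain ⟨δ, hδ, hend⟩ := hy.end_eq_of_retract_eq_zero hG hτ hπ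
  obtain ⟨z, Ψ', hΨ, hinj, hz0, hev⟩ := hy.exists_end_map hG hτ (τ₁ := τ₁) (Z := Z) hπ hδ
  set Ψ : complexLieSpace hG × ℝ → complexLieSpace hG := fun p => π (NormedSpace.exp (-(p.2 • Z))
        * ((y 1).2.2.2 * (z p 1).2.2.1) * NormedSpace.exp (-skewPart (p.1 : Mat n)) - 1) with hΨd
  have hF := hΨ.prodMk (ContinuousLinearMap.snd ℝ (complexLieSpace hG) ℝ).hasStrictFDerivAt
  -- with the parameter `ρ` adjoined, the derivative of the discrepancy is surjective, so that
  -- `(0, ρ)` is a value for every small `ρ`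
  have hsurj : (Ψ'.prod (ContinuousLinearMap.snd ℝ (complexLieSpace hG) ℝ)).range = ⊤ := by
    refine LinearMap.range_eq_top.2 (LinearMap.injective_iff_surjective.1 ?_)
    refine (injective_iff_map_eq_zero _).2 fun p hp => ?_
    obtain ⟨ζ, ρ⟩ := p
    obtain ⟨h1, h2⟩ := Prod.ext_iff.1 hp
    change Ψ' (ζ, ρ) = 0 at h1
    change ρ = 0 at h2
    subst h2
    rw [hinj ζ h1]; rfl
  have hmap := hF.map_nhds_eq_of_surj hsurj
  have hΨ0 : Ψ 0 = 0 := by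
    simp only [hΨd]
    rw [hz0 1 (by simp), hy.k_mul_h 1 (by simp)]
    simp
  have h0 : ((Ψ 0, (ContinuousLinearMap.snd ℝ (complexLieSpace hG) ℝ) 0) :
      complexLieSpace hG × ℝ) = 0 := by rw [hΨ0]; rfl
  rw [h0] at hmap
  have h1 := Filter.image_mem_map (m := fun p => (Ψ p,
    (ContinuousLinearMap.snd ℝ (complexLieSpace hG) ℝ) p)) hev
  rw [hmap] at h1
  have hc : ContinuousAt (fun ρ : ℝ => ((0 : complexLieSpace hG), ρ)) 0 := by fun_prop
  filter_upwards [hc h1] with ρ hρ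
  obtain ⟨⟨ζ, ρ'⟩, ⟨hz1, hzode, hshort⟩, hp⟩ := hρ
  obtain ⟨h2, h3⟩ := Prod.ext_iff.1 hp
  change Ψ (ζ, ρ') = 0 at h2
  change ρ' = ρ at h3
  subst h3
  rw [initDeform_apply] at hz1
  have hτ' : ∀ i, (τ + ρ' • τ₁) i ∈ lieAlgC G := fun i =>
    (complexLieSpace hG).add_mem (hτ i) ((complexLieSpace hG).smul_mem _ (hτ₁ i))
  have hz : HermitianNahm G (τ + ρ' • τ₁) (z (ζ, ρ')) := by
    refine ⟨hzode, ?_, ?_, ?_⟩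
    · rw [hz1]; exact (complexLieSpace hG).add_mem hy.mem_zero (hermPart_mem hG ζ.2)
    · rw [hz1, Prod.fst_add, Matrix.conjTranspose_add, hy.herm_zero, conjTranspose_hermPart]
    · rw [hz1, Prod.snd_add, hy.init]; simp
  have h4 := hend _ _ (-(ρ' • Z)) (-skewPart (ζ : Mat n)) hτ' hz
    ((complexLieSpace hG).neg_mem ((complexLieSpace hG).smul_mem _ hZ))
    ((complexLieSpace hG).neg_mem (skewPart_mem hG ζ.2)) hshort h2
  refine ⟨_, hz, expGL (skewPart (ζ : Mat n)), expGL_skewPart_mem hG ζ.2, ?_⟩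
  have e1 := exp_neg_mul_exp (skewPart (ζ : Mat n))
  have e2 := exp_mul_exp_neg (ρ' • Z)
  rw [coe_expGL]
  generalize NormedSpace.exp (skewPart (ζ : Mat n)) = a at *
  generalize NormedSpace.exp (-skewPart (ζ : Mat n)) = a' at *
  generalize NormedSpace.exp (-(ρ' • Z)) = b' at *
  generalize NormedSpace.exp (ρ' • Z) = b at *
  have e3 := hy.h_mul_k 1 (by simp)
  calc (z (ζ, ρ') 1).2.2.1
      = (y 1).2.2.1 * (b * b') * (y 1).2.2.2 * (z (ζ, ρ') 1).2.2.1 * (a' * a) := by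
        rw [e1, e2, mul_one, mul_one, e3, one_mul]
    _ = (y 1).2.2.1 * b * (b' * ((y 1).2.2.2 * (z (ζ, ρ') 1).2.2.1) * a') * a := by
        simp only [mul_assoc]
    _ = _ := by rw [h4, mul_one]

end HermitianNahm

end Openness

/-! ### Existence of solutions with prescribed end point -/

section Existence

attribute [local instance] matNormedRing matNormedAlgebra

open scoped Matrix

variable {n : ℕ} {G : Subgroup (GL (Fin n) ℂ)}

/-- The parameters `s` for which there is a solution in Hermitian gauge with `β(0) = τ₀ + sτ₁` and
`h(1)` in the coset `g exp(sZ) G`. -/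
def solvableSet (G : Subgroup (GL (Fin n) ℂ)) (τ₀ τ₁ : Fin 3 → Mat n) (g : GL (Fin n) ℂ)
    (Z : Mat n) : Set ℝ :=
  {s | ∃ y, HermitianNahm G (τ₀ + s • τ₁) y ∧
    ∃ k ∈ G, (y 1).2.2.1 = (g : Mat n) * NormedSpace.exp (s • Z) * (k : Mat n)}

variable {τ₀ τ₁ : Fin 3 → Mat n} {g : GL (Fin n) ℂ} {Z : Mat n}

theorem exists_norm_le_of_mem (hG : IsCompactConnectedUnitary G) :
    ∃ C : ℝ, 0 ≤ C ∧ ∀ k ∈ G, ‖(k : Mat n)‖ ≤ C := by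
  obtain ⟨C, hC⟩ := (hG.compact.image Units.continuous_val).isBounded.exists_norm_le
  exact ⟨C, (norm_nonneg _).trans (hC _ ⟨1, G.one_mem, rfl⟩), fun k hk => hC _ ⟨k, hk, rfl⟩⟩

theorem continuous_exp_smul (Z : Mat n) : Continuous fun s : ℝ => NormedSpace.exp (s • Z) :=
  (contDiff_exp (k := 0)).continuous.comp (by fun_prop)

theorem HermitianNahm.k_end_eq {τ : Fin 3 → Mat n} {y : ℝ → NahmSpace n}
    (hy : HermitianNahm G τ y) {s : ℝ} {k : GL (Fin n) ℂ}
    (h : (y 1).2.2.1 = (g : Mat n) * NormedSpace.exp (s • Z) * (k : Mat n)) :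
    (y 1).2.2.2 = ((k⁻¹ : GL (Fin n) ℂ) : Mat n) * (NormedSpace.exp (s • -Z)
      * ((g⁻¹ : GL (Fin n) ℂ) : Mat n)) := by
  have e : (g : Mat n) * NormedSpace.exp (s • Z) * (k : Mat n)
      = ((g * expGL (s • Z) * k : GL (Fin n) ℂ) : Mat n) := rfl
  have h1 : (y 1).2.2.1 * ((k⁻¹ : GL (Fin n) ℂ) * (NormedSpace.exp (s • -Z)
      * ((g⁻¹ : GL (Fin n) ℂ) : Mat n))) = 1 := by
    rw [h, e, smul_neg, ← coe_expGL_inv, ← Units.val_mul, ← Units.val_mul, ← Units.val_mul]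
    simp [mul_assoc]
  calc (y 1).2.2.2 = (y 1).2.2.2 * ((y 1).2.2.1 * ((k⁻¹ : GL (Fin n) ℂ) * (NormedSpace.exp (s • -Z)
      * ((g⁻¹ : GL (Fin n) ℂ) : Mat n)))) := by rw [h1, mul_one]
    _ = _ := by rw [← mul_assoc, hy.k_mul_h 1 (by simp), one_mul]

/-- Solutions with end point in one of the cosets `g exp(sZ) G`, `s ∈ [0,1]`, are uniformly bounded,
because `G` is compact. -/
theorem exists_bound_of_end (hG : IsCompactConnectedUnitary G) (τ₀ τ₁ : Fin 3 → Mat n)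
    (g : GL (Fin n) ℂ) (Z : Mat n) :
    ∃ R, ∀ s ∈ I01, ∀ y, HermitianNahm G (τ₀ + s • τ₁) y → ∀ k ∈ G,
      (y 1).2.2.1 = (g : Mat n) * NormedSpace.exp (s • Z) * (k : Mat n) → ∀ t ∈ I01, ‖y t‖ ≤ R := by
  obtain ⟨C, hC0, hC⟩ := exists_norm_le_of_mem hG
  obtain ⟨A, hA0, hA⟩ := exists_norm_le_of_continuousOn
    (f := fun s : ℝ => (g : Mat n) * NormedSpace.exp (s • Z))
    (continuous_const.mul (continuous_exp_smul Z)).continuousOn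
  obtain ⟨A', hA0', hA'⟩ := exists_norm_le_of_continuousOn
    (f := fun s : ℝ => NormedSpace.exp (s • -Z) * ((g⁻¹ : GL (Fin n) ℂ) : Mat n))
    ((continuous_exp_smul (-Z)).mul continuous_const).continuousOn
  obtain ⟨T, hT0, hT⟩ := exists_norm_le_of_continuousOn
    (f := fun s : ℝ => τ₀ + s • τ₁) (by fun_prop)
  set M : ℝ := T + ‖(1 : Mat n)‖ ^ 2 + (A * C) ^ 2 + (C * A') ^ 2 with hM
  have p1 := sq_nonneg ‖(1 : Mat n)‖
  have p2 := sq_nonneg (A * C)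
  have p3 := sq_nonneg (C * A')
  obtain ⟨R, hR⟩ := HermitianNahm.exists_bound (G := G) M
  refine ⟨R, fun s hs y hy k hk hend => hR _ y hy (fun i => ?_) (by linarith) ?_ ?_⟩
  · have := (norm_le_pi_norm _ i).trans (hT s hs)
    linarith
  · have h1 : ‖(y 1).2.2.1‖ ≤ A * C := by
      rw [hend]; exact norm_mul_le_of_le (hA s hs) (hC k hk)
    have := pow_le_pow_left₀ (norm_nonneg _) h1 2
    linarith
  · have h1 : ‖(y 1).2.2.2‖ ≤ C * A' := by
      rw [hy.k_end_eq hend]; exact norm_mul_le_of_le (hC _ (G.inv_mem hk)) (hA' s hs)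
    have := pow_le_pow_left₀ (norm_nonneg _) h1 2
    linarith

/-- Closedness: by the a priori bound, `α(0)` and the factor in `G` of a sequence of solutions
converge along a subsequence. -/
theorem isClosed_solvableSet_inter (hG : IsCompactConnectedUnitary G) :
    IsClosed (solvableSet G τ₀ τ₁ g Z ∩ I01) := by
  have : ProperSpace (Mat n) := FiniteDimensional.proper ℝ (Mat n)
  obtain ⟨R, hR⟩ := exists_bound_of_end hG τ₀ τ₁ g Z
  refine IsSeqClosed.isClosed fun s x hs hsx => ?_
  have hx : x ∈ I01 := isClosed_Icc.mem_of_tendsto hsx (Eventually.of_forall fun m => (hs m).2)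
  refine ⟨?_, hx⟩
  choose y hy k hk hend using fun m => (hs m).1
  have hb : ∀ m, ∀ t ∈ I01, ‖y m t‖ ≤ R := fun m => hR _ (hs m).2 _ (hy m) _ (hk m) (hend m)
  have hK : IsCompact (Metric.closedBall (0 : Mat n) R ×ˢ
      ((fun g : GL (Fin n) ℂ => (g : Mat n)) '' (G : Set (GL (Fin n) ℂ)))) :=
    (isCompact_closedBall _ _).prod (hG.compact.image Units.continuous_val)
  obtain ⟨⟨a, _⟩, ⟨ha, ⟨k₀, hk₀, rfl⟩⟩, φ, hφ, hlim⟩ := hK.tendsto_subseq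
    (x := fun m => ((y m 0).1, (k m : Mat n))) fun m =>
      ⟨mem_closedBall_zero_iff.2 ((norm_fst_le (y m 0)).trans (hb m 0 (by simp))), ⟨k m, hk m, rfl⟩⟩
  have hla : Tendsto (fun m => (y (φ m) 0).1) atTop (𝓝 a) :=
    (continuous_fst.tendsto _).comp hlim
  have hlk : Tendsto (fun m => (k (φ m) : Mat n)) atTop (𝓝 (k₀ : Mat n)) :=
    (continuous_snd.tendsto _).comp hlim
  have hls : Tendsto (fun m => s (φ m)) atTop (𝓝 x) := hsx.comp hφ.tendsto_atTop
  have hy0 : ∀ m, y m 0 = ((y m 0).1, τ₀ + s m • τ₁, 1, 1) := fun m =>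
    Prod.ext rfl (hy m).init
  have hlτ : Tendsto (fun m => τ₀ + s (φ m) • τ₁) atTop (𝓝 (τ₀ + x • τ₁)) :=
    tendsto_const_nhds.add (hls.smul_const τ₁)
  obtain ⟨z, hz0, hz, hzlim⟩ := exists_limit_quadratic_ode (y := fun m => y (φ m))
    (e := (a, τ₀ + x • τ₁, 1, 1)) (fun m => (hy (φ m)).ode) (fun m => hb (φ m)) (by
      have := hla.prodMk_nhds (hlτ.prodMk_nhds (tendsto_const_nhds (x := ((1, 1) : Mat n × Mat n))))
      exact this.congr fun m => (hy0 (φ m)).symm)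
  refine ⟨z, ⟨hz, ?_, ?_, by rw [hz0]⟩, k₀, hk₀, ?_⟩
  · rw [hz0]
    exact (Submodule.closed_of_finiteDimensional (complexLieSpace hG)).mem_of_tendsto hla
      (Eventually.of_forall fun m => (hy (φ m)).mem_zero)
  · rw [hz0]
    exact tendsto_nhds_unique
      (((ctL (n := n)).continuous.tendsto a).comp hla)
      (hla.congr fun m => ((hy (φ m)).herm_zero).symm)
  · have h1 : Tendsto (fun m => (y (φ m) 1).2.2.1) atTop (𝓝 (z 1).2.2.1) :=
      ((continuous_fst.comp (continuous_snd.comp continuous_snd)).tendsto (z 1)).comp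
        (hzlim 1 (by simp))
    have h2 : Tendsto (fun m => (g : Mat n) * NormedSpace.exp (s (φ m) • Z) * (k (φ m) : Mat n))
        atTop (𝓝 ((g : Mat n) * NormedSpace.exp (x • Z) * (k₀ : Mat n))) :=
      (tendsto_const_nhds.mul (((continuous_exp_smul Z).tendsto x).comp hls)).mul hlk
    exact tendsto_nhds_unique h1 (h2.congr fun m => (hend (φ m)).symm)

/-- Openness, from the local statement `HermitianNahm.eventually_exists`. -/
theorem eventually_mem_solvableSet (hG : IsCompactConnectedUnitary G)
    (hτ₀ : ∀ i, τ₀ i ∈ lieAlgC G) (hτ₁ : ∀ i, τ₁ i ∈ lieAlgC G) (hZ : Z ∈ lieAlgC G) {s : ℝ}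
    (hs : s ∈ solvableSet G τ₀ τ₁ g Z) : ∀ᶠ r in 𝓝 s, r ∈ solvableSet G τ₀ τ₁ g Z := by
  obtain ⟨y, hy, k, hk, hend⟩ := hs
  have h1 := hy.eventually_exists (τ := τ₀ + s • τ₁) hG
    (fun i => (complexLieSpace hG).add_mem (hτ₀ i) ((complexLieSpace hG).smul_mem _ (hτ₁ i))) hτ₁
    (conj_mem_lieAlgC' hG (subset_complexification hk) hZ)
  have hc : Tendsto (fun r => r - s) (𝓝 s) (𝓝 0) := by
    have : Continuous fun r : ℝ => r - s := by fun_prop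
    simpa using this.tendsto s
  filter_upwards [hc.eventually h1] with r hr
  obtain ⟨z, hz, k', hk', hzend⟩ := hr
  refine ⟨z, ?_, k * k', G.mul_mem hk hk', ?_⟩
  · rwa [add_assoc, ← add_smul, add_sub_cancel] at hz
  · let _ : NormedAlgebra ℚ (Mat n) := NormedAlgebra.restrictScalars ℚ ℝ (Mat n)
    have e1 : NormedSpace.exp ((r - s) • (((k⁻¹ : GL (Fin n) ℂ) : Mat n) * Z * (k : Mat n)))
        = ((k⁻¹ : GL (Fin n) ℂ) : Mat n) * NormedSpace.exp ((r - s) • Z) * (k : Mat n) := by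
      rw [← NormedSpace.exp_units_conj', mul_smul_comm, smul_mul_assoc]
    have e2 : NormedSpace.exp (r • Z)
        = NormedSpace.exp (s • Z) * NormedSpace.exp ((r - s) • Z) := by
      rw [← exp_add_smul_self, add_sub_cancel]
    have e3 : (k : Mat n) * ((k⁻¹ : GL (Fin n) ℂ) : Mat n) = 1 := Units.mul_inv k
    rw [hzend, hend, e1, e2, Units.val_mul]
    calc _ = (g : Mat n) * NormedSpace.exp (s • Z) * ((k : Mat n) * ((k⁻¹ : GL (Fin n) ℂ) : Mat n))
          * NormedSpace.exp ((r - s) • Z) * k * k' := by noncomm_ring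
      _ = _ := by rw [e3]; noncomm_ring

/-- The continuity method: the set of solvable parameters in `[0,1]` is open and closed. -/
theorem one_mem_solvableSet (hG : IsCompactConnectedUnitary G)
    (hτ₀ : ∀ i, τ₀ i ∈ lieAlgC G) (hτ₁ : ∀ i, τ₁ i ∈ lieAlgC G) (hZ : Z ∈ lieAlgC G)
    (h0 : 0 ∈ solvableSet G τ₀ τ₁ g Z) : 1 ∈ solvableSet G τ₀ τ₁ g Z := by
  refine (isClosed_solvableSet_inter hG).mem_of_ge_of_forall_exists_gt h0 zero_le_one ?_
  rintro s ⟨hs, hs'⟩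
  have h1 := (eventually_mem_solvableSet hG hτ₀ hτ₁ hZ hs).filter_mono
    (nhdsWithin_le_nhds (s := Ioi s))
  obtain ⟨r, hr, hr'⟩ := (h1.and (Ioc_mem_nhdsGT hs'.2)).exists
  exact ⟨r, hr, hr'⟩

/-- Every coset of `G` in the complexified group contains the end point of a solution in Hermitian
gauge with given `β(0)`. Starting from the zero solution, first `β(0)` is moved to `τ` and then the
coset is moved along the exponentials which, together with `G`, generate the group. -/
theorem exists_hermitianNahm (hG : IsCompactConnectedUnitary G) {τ : Fin 3 → Mat n}
    (hτ : ∀ i, τ i ∈ lieAlgC G) (hg : g ∈ complexification G) :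
    ∃ y, HermitianNahm G τ y ∧ ∃ k ∈ G, (y 1).2.2.1 = (g : Mat n) * (k : Mat n) := by
  have hz : ∀ i, (0 : Fin 3 → Mat n) i ∈ lieAlgC G := fun i => (complexLieSpace hG).zero_mem
  have hexp : ∀ (g : GL (Fin n) ℂ) (Z : Mat n) (e : GL (Fin n) ℂ), Z ∈ lieAlgC G →
      (e : Mat n) = NormedSpace.exp Z →
      (∃ y, HermitianNahm G τ y ∧ ∃ k ∈ G, (y 1).2.2.1 = (g : Mat n) * (k : Mat n)) →
      ∃ y, HermitianNahm G τ y ∧ ∃ k ∈ G, (y 1).2.2.1 = ((g * e : GL (Fin n) ℂ) : Mat n) * k := by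
    rintro g Z e hZ he ⟨y, hy, k, hk, hend⟩
    obtain ⟨y', hy', h⟩ := one_mem_solvableSet (g := g) hG hτ hz hZ
      ⟨y, by rwa [zero_smul, add_zero], k, hk, by rw [hend]; simp⟩
    rw [smul_zero, add_zero] at hy'
    rw [one_smul] at h
    refine ⟨y', hy', ?_⟩
    rwa [Units.val_mul, he]
  have hmul : ∀ (g e : GL (Fin n) ℂ), e ∈ G →
      (∃ y, HermitianNahm G τ y ∧ ∃ k ∈ G, (y 1).2.2.1 = (g : Mat n) * (k : Mat n)) →
      ∃ y, HermitianNahm G τ y ∧ ∃ k ∈ G, (y 1).2.2.1 = ((g * e : GL (Fin n) ℂ) : Mat n) * k := by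
    rintro g e he ⟨y, hy, k, hk, hend⟩
    refine ⟨y, hy, e⁻¹ * k, G.mul_mem (G.inv_mem he) hk, ?_⟩
    rw [hend, ← Units.val_mul, ← Units.val_mul]
    simp [mul_assoc]
  induction hg using Subgroup.closure_induction_right with
  | one =>
    have hc : HermitianNahm G 0 fun _ : ℝ => ((0, 0, 1, 1) : NahmSpace n) := by
      refine ⟨fun t _ => (hasDerivWithinAt_const _ _ _).congr_deriv ?_,
        (complexLieSpace hG).zero_mem, Matrix.conjTranspose_zero, rfl⟩
      rw [nahmField_apply]
      refine Prod.ext ?_ (Prod.ext (funext fun i => ?_) (Prod.ext ?_ ?_)) <;> simp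
    obtain ⟨y, hy, k, hk, h⟩ := one_mem_solvableSet (τ₀ := 0) (g := 1) (Z := 0) hG hz hτ
      (complexLieSpace hG).zero_mem
      ⟨_, by rw [zero_smul, add_zero]; exact hc, 1, G.one_mem, by simp⟩
    rw [one_smul, zero_add] at hy
    exact ⟨y, hy, k, hk, by simpa using h⟩
  | mul_right g hg e he ih =>
    rcases he with he | ⟨Z, hZ, he⟩
    · exact hmul g e he ih
    · exact hexp g Z e hZ he ih
  | mul_inv_cancel g hg e he ih =>
    rcases he with he | ⟨Z, hZ, he⟩
    · exact hmul g _ (G.inv_mem he) ih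
    · refine hexp g (-Z) _ ((complexLieSpace hG).neg_mem hZ) ?_ ih
      have : e = expGL Z := Units.ext he
      rw [this, coe_expGL_inv]

end Existence

/-! ### Regularity, and the trivialization of a solution -/

section Trivialization

attribute [local instance] matNormedRing matNormedAlgebra

open scoped Matrix ContDiff

variable {n : ℕ} {G : Subgroup (GL (Fin n) ℂ)}

/-- Entrywise regularity is regularity with respect to the norm. -/
theorem isClass_iff_contDiffOn {k : ℕ∞} {A : ℝ → Mat n} : IsClass k A ↔ ContDiffOn ℝ k A I01 := by
  refine ⟨fun h => ?_, isClass_of_contDiffOn⟩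
  have h1 : ContDiffOn ℝ k (fun s => fun i j => A s i j) I01 :=
    contDiffOn_pi.2 fun i => contDiffOn_pi.2 fun j => h i j
  exact (LinearMap.toContinuousLinearMap
    (Matrix.ofLinearEquiv ℝ :
      (Fin n → Fin n → ℂ) ≃ₗ[ℝ] Mat n).toLinearMap).contDiff.comp_contDiffOn h1

theorem D_eq_of_hasDerivWithinAt {A : ℝ → Mat n} {A' : Mat n} {t : ℝ} (ht : t ∈ I01)
    (h : HasDerivWithinAt A A' I01 t) : D A t = A' := by
  ext i j
  exact ((Matrix.entryLinearMap ℝ ℂ i j).toContinuousLinearMap.hasFDerivAt.comp_hasDerivWithinAt t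
    h).derivWithin (uniqueDiffOn_Icc zero_lt_one t ht)

theorem IsClass.hasDerivWithinAt {k : ℕ∞} {A : ℝ → Mat n} (h : IsClass k A) (hk : k ≠ 0) {t : ℝ}
    (ht : t ∈ I01) : HasDerivWithinAt A (D A t) I01 t := by
  have h1 := ((isClass_iff_contDiffOn.1 h).differentiableOn (by exact_mod_cast hk) t
    ht).hasDerivWithinAt
  exact h1.congr_deriv (D_eq_of_hasDerivWithinAt ht h1).symm

theorem IsClass.continuousOn {k : ℕ∞} {A : ℝ → Mat n} (h : IsClass k A) : ContinuousOn A I01 :=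
  (isClass_iff_contDiffOn.1 h).continuousOn

theorem IsClass.of_le {k l : ℕ∞} {A : ℝ → Mat n} (h : IsClass k A) (hl : l ≤ k) : IsClass l A :=
  fun i j => (h i j).of_le (by exact_mod_cast hl)

theorem isClass_D {A : ℝ → Mat n} (h : IsClass ⊤ A) : IsClass ⊤ (D A) := fun i j =>
  (h i j).derivWithin (uniqueDiffOn_Icc zero_lt_one) (by exact_mod_cast le_rfl)

/-- A solution of a differential equation is smooth if its right hand side is as regular as the
solution. -/
theorem contDiffOn_of_hasDerivWithinAt {E : Type*} [NormedAddCommGroup E] [NormedSpace ℝ E]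
    {u F : ℝ → E} (hu : ∀ t ∈ I01, HasDerivWithinAt u (F t) I01 t)
    (hF : ∀ m : ℕ, ContDiffOn ℝ m u I01 → ContDiffOn ℝ m F I01) : ContDiffOn ℝ ∞ u I01 := by
  have hd : ∀ t ∈ I01, derivWithin u I01 t = F t := fun t ht =>
    (hu t ht).derivWithin (uniqueDiffOn_Icc zero_lt_one t ht)
  refine contDiffOn_infty.2 fun m => ?_
  induction m with
  | zero => exact contDiffOn_zero.2 fun t ht => (hu t ht).continuousWithinAt
  | succ m ih =>
    refine (contDiffOn_succ_iff_derivWithin (uniqueDiffOn_Icc zero_lt_one)).2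
      ⟨fun t ht => (hu t ht).differentiableWithinAt, by simp, (hF m ih).congr hd⟩

theorem contDiffOn_quadratic_ode {E : Type*} [NormedAddCommGroup E] [NormedSpace ℝ E]
    {B : E →L[ℝ] E →L[ℝ] E} {y : ℝ → E}
    (hy : ∀ t ∈ I01, HasDerivWithinAt y (B (y t) (y t)) I01 t) : ContDiffOn ℝ ∞ y I01 :=
  contDiffOn_of_hasDerivWithinAt hy fun _ h => (B.contDiff.comp_contDiffOn h).clm_apply h

theorem HermitianNahm.contDiffOn {τ : Fin 3 → Mat n} {y : ℝ → NahmSpace n}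
    (hy : HermitianNahm G τ y) : ContDiffOn ℝ ∞ y I01 :=
  contDiffOn_quadratic_ode hy.ode

namespace Solution

theorem deriv_β (x : Solution G) (i : Fin 3) {t : ℝ} (ht : t ∈ I01) :
    HasDerivWithinAt (x.β i) (-((2 : ℝ) • ⁅x.α t, x.β i t⁆)) I01 t :=
  ((x.β_smooth i).hasDerivWithinAt (by simp) ht).congr_deriv
    (eq_neg_of_add_eq_zero_left (x.complex_eq i t ht))

theorem deriv_real (x : Solution G) {t : ℝ} (ht : t ∈ I01) :
    HasDerivWithinAt (fun t => x.α t + (x.α t)ᴴ)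
      (-((2 : ℝ) • (⁅x.α t, (x.α t)ᴴ⁆ + ∑ i, ⁅x.β i t, (x.β i t)ᴴ⁆))) I01 t := by
  have h1 := x.α_smooth.hasDerivWithinAt (by simp) ht
  have h2 := h1.fun_add (hasDerivWithinAt_conjTranspose h1)
  refine h2.congr_deriv ?_
  rw [← D_eq_of_hasDerivWithinAt ht h2]
  exact eq_neg_of_add_eq_zero_left (x.real_eq t ht)

end Solution

namespace IsTrivializing

variable {x : Solution G} {g : ℝ → GL (Fin n) ℂ}

theorem hasDerivWithinAt (hg : IsTrivializing x g) {t : ℝ} (ht : t ∈ I01) :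
    HasDerivWithinAt (fun t => (g t : Mat n)) ((2 : ℝ) • ((g t : Mat n) * x.α t)) I01 t :=
  (hg.isClass.hasDerivWithinAt (by simp) ht).congr_deriv (hg.ode t ht)

/-- A path of matrices which solves `g' = 2gα` is a trivialization. -/
theorem of_hasDerivWithinAt (hG : IsCompactConnectedUnitary G)
    (hd : ∀ t ∈ I01,
      HasDerivWithinAt (fun t => (g t : Mat n)) ((2 : ℝ) • ((g t : Mat n) * x.α t)) I01 t)
    (h0 : g 0 = 1) : IsTrivializing x g where
  mem := (TangentPath.of_deriv hG (A := fun t => (2 : ℝ) • x.α t) (by rw [h0]; exact one_mem _)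
    ((continuous_const_smul (2 : ℝ)).comp_continuousOn x.α_smooth.continuousOn)
    (fun t ht => (complexLieSpace hG).smul_mem _ (x.α_mem t ht))
    (fun t ht => (hd t ht).congr_deriv (mul_smul_comm _ _ _).symm)).mem
  isClass := by
    refine IsClass.of_le (k := ⊤) (isClass_of_contDiffOn (contDiffOn_of_hasDerivWithinAt hd
      fun m hm => ?_)) le_top
    exact (contDiff_const_smul (2 : ℝ)).comp_contDiffOn (hm.mul
      ((isClass_iff_contDiffOn.1 x.α_smooth).of_le (by exact_mod_cast le_top)))
  zero := h0
  ode := fun t ht => D_eq_of_hasDerivWithinAt ht (hd t ht)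

theorem tangentPath (hG : IsCompactConnectedUnitary G) (hg : IsTrivializing x g) :
    TangentPath G g :=
  TangentPath.of_deriv hG (A := fun t => (2 : ℝ) • x.α t) (by rw [hg.zero]; exact one_mem _)
    ((continuous_const_smul (2 : ℝ)).comp_continuousOn x.α_smooth.continuousOn)
    (fun t ht => (complexLieSpace hG).smul_mem _ (x.α_mem t ht))
    (fun t ht => (hg.hasDerivWithinAt ht).congr_deriv (mul_smul_comm _ _ _).symm)

theorem eqOn {g' : ℝ → GL (Fin n) ℂ} (hg' : IsTrivializing x g') (hg : IsTrivializing x g) :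
    EqOn g' g I01 := by
  intro t ht
  have := eq_zero_of_hasDerivWithinAt_mul (w := fun t => (g' t : Mat n) - (g t : Mat n))
    (a := fun _ => 0) (b := fun t => (2 : ℝ) • x.α t) continuousOn_const
    ((continuous_const_smul (2 : ℝ)).comp_continuousOn x.α_smooth.continuousOn)
    (fun t ht => ((hg'.hasDerivWithinAt ht).fun_sub (hg.hasDerivWithinAt ht)).congr_deriv (by
      simp only [zero_mul, zero_add, sub_mul, mul_smul_comm, smul_sub]))
    (by simp [hg'.zero, hg.zero]) t ht
  exact Units.ext (sub_eq_zero.1 this)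

theorem gaugeβ_eq (hg : IsTrivializing x g) (i : Fin 3) {t : ℝ} (ht : t ∈ I01) :
    gaugeβ g (x.β i) t = x.β i 0 := by
  rw [eq_of_hasDerivWithinAt_zero (f := gaugeβ g (x.β i)) (fun t ht => ?_) t ht]
  · simp [gaugeβ, hg.zero]
  · refine (((hg.hasDerivWithinAt ht).fun_mul (x.deriv_β i ht)).fun_mul
      (hasDerivWithinAt_coe_inv (hg.hasDerivWithinAt ht))).congr_deriv ?_
    have e : (((g t)⁻¹ : GL (Fin n) ℂ) : Mat n) * (g t : Mat n) = 1 := Units.inv_mul _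
    generalize (((g t)⁻¹ : GL (Fin n) ℂ) : Mat n) = k at *
    have e2 : k * ((2 : ℝ) • ((g t : Mat n) * x.α t)) = (2 : ℝ) • x.α t := by
      rw [mul_smul_comm, ← mul_assoc, e, one_mul]
    rw [e2, Ring.lie_def]
    simp only [smul_mul_assoc, mul_smul_comm, mul_neg, mul_sub, add_mul, neg_mul, sub_mul,
      mul_assoc, smul_sub]
    abel

end IsTrivializing

theorem Solution.exists_isTrivializing (hG : IsCompactConnectedUnitary G) (x : Solution G) :
    ∃ g, IsTrivializing x g := by
  classical
  have hα := x.α_smooth.continuousOn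
  obtain ⟨h, h0, hd⟩ := exists_linear_ode
    (A := fun t => (2 : ℝ) • (ContinuousLinearMap.mul ℝ (Mat n)).flip (x.α t)) (by fun_prop) 1
  -- the inverse of `h` is the solution of `k' = -2αk`
  obtain ⟨k, k0, kd⟩ := exists_linear_ode
    (A := fun t => -((2 : ℝ) • ContinuousLinearMap.mul ℝ (Mat n) (x.α t))) (by fun_prop) 1
  have hd' : ∀ t ∈ I01, HasDerivWithinAt h ((2 : ℝ) • (h t * x.α t)) I01 t := hd
  have kd' : ∀ t ∈ I01, HasDerivWithinAt k (-((2 : ℝ) • (x.α t * k t))) I01 t := kd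
  have hk : ∀ t ∈ I01, h t * k t = 1 := by
    intro t ht
    rw [eq_of_hasDerivWithinAt_zero (f := fun t => h t * k t) (fun t ht => ?_) t ht]
    · simp [h0, k0]
    · refine ((hd' t ht).fun_mul (kd' t ht)).congr_deriv ?_
      simp only [smul_mul_assoc, mul_neg, mul_smul_comm, mul_assoc, add_neg_cancel]
  -- the values outside `[0,1]` are irrelevant
  let g : ℝ → GL (Fin n) ℂ := fun t => if ht : t ∈ I01 then
    ⟨h t, k t, hk t ht, mul_eq_one_comm.1 (hk t ht)⟩ else 1
  have hg : ∀ t ∈ I01, (g t : Mat n) = h t := by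
    intro t ht
    have : g t = ⟨h t, k t, hk t ht, mul_eq_one_comm.1 (hk t ht)⟩ := dif_pos ht
    rw [this]
  refine ⟨g, IsTrivializing.of_hasDerivWithinAt hG (fun t ht => ?_)
    (Units.ext ((hg 0 (by simp)).trans h0))⟩
  rw [hg t ht]
  exact (hd' t ht).congr hg (hg t ht)

end Trivialization

/-! ### The moduli space -/

section Moduli

attribute [local instance] matNormedRing matNormedAlgebra

open scoped Matrix ContDiff

variable {n : ℕ} {G : Subgroup (GL (Fin n) ℂ)}

/-- A trivialization of `x` gives one of every gauge transform of `x`. -/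
theorem IsTrivializing.of_gaugeEquiv (hG : IsCompactConnectedUnitary G) {x y : Solution G}
    {g u : ℝ → GL (Fin n) ℂ} (hg : IsTrivializing x g) (hu : IsBasedGauge G u)
    (h : ∀ t ∈ I01, y.α t = gaugeα u x.α t) : IsTrivializing y fun t => g t * (u t)⁻¹ := by
  refine IsTrivializing.of_hasDerivWithinAt hG (fun t ht => ?_) (by simp [hg.zero, hu.zero])
  simp only [Units.val_mul]
  have hud := hasDerivWithinAt_coe_inv (hu.isClass.hasDerivWithinAt (by simp) ht)
  refine ((hg.hasDerivWithinAt ht).fun_mul hud).congr_deriv ?_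
  rw [h t ht, gaugeα]
  have e : (((u t)⁻¹ : GL (Fin n) ℂ) : Mat n) * (u t : Mat n) = 1 := Units.inv_mul _
  generalize (((u t)⁻¹ : GL (Fin n) ℂ) : Mat n) = v at *
  rw [mul_sub, smul_sub]
  have e1 : (g t : Mat n) * v * ((u t : Mat n) * x.α t * v) = g t * x.α t * v := by
    calc _ = (g t : Mat n) * (v * (u t : Mat n)) * x.α t * v := by noncomm_ring
      _ = _ := by rw [e, mul_one]
  rw [e1, mul_smul_comm, smul_smul, smul_mul_assoc]
  norm_num
  simp only [mul_assoc, sub_eq_add_neg]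

theorem IsBasedGauge.gaugeβ_zero {u : ℝ → GL (Fin n) ℂ} (hu : IsBasedGauge G u) (β : ℝ → Mat n) :
    gaugeβ u β 0 = β 0 := by
  simp [gaugeβ, hu.zero]

/-- The logarithmic derivative of a unitary path is skew-Hermitian. -/
theorem conjTranspose_eq_neg_of_unitary {u : ℝ → GL (Fin n) ℂ} {A : ℝ → Mat n}
    (hd : ∀ t ∈ I01, HasDerivWithinAt (fun t => (u t : Mat n)) (u t * A t) I01 t)
    (hun : ∀ t ∈ I01, (u t : Mat n)ᴴ = (((u t)⁻¹ : GL (Fin n) ℂ) : Mat n)) :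
    ∀ t ∈ I01, (A t)ᴴ = -A t := by
  intro t ht
  have h1 := (hasDerivWithinAt_conjTranspose (hd t ht)).fun_mul (hd t ht)
  have h2 : ∀ t ∈ I01, (u t : Mat n)ᴴ * (u t : Mat n) = 1 := fun t ht => by
    rw [hun t ht]; exact Units.inv_mul _
  have h3 := (uniqueDiffOn_Icc zero_lt_one t ht).eq_deriv I01 h1
    ((hasDerivWithinAt_const t I01 (1 : Mat n)).congr h2 (h2 t ht))
  rw [Matrix.conjTranspose_mul, mul_assoc, h2 t ht, ← mul_assoc, h2 t ht, mul_one, one_mul] at h3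
  exact eq_neg_of_add_eq_zero_left h3

/-- A tangent path of the complexified group which is unitary lies in `G` if it starts there. -/
theorem TangentPath.mem_of_unitary (hG : IsCompactConnectedUnitary G) {u : ℝ → GL (Fin n) ℂ}
    (hu : TangentPath G u) (h0 : u 0 ∈ G)
    (hun : ∀ t ∈ I01, (u t : Mat n)ᴴ = (((u t)⁻¹ : GL (Fin n) ℂ) : Mat n)) :
    ∀ t ∈ I01, u t ∈ G := by
  obtain ⟨A, hA, hAV, hd⟩ := hu.deriv
  have hskew := conjTranspose_eq_neg_of_unitary hd hun
  let _ : LieRing (Mat n) := LieRing.ofAssociativeRing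
  exact mem_subgroup_of_path (realLie hG) (H := G) (fun ζ hζ g hg => by
    have : g = expGL ζ := Units.ext hg
    rw [this]; simpa using mem_lieAlg_iff.1 hζ 1) hd
    (fun t ht => mem_lieAlg_of_skew hG (hAV t ht) (hskew t ht)) hA h0

/-- Solutions with the same `g(1)` and `β(0)` are gauge equivalent. The gauge transformation between
them is the quotient `u = k⁻¹g` of their trivializations; it is the identity at both ends, hence
unitary by convexity, hence a path in `G`. -/
theorem gaugeEquiv_of_end_eq (hG : IsCompactConnectedUnitary G) {x y : Solution G}
    {g k : ℝ → GL (Fin n) ℂ} (hg : IsTrivializing x g) (hk : IsTrivializing y k) (h1 : g 1 = k 1)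
    (hβ : ∀ i, x.β i 0 = y.β i 0) : GaugeEquiv x y := by
  set u : ℝ → GL (Fin n) ℂ := fun t => (k t)⁻¹ * g t with hu
  have huT : TangentPath G u := ((hk.tangentPath hG).inv hG).mul hG (hg.tangentPath hG)
  have hki : ∀ t, (((k t)⁻¹ : GL (Fin n) ℂ) : Mat n) * (k t : Mat n) = 1 := fun t => Units.inv_mul _
  have hgi : ∀ t, (((g t)⁻¹ : GL (Fin n) ℂ) : Mat n) * (g t : Mat n) = 1 := fun t => Units.inv_mul _
  -- stated for all pairs, so as to apply to `u` and to `u⁻¹`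
  have key : ∀ {x y : Solution G} {g k : ℝ → GL (Fin n) ℂ}, IsTrivializing x g →
      IsTrivializing y k → ∀ t ∈ I01,
      HasDerivWithinAt (fun t => (((k t)⁻¹ * g t : GL (Fin n) ℂ) : Mat n))
        ((2 : ℝ) • ((((k t)⁻¹ * g t : GL (Fin n) ℂ) : Mat n) * x.α t
          - y.α t * (((k t)⁻¹ * g t : GL (Fin n) ℂ) : Mat n))) I01 t := by
    intro x y g k hg hk t ht
    simp only [Units.val_mul]
    refine ((hasDerivWithinAt_coe_inv (hk.hasDerivWithinAt ht)).fun_mul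
      (hg.hasDerivWithinAt ht)).congr_deriv ?_
    have e : (((k t)⁻¹ : GL (Fin n) ℂ) : Mat n) * (k t : Mat n) = 1 := Units.inv_mul _
    generalize (((k t)⁻¹ : GL (Fin n) ℂ) : Mat n) = v at *
    have e2 : v * ((2 : ℝ) • ((k t : Mat n) * y.α t)) = (2 : ℝ) • y.α t := by
      rw [mul_smul_comm, ← mul_assoc, e, one_mul]
    rw [e2]
    simp only [smul_mul_assoc, mul_smul_comm, neg_mul, smul_sub, mul_assoc]
    abel
  have hint : ∀ i, ∀ t ∈ I01, (u t : Mat n) * x.β i t = y.β i t * (u t : Mat n) := by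
    intro i t ht
    have e1 := (hg.gaugeβ_eq i ht).trans ((hβ i).trans (hk.gaugeβ_eq i ht).symm)
    simp only [gaugeβ] at e1
    simp only [hu, Units.val_mul]
    calc _ = (((k t)⁻¹ : GL (Fin n) ℂ) : Mat n) * ((g t : Mat n) * x.β i t
          * (((g t)⁻¹ : GL (Fin n) ℂ) : Mat n)) * (g t : Mat n) := by
          simp only [mul_assoc, hgi, mul_one]
      _ = ((((k t)⁻¹ : GL (Fin n) ℂ) : Mat n) * (k t : Mat n)) * y.β i t
          * ((((k t)⁻¹ : GL (Fin n) ℂ) : Mat n) * (g t : Mat n)) := by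
          rw [e1]; simp only [mul_assoc]
      _ = _ := by rw [hki, one_mul]
  have hud : ∀ t ∈ I01, HasDerivWithinAt (fun t => (u t : Mat n))
      ((2 : ℝ) • ((u t : Mat n) * x.α t - y.α t * (u t : Mat n))) I01 t := key hg hk
  have hu0 : u 0 = 1 := by simp [hu, hg.zero, hk.zero]
  have hu1 : u 1 = 1 := by simp [hu, h1]
  have hunit : ∀ t ∈ I01, (u t : Mat n)ᴴ = (((u t)⁻¹ : GL (Fin n) ℂ) : Mat n) := by
    intro t ht
    refine conjTranspose_eq_of_real_eq (u := fun t => (u t : Mat n))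
      (w := fun t => (((u t)⁻¹ : GL (Fin n) ℂ) : Mat n)) hud (fun t ht => ?_)
      (fun t ht => x.deriv_real ht) (fun t ht => y.deriv_real ht) hint
      (fun t _ => Units.inv_mul _) (by simp [hu0]) (by simp [hu1]) ht
    have e : ∀ t, (u t)⁻¹ = (g t)⁻¹ * k t := fun t => by simp [hu]
    simp only [e]
    exact key hk hg t ht
  have hmem := huT.mem_of_unitary hG (by rw [hu0]; exact one_mem _) hunit
  refine ⟨u, ⟨⟨hmem, by simpa only [hu, Units.val_mul] using hk.isClass.inv.mul hg.isClass⟩,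
    hu0, hu1⟩, fun t ht => ⟨?_, fun i => ?_⟩⟩
  · rw [gaugeα, D_eq_of_hasDerivWithinAt ht (hud t ht), smul_mul_assoc, smul_smul, sub_mul]
    have e : (u t : Mat n) * (((u t)⁻¹ : GL (Fin n) ℂ) : Mat n) = 1 := Units.mul_inv _
    rw [mul_assoc (y.α t), e, mul_one]
    norm_num
  · rw [gaugeβ, hint i t ht, mul_assoc, Units.mul_inv, mul_one]

end Moduli

section Moduli

attribute [local instance] matNormedRing matNormedAlgebra

open scoped Matrix ContDiff

variable {n : ℕ} {G : Subgroup (GL (Fin n) ℂ)}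

theorem conjTranspose_eq_inv (hG : IsCompactConnectedUnitary G) {u : GL (Fin n) ℂ} (hu : u ∈ G) :
    (u : Mat n)ᴴ = ((u⁻¹ : GL (Fin n) ℂ) : Mat n) := by
  have h : (u : Mat n)ᴴ * (u : Mat n) = 1 := Matrix.mem_unitaryGroup_iff'.1 (hG.unitary u hu)
  rw [← mul_one (u : Mat n)ᴴ, ← Units.mul_inv u, ← mul_assoc, h, one_mul]

/-- The real equation after transforming a solution `(p, c)` in Hermitian gauge by a unitary path
`u = w⁻¹` with `u' = ua`. -/
theorem real_eq_of_unitary (w u a p : Mat n) (c : Fin 3 → Mat n) (hu : uᴴ = w) (hwu : u * w = 1)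
    (ha : aᴴ = -a) (hp : pᴴ = p) :
    (2 : ℝ) • (-(a * w) * p * u + w * (-∑ i, ⁅c i, (c i)ᴴ⁆) * u + w * p * (u * a))
      + (2 : ℝ) • (⁅w * p * u + (1 / 2 : ℝ) • a, (w * p * u + (1 / 2 : ℝ) • a)ᴴ⁆
        + ∑ i, ⁅w * c i * u, (w * c i * u)ᴴ⁆) = 0 := by
  have hw : wᴴ = u := by rw [← hu, Matrix.conjTranspose_conjTranspose]
  have e1 : (w * p * u + (1 / 2 : ℝ) • a)ᴴ = w * p * u - (1 / 2 : ℝ) • a := by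
    rw [Matrix.conjTranspose_add, Matrix.conjTranspose_mul, Matrix.conjTranspose_mul, hu, hp, hw,
      Matrix.conjTranspose_smul, star_trivial, ha, smul_neg, ← sub_eq_add_neg, mul_assoc]
  have e2 : ∀ i, ⁅w * c i * u, (w * c i * u)ᴴ⁆ = w * ⁅c i, (c i)ᴴ⁆ * u := fun i => by
    rw [Matrix.conjTranspose_mul, Matrix.conjTranspose_mul, hu, hw, Ring.lie_def, Ring.lie_def]
    calc _ = w * c i * (u * w) * (c i)ᴴ * u - w * (c i)ᴴ * (u * w) * c i * u := by noncomm_ring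
      _ = _ := by rw [hwu]; noncomm_ring
  have e3 : w * (-∑ i, ⁅c i, (c i)ᴴ⁆) * u = -∑ i, w * ⁅c i, (c i)ᴴ⁆ * u := by
    rw [mul_neg, neg_mul, Finset.mul_sum, Finset.sum_mul]
  rw [e1, Finset.sum_congr rfl fun i _ => e2 i, e3, Ring.lie_def, ← smul_add]
  have e4 : w * p * (u * a) = w * p * u * a := by rw [← mul_assoc]
  have e5 : -(a * w) * p * u = -(a * (w * p * u)) := by simp only [neg_mul, mul_assoc]
  rw [e4, e5]
  generalize w * p * u = q
  have e6 : (q + (1 / 2 : ℝ) • a) * (q - (1 / 2 : ℝ) • a)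
      - (q - (1 / 2 : ℝ) • a) * (q + (1 / 2 : ℝ) • a) = a * q - q * a := by
    simp only [mul_add, add_mul, mul_sub, sub_mul, mul_smul_comm, smul_mul_assoc]
    module
  rw [e6]
  refine smul_eq_zero_of_right _ ?_
  abel

/-- The complex equation after transforming `(p, c)` by a path `u = w⁻¹` with `u' = ua`. -/
theorem complex_eq_of_unitary (w u a p c : Mat n) (hwu : u * w = 1) :
    -(a * w) * c * u + w * (-((2 : ℝ) • ⁅p, c⁆)) * u + w * c * (u * a)
      + (2 : ℝ) • ⁅w * p * u + (1 / 2 : ℝ) • a, w * c * u⁆ = 0 := by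
  have e1 : ⁅w * p * u, w * c * u⁆ = w * ⁅p, c⁆ * u := by
    rw [Ring.lie_def, Ring.lie_def]
    calc _ = w * p * (u * w) * c * u - w * c * (u * w) * p * u := by noncomm_ring
      _ = _ := by rw [hwu]; noncomm_ring
  have e2 : ⁅w * p * u + (1 / 2 : ℝ) • a, w * c * u⁆
      = w * ⁅p, c⁆ * u + (1 / 2 : ℝ) • (a * (w * c * u) - w * c * u * a) := by
    rw [← e1, Ring.lie_def, Ring.lie_def]
    simp only [mul_add, add_mul, mul_smul_comm, smul_mul_assoc, smul_sub]
    abel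
  rw [e2]
  have e4 : w * c * (u * a) = w * c * u * a := by rw [← mul_assoc]
  have e5 : -(a * w) * c * u = -(a * (w * c * u)) := by simp only [neg_mul, mul_assoc]
  rw [e4, e5, mul_neg, neg_mul, mul_smul_comm, smul_mul_assoc]
  module

/-- A solution `y` in Hermitian gauge and a smooth path `u` in `G` from the identity yield a smooth
solution, trivialized by `hu`. -/
theorem HermitianNahm.exists_solution (hG : IsCompactConnectedUnitary G) {τ : Fin 3 → Mat n}
    {y : ℝ → NahmSpace n} (hτ : ∀ i, τ i ∈ lieAlgC G) (hcomm : ∀ i j, ⁅τ i, τ j⁆ = 0)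
    (hy : HermitianNahm G τ y) {u : ℝ → GL (Fin n) ℂ} (huG : ∀ t, u t ∈ G) (hu0 : u 0 = 1)
    (hus : IsClass ⊤ (fun t => (u t : Mat n))) (huT : TangentPath G u) :
    ∃ (x : Solution G) (g : ℝ → GL (Fin n) ℂ), IsTrivializing x g ∧
      (g 1 : Mat n) = (y 1).2.2.1 * u 1 ∧ ∀ i, x.β i 0 = τ i := by
  obtain ⟨h, hhT, hh0, hhy⟩ := hy.exists_tangentPath hG hτ
  obtain ⟨A, hA, hAV, hud⟩ := huT.deriv
  have hwu : ∀ t, (u t : Mat n) * (((u t)⁻¹ : GL (Fin n) ℂ) : Mat n) = 1 := fun t => Units.mul_inv _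
  have huw : ∀ t, (((u t)⁻¹ : GL (Fin n) ℂ) : Mat n) * (u t : Mat n) = 1 := fun t => Units.inv_mul _
  have hct : ∀ t, (u t : Mat n)ᴴ = (((u t)⁻¹ : GL (Fin n) ℂ) : Mat n) := fun t =>
    conjTranspose_eq_inv hG (huG t)
  have hskew := conjTranspose_eq_neg_of_unitary hud fun t _ => hct t
  have hwd : ∀ t ∈ I01, HasDerivWithinAt (fun t => (((u t)⁻¹ : GL (Fin n) ℂ) : Mat n))
      (-(A t * (((u t)⁻¹ : GL (Fin n) ℂ) : Mat n))) I01 t := fun t ht =>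
    (hasDerivWithinAt_coe_inv (hud t ht)).congr_deriv (by rw [← mul_assoc, huw, one_mul])
  set w : ℝ → Mat n := fun t => (((u t)⁻¹ : GL (Fin n) ℂ) : Mat n) with hw
  have hDu : ∀ t ∈ I01, w t * D (fun s => (u s : Mat n)) t = A t := fun t ht => by
    rw [D_eq_of_hasDerivWithinAt ht (hud t ht), ← mul_assoc, huw, one_mul]
  have hys := isClass_of_contDiffOn (k := ⊤) (contDiff_fst.comp_contDiffOn hy.contDiffOn)
  have hyβs : ∀ i, IsClass ⊤ (fun t => (y t).2.1 i) := fun i =>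
    isClass_of_contDiffOn (contDiffOn_pi.1
      (contDiff_fst.comp_contDiffOn (contDiff_snd.comp_contDiffOn hy.contDiffOn)) i)
  have hws : IsClass ⊤ w := hus.inv
  -- the logarithmic derivative `A` of `u` is written as `w u'`, which is visibly smooth
  set α : ℝ → Mat n := fun t => w t * (y t).1 * u t
    + (1 / 2 : ℝ) • (w t * D (fun s => (u s : Mat n)) t) with hα
  set β : Fin 3 → ℝ → Mat n := fun i t => w t * (y t).2.1 i * u t with hβ
  have hα' : ∀ t ∈ I01, α t = w t * (y t).1 * u t + (1 / 2 : ℝ) • A t := fun t ht => by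
    simp only [hα, hDu t ht]
  have hβd : ∀ i, ∀ t ∈ I01, HasDerivWithinAt (β i) (-(A t * w t) * (y t).2.1 i * u t
      + w t * (-((2 : ℝ) • ⁅(y t).1, (y t).2.1 i⁆)) * u t
      + w t * (y t).2.1 i * (u t * A t)) I01 t :=
    fun i t ht => (((hwd t ht).fun_mul (hy.deriv_β i ht)).fun_mul (hud t ht)).congr_deriv
      (by rw [add_mul])
  have hsum : ∀ t ∈ I01, α t + (α t)ᴴ = (2 : ℝ) • (w t * (y t).1 * u t) := fun t ht => by
    have hwt : (w t)ᴴ = u t := by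
      simp only [hw]; rw [← hct t, Matrix.conjTranspose_conjTranspose]
    rw [hα' t ht, Matrix.conjTranspose_add, Matrix.conjTranspose_mul, Matrix.conjTranspose_mul,
      hct t, hy.α_herm t ht, hwt, Matrix.conjTranspose_smul, star_trivial, hskew t ht, smul_neg,
      ← mul_assoc, two_smul]
    simp only [hw]
    abel
  have hsumd : ∀ t ∈ I01, HasDerivWithinAt (fun t => α t + (α t)ᴴ)
      ((2 : ℝ) • (-(A t * w t) * (y t).1 * u t
        + w t * (-∑ i, ⁅(y t).2.1 i, ((y t).2.1 i)ᴴ⁆) * u t + w t * (y t).1 * (u t * A t))) I01 t :=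
    fun t ht => ((((hwd t ht).fun_mul (hy.deriv_α ht)).fun_mul (hud t ht)).const_smul
      (2 : ℝ)).congr_deriv (by rw [add_mul]) |>.congr hsum (hsum t ht)
  let x : Solution G :=
    { α := α
      β := β
      α_mem := fun t ht => by
        rw [hα' t ht]
        exact (complexLieSpace hG).add_mem (conj_mem_lieAlgC' hG (subset_complexification (huG t))
          (mem_nahmSubspace.1 (hy.mem hG hτ t ht)).1) ((complexLieSpace hG).smul_mem _ (hAV t ht))
      β_mem := fun i t ht => conj_mem_lieAlgC' hG (subset_complexification (huG t))
          ((mem_nahmSubspace.1 (hy.mem hG hτ t ht)).2 i)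
      α_smooth := isClass_iff_contDiffOn.2
        ((isClass_iff_contDiffOn.1 ((hws.mul hys).mul hus)).add
          (contDiff_const_smul (1 / 2 : ℝ) |>.comp_contDiffOn
            (isClass_iff_contDiffOn.1 (hws.mul (isClass_D hus)))))
      β_smooth := fun i => (hws.mul (hyβs i)).mul hus
      complex_eq := fun i t ht => by
        rw [D_eq_of_hasDerivWithinAt ht (hβd i t ht), hα' t ht]
        exact complex_eq_of_unitary _ _ _ _ _ (hwu t)
      comm := fun i j t ht => by
        have e : ∀ i, β i t = (w t * (y t).2.2.2) * τ i * ((y t).2.2.1 * u t) := fun i => by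
          simp only [hβ]; rw [hy.β_eq i t ht]; simp only [mul_assoc]
        have e2 : ((y t).2.2.1 * u t) * (w t * (y t).2.2.2) = 1 := by
          rw [mul_assoc, ← mul_assoc (u t : Mat n), hwu, one_mul, hy.h_mul_k t ht]
        have e3 := hcomm i j
        rw [Ring.lie_def] at e3
        rw [e, e, Ring.lie_def]
        generalize w t * (y t).2.2.2 = a at *
        generalize (y t).2.2.1 * (u t : Mat n) = b at *
        calc _ = a * τ i * (b * a) * τ j * b - a * τ j * (b * a) * τ i * b := by noncomm_ring
          _ = a * (τ i * τ j - τ j * τ i) * b := by rw [e2]; noncomm_ring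
          _ = 0 := by rw [e3, mul_zero, zero_mul]
      real_eq := fun t ht => by
        rw [D_eq_of_hasDerivWithinAt ht (hsumd t ht), hα' t ht]
        exact real_eq_of_unitary _ _ _ _ _ (hct t) (hwu t) (hskew t ht) (hy.α_herm t ht) }
  refine ⟨x, fun t => h t * u t, IsTrivializing.of_hasDerivWithinAt hG (fun t ht => ?_)
    (by simp [hh0, hu0]), ?_, fun i => ?_⟩
  · obtain ⟨B, -, -, hhd⟩ := hhT.deriv
    have hhd' : HasDerivWithinAt (fun t => (h t : Mat n))
        ((2 : ℝ) • ((h t : Mat n) * (y t).1)) I01 t := by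
      rw [(hhy t ht).1]
      exact (hy.deriv_h ht).congr (fun t ht => (hhy t ht).1) (hhy t ht).1
    simp only [Units.val_mul]
    refine (hhd'.fun_mul (hud t ht)).congr_deriv ?_
    change _ = (2 : ℝ) • ((h t : Mat n) * (u t : Mat n) * α t)
    rw [hα' t ht]
    have e : (h t : Mat n) * (u t : Mat n) * (w t * (y t).1 * u t) = h t * (y t).1 * u t := by
      calc _ = (h t : Mat n) * ((u t : Mat n) * w t) * (y t).1 * u t := by noncomm_ring
        _ = _ := by rw [hwu, mul_one]
    rw [mul_add, e, mul_smul_comm, smul_add, smul_smul, smul_mul_assoc]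
    norm_num [mul_assoc]
  · rw [Units.val_mul, (hhy 1 (by simp)).1]
  · change w 0 * (y 0).2.1 i * u 0 = τ i
    simp [hw, hu0, hy.β_zero]

/-- Surjectivity: the solution in Hermitian gauge reaches the coset `gG`, and a smooth path in `G`
corrects its end point to `g`. -/
theorem exists_solution_of_mem (hG : IsCompactConnectedUnitary G) {g : GL (Fin n) ℂ}
    {τ : Fin 3 → Mat n} (h : (g, τ) ∈ commutingTriples G) :
    ∃ (x : Solution G) (k : ℝ → GL (Fin n) ℂ), IsTrivializing x k ∧ k 1 = g ∧
      ∀ i, x.β i 0 = τ i := by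
  obtain ⟨hg, hτ, hcomm⟩ := h
  obtain ⟨y, hy, k, hk, hend⟩ := exists_hermitianNahm hG hτ hg
  obtain ⟨u, huG, hu0, hu1, hus, huT⟩ := mem_smoothlyReachable hG (G.inv_mem hk)
  obtain ⟨x, h, hx, hh1, hβ⟩ := hy.exists_solution hG hτ hcomm huG hu0 hus huT
  refine ⟨x, h, hx, Units.ext ?_, hβ⟩
  rw [hh1, hend, hu1, mul_assoc, Units.mul_inv, mul_one]

end Moduli

end OctonionicNahm

theorem mainTheorem3 {n : ℕ} (G : Subgroup (GL (Fin n) ℂ))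
    (hG : OctonionicNahm.IsCompactConnectedUnitary G) :
    ∃ Θ : OctonionicNahm.ModuliSpace G → OctonionicNahm.commutingTriples G,
      (∀ x : OctonionicNahm.Solution G, ∃ g : ℝ → GL (Fin n) ℂ,
        OctonionicNahm.IsTrivializing x g ∧
        (∀ g' : ℝ → GL (Fin n) ℂ, OctonionicNahm.IsTrivializing x g' →
          Set.EqOn g' g (Set.Icc 0 1)) ∧
        (Θ x.toModuli).1.1 = g 1 ∧
        ∀ i, ∀ t ∈ Set.Icc (0 : ℝ) 1,
          (Θ x.toModuli).1.2 i = OctonionicNahm.gaugeβ g (x.β i) t) ∧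
      Function.Bijective Θ := by
  choose triv htriv using fun x : OctonionicNahm.Solution G => x.exists_isTrivializing hG
  -- `gβg⁻¹` is constant, so it may be evaluated at `0`, where `g = 1`
  let θ : OctonionicNahm.Solution G → OctonionicNahm.commutingTriples G := fun x =>
    ⟨(triv x 1, fun i => x.β i 0), (htriv x).mem 1 (by simp), fun i => x.β_mem i 0 (by simp),
      fun i j => x.comm i j 0 (by simp)⟩
  have hθ : ∀ x g, OctonionicNahm.IsTrivializing x g → (θ x).1.1 = g 1 := fun x g hg =>
    (htriv x).eqOn hg (by simp)
  -- if `u` takes `x` to `y` and `g` trivializes `x`, then `gu⁻¹` trivializes `y`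
  have hwd : ∀ x y, OctonionicNahm.GaugeEquiv x y → θ x = θ y := by
    rintro x y ⟨u, hu, h⟩
    refine Subtype.ext (Prod.ext ?_ (funext fun i => ?_))
    · rw [hθ y _ ((htriv x).of_gaugeEquiv hG hu fun t ht => (h t ht).1)]
      simp [hu.one, θ]
    · exact (hu.gaugeβ_zero _).symm.trans ((h 0 (by simp)).2 i).symm
  refine ⟨Quotient.lift θ hwd, fun x => ⟨triv x, htriv x, fun g' hg' => hg'.eqOn (htriv x), rfl,
    fun i t ht => ((htriv x).gaugeβ_eq i ht).symm⟩, ?_, ?_⟩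
  · rintro ⟨x⟩ ⟨y⟩ h
    have h' : θ x = θ y := h
    have h1 := congrArg Subtype.val h'
    exact Quotient.sound (OctonionicNahm.gaugeEquiv_of_end_eq hG (htriv x) (htriv y)
      (congrArg Prod.fst h1) fun i => congrFun (congrArg Prod.snd h1) i)
  · rintro ⟨⟨g, τ⟩, h⟩
    obtain ⟨x, k, hk, hk1, hβ⟩ := OctonionicNahm.exists_solution_of_mem hG h
    refine ⟨x.toModuli, Subtype.ext (Prod.ext ?_ (funext fun i => hβ i))⟩
    exact (hθ x k hk).trans hk1
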